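/- **Setting.** Let $d\in\{2,3\}$, let $\Omega\subset\mathbb R^d$ be open and bounded (polygonal/polyhedral, which is implied by the existence of the meshes below), and let $T>0$, $Q=(0,T)\times\Omega$. Let $u_0\in L^\infty(\Omega)$, let $S$ be measurable on $Q$ with $\int_0^T\|S(t,\cdot)\|_{L^\infty(\Omega)}dt<\infty$, and put $M=\|u_0\|_{L^\infty}+\int_0^T\|S(t,\cdot)\|_{L^\infty}dt$. Let $\mathfrak a(\xi)=k(\xi)\xi$ be continuous and strictly monotone on $\mathbb R^d$, where for some $p\in(1,\infty)$, $c>0$ one has $\frac1c|\xi|^{p-2}\le k(\xi)\le c|\xi|^{p-2}$ for $\xi\ne0$. Let $A:\mathbb R\to\mathbb R$ be continuous and nondecreasing with $A(0)=0$, and let $\mathfrak f:\mathbb R\to\mathbb R^d$ be continuous with $\mathfrak f(0)=0$ and with a concave continuous modulus of continuity $\omega_M$ on $[-M,M]$ ($\omega_M$ defined on $[0,2M]$, $\omega_M(0)=0$). **Mesh.** $\mathfrak M$ is a finite conforming partition of $\Omega$, up to a null set, into disjoint open simplices $K$ contained in $\Omega$ (closed simplices meet along common faces). $\partial\mathfrak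 M$ is the set of faces of control volumes contained in $\partial\Omega$. The centre $x_K$ is the circumcentre of the simplex, resp. of the face. Two control volumes of $\mathfrak M$ sharing a face not contained in $\partial\Omega$ are neighbours, and a simplex is a neighbour of each of its boundary faces; $K|L$ is the common face, $d_{KL}=|x_K-x_L|$, and $\nu_{KL}=(x_L-x_K)/d_{KL}$ is normal to $K|L$. Assume: (Delaunay) the open circumscribed ball of a simplex contains no vertex of a neighbouring simplex, and neighbouring simplices have distinct centres; at each boundary face of $K$, $x_K$ lies strictly on the same side of the face as $K$; if $d=3$, each face contains its circumcentre. To each vertex $x_{K^*}$ of the mesh corresponds the dual volume $K^*$, the set of points of $\Omega$ closer to $x_{K^*}$ than to any other vertex, for the distance given by the infimum of the lengths of paths within $\overline\Omega$; $K^*\in\mathfrak M^*$ if $x_{K^*}\in\Omega$ and $K^*\in\partial\mathfrak M^*$ if $x_{K^*}\in\partial\Omega$. Vertices of a common simplex are dual neighbours; $d_{K^*L^*}=|x_{K^*}-x_{L^*}|$, $\nu_{K^*L^*}=(x_{L^*}-x_{K^*})/d_{K^*L^*}$. The diamond $D=D^{K,L}$ is the union (the difference, if $x_K,x_L$ are on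 the same side of $K|L$) of the pyramids with base $K|L$ and apexes $x_K,x_L$; each edge $[x_{K^*},x_{L^*}]$ of $K|L$ gives a subdiamond $s\subset D$. For $d=2$, $\sigma_s=[x_{K^*},x_{L^*}]$ and $\sigma^*_s=[x_K,x_L]$; for $d=3$, $\sigma_s$ is the triangle with summits $x_{K^*},x_{L^*}$ and the circumcentre of $K|L$, and $\sigma_s^*$ is the triangle with summits $x_K,x_L$ and the midpoint of $[x_{K^*},x_{L^*}]$. The measures are $m_s=\frac1d m_{\sigma_s}d_{KL}$, $m_D=\sum_{s\subset D}m_s$, $m_{K|L}=\sum_{s\subset D^{K,L}}m_{\sigma_s}$; $m_{K^*|L^*}$ is the sum of the $m_{\sigma^*_s}$ over all subdiamonds $s$ associated with the edge $[x_{K^*},x_{L^*}]$; and $m_K,m_{K^*},m_{K\cap K^*}$ are Lebesgue measures for $K\in\mathfrak M$ (for $K\in\partial\mathfrak M$, $m_K$ is the measure of the face). $\mathrm{size}(\mathfrak T)$ is the largest diameter of primal volumes, dual volumes and diamonds. $\mathrm{reg}(\mathfrak T)$ is the maximum of: the numbers of dual neighbours; $\mathrm{diam}(K)^d/m_K$;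 $\mathrm{diam}(K^*)^d/m_{K^*}$; $\frac{\mathrm{diam}K}{\mathrm{diam}D}+\frac{\mathrm{diam}D}{\mathrm{diam}K}$ over $K\cap D\ne\emptyset$; and $\frac{\mathrm{diam}K^*}{\mathrm{diam}D}+\frac{\mathrm{diam}D}{\mathrm{diam}K^*}$ over $K^*\cap D\neq\emptyset$ (boundary volumes included, a boundary face being taken relatively open). **Discrete operators.** For values $w_K$ ($K\in\mathfrak M\cup\partial\mathfrak M$), $w_{K^*}$ ($K^*\in\mathfrak M^*\cup\partial\mathfrak M^*$) and vectors $F_D$ set $$\nabla_Dw=\frac{w_L-w_K}{d_{KL}}\nu_{KL}+\frac{d-1}{m_D}\sum_{s\subset D}m_s\frac{w_{L^*}-w_{K^*}}{d_{K^*L^*}}\nu_{K^*L^*},$$ $$(\mathrm{div}F)_K=\frac1{m_K}\sum_{s}m_{\sigma_s}F_D\cdot\nu_K,\qquad(\mathrm{div}F)_{K^*}=\frac1{m_{K^*}}\sum_{s}m_{\sigma^*_s}F_D\cdot\nu_{K^*},$$ with sums over the subdiamonds $s\subset D$ whose $\sigma_s$ (resp. $\sigma^*_s$) is part of an interface of $K$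 (resp. $K^*$), $\nu_K,\nu_{K^*}$ being exterior unit normals; $$\mathcal P[w]_K=\frac{d-1}{\mathrm{size}(\mathfrak T)\,m_K}\sum_{K^*\in\mathfrak M^*\cup\partial\mathfrak M^*}m_{K\cap K^*}(w_K-w_{K^*}),\qquad \mathcal P[w]_{K^*}=\frac1{\mathrm{size}(\mathfrak T)\,m_{K^*}}\sum_{K\in\mathfrak M}m_{K\cap K^*}(w_{K^*}-w_K);$$ $$(\mathrm{div}_c\mathfrak f)[u]_K=\frac1{m_K}\sum_{L}m_{K|L}\,g_{K,L}(u_K,u_L),\qquad(\mathrm{div}_c\mathfrak f)[u]_{K^*}=\frac1{m_{K^*}}\sum_{L^*}m_{K^*|L^*}\,g_{K^*,L^*}(u_{K^*},u_{L^*})$$ (sums over neighbours). The numerical fluxes $g_{K,L}\in C(\mathbb R^2)$ are nondecreasing in the first and nonincreasing in the second variable and satisfy $g_{K,L}(a,a)=\mathfrak f(a)\cdot\nu_{KL}$, $g_{K,L}(a,b)=-g_{L,K}(b,a)$, and $|g_{K,L}(a,b)-g_{K,L}(a',b')|\le c'(\omega_M(|a-a'|)+\omega_M(|b-b'|))$ on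 $[-M,M]$; likewise for $g_{K^*,L^*}$. Let $$[\![a,b]\!]=\frac1d\sum_{K\in\mathfrak M}m_Ka_Kb_K+\frac{d-1}d\sum_{K^*\in\mathfrak M^*}m_{K^*}a_{K^*}b_{K^*},$$ $$I[u]=\frac1d\sum_{K|L}m_{K|L}\int_{u_K}^{u_L}\big(g_{K,L}(s,s)-g_{K,L}(u_K,u_L)\big)ds,$$ $$I^*[u]=\frac{d-1}d\sum_{K^*|L^*}m_{K^*|L^*}\int_{u_{K^*}}^{u_{L^*}}\big(g_{K^*,L^*}(s,s)-g_{K^*,L^*}(u_{K^*},u_{L^*})\big)ds,$$ with sums over all (unordered) interfaces. **Scheme.** For a time step $\Delta t>0$ let $N=\lfloor T/\Delta t\rfloor$. A discrete solution is a family $u^0,\dots,u^N$ of discrete functions such that $u^0_K$, $u^0_{K^*}$ are the mean values of $u_0$ on $K\in\mathfrak M$, $K^*\in\mathfrak M^*$, and for $n=1,\dots,N$: $u^n=0$ on $\partial\mathfrak M\cup\partial\mathfrak M^*$, and with $w^n=A(u^n)$, on $\mathfrak M\cup\mathfrak M^*$, $$\frac{u^n-u^{n-1}}{\Delta t}+(\mathrm{div}_c\mathfrak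 f)[u^n]-\mathrm{div}[\mathfrak a(\nabla w^n)]+\mathcal P[w^n]=S^n,$$ where $S^n_K$, $S^n_{K^*}$ are the mean values of $S$ on $((n-1)\Delta t,n\Delta t)\times K$ and $((n-1)\Delta t,n\Delta t)\times K^*$. For a family $v=(v^n)_{n=1}^N$ let $v^{\mathfrak M,\Delta t}$ and $v^{\mathfrak M^*,\Delta t}$ be the functions equal to $v_K^n$ on $[(n-1)\Delta t,n\Delta t)\times K$, $K\in\mathfrak M$, resp. to $v_{K^*}^n$ on $[(n-1)\Delta t,n\Delta t)\times K^*$, $K^*\in\mathfrak M^*$, and zero elsewhere (in particular for $t\ge N\Delta t$). **Proposition.** Fix all the data above, including $\omega_M$ and $c'$, and a bound $R$. There are a constant $C>0$ and a continuous nondecreasing function $\omega_A:[0,\infty)\to\mathbb R$ with $\omega_A(0)=0$ such that, for every mesh as above with $\mathrm{reg}(\mathfrak T)\le R$, every $\Delta t>0$, all numerical fluxes as above and every discrete solution $u$ (in particular uniformly in $h=\max\{\mathrm{size}(\mathfrak T),\Delta t\}$ along any family of meshes with bounded regularity constants), the following holds. (i) $\max\{\|u^{\mathfrak M,\Delta t}\|_{L^\infty(Q)},\|u^{\mathfrak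 M^*,\Delta t}\|_{L^\infty(Q)}\}\le M$. (ii) $\|\nabla w\|_{L^p(Q)}:=\Big(\sum_{n=1}^N\Delta t\sum_Dm_D|\nabla_Dw^n|^p\Big)^{1/p}\le C$ and $\sum_{n=1}^N\Delta t\,[\![\mathcal P[w^n],w^n]\!]\le C$. (iii) $\sum_{n=1}^N\Delta t\,\big(I[u^n]+I^*[u^n]\big)\le C$. (iv) For all $\delta>0$, $$\int_Q\Big(|w^{\mathfrak M,\Delta t}(t+\delta,x)-w^{\mathfrak M,\Delta t}(t,x)|+|w^{\mathfrak M^*,\Delta t}(t+\delta,x)-w^{\mathfrak M^*,\Delta t}(t,x)|\Big)\,dx\,dt\le\omega_A(\delta).$$ -/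

import Mathlib

open MeasureTheory Set
open scoped ENNReal

noncomputable section

namespace DDFV

/-- Points and vectors of `ℝ^d`, with the Euclidean norm. -/
abbrev Pt (d : ℕ) := EuclideanSpace ℝ (Fin d)

/-- Area of the triangle with summits `a`, `b`, `c`. -/
def triArea {d : ℕ} (a b c : Pt d) : ℝ :=
  Real.sqrt (‖b - a‖ ^ 2 * ‖c - a‖ ^ 2 - (inner ℝ (b - a) (c - a)) ^ 2) / 2

/-- Intrinsic distance of the closure of `Ω`: infimum of the lengths of the paths that
join `x` to `y` within `closure Ω`. -/
def geodDist {d : ℕ} (Ω : Set (Pt d)) (x y : Pt d) : ℝ≥0∞ :=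
  ⨅ (γ : Path x y) (_ : Set.range γ ⊆ closure Ω), eVariationOn γ Set.univ

/-- A conforming partition of `Ω` (up to a null set) into disjoint open `d`-simplices. -/
structure Triangulation (d : ℕ) (Ω : Set (Pt d)) where
  /-- number of control volumes -/
  n : ℕ
  /-- the control volumes (with an arbitrary labelling of their vertices) -/
  simplex : Fin n → Affine.Simplex ℝ (Pt d) d
  interior_subset : ∀ K, (simplex K).interior ⊆ Ω
  disjoint : ∀ K L, K ≠ L → Disjoint (simplex K).interior (simplex L).interior
  cover : volume (Ω \ ⋃ K, (simplex K).interior) = 0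
  conforming : ∀ K L, K ≠ L → (simplex K).closedInterior ∩ (simplex L).closedInterior =
    convexHull ℝ (Set.range (simplex K).points ∩ Set.range (simplex L).points)

namespace Triangulation

variable {d : ℕ} [NeZero d] {Ω : Set (Pt d)} (𝒯 : Triangulation d Ω)

/-! ### The primal mesh -/

/-- The face of the control volume `K` opposite to its `i`-th vertex. -/
def face (K : Fin 𝒯.n) (i : Fin (d + 1)) : Affine.Simplex ℝ (Pt d) (d - 1) :=
  (𝒯.simplex K).faceOpposite i

/-- The face is included in `∂Ω`. -/
def IsBdryFace (K : Fin 𝒯.n) (i : Fin (d + 1)) : Prop :=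
  (𝒯.face K i).closedInterior ⊆ frontier Ω

/-- Boundary control volumes `∂𝔐`: the faces of control volumes that are included in `∂Ω`. -/
abbrev BCell := {e : Fin 𝒯.n × Fin (d + 1) // 𝒯.IsBdryFace e.1 e.2}

instance : Fintype 𝒯.BCell := Fintype.ofFinite _

/-- All primal control volumes: `𝔐` (left) and `∂𝔐` (right). -/
abbrev CellBar := Fin 𝒯.n ⊕ 𝒯.BCell

/-- Centres: the circumcentre of the simplex, resp. of the boundary face. -/
def center : 𝒯.CellBar → Pt d
  | Sum.inl K => (𝒯.simplex K).circumcenter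
  | Sum.inr e => (𝒯.face e.1.1 e.1.2).circumcenter

/-- `L` is the neighbour of `K` across the face of `K` opposite to its `i`-th vertex. -/
def Adj (K : Fin 𝒯.n) (i : Fin (d + 1)) : 𝒯.CellBar → Prop
  | Sum.inl L => L ≠ K ∧ ¬ 𝒯.IsBdryFace K i ∧
      ∃ j, Set.range (𝒯.face K i).points = Set.range (𝒯.face L j).points
  | Sum.inr e => e.1 = (K, i)

/-- An interface `K|L` (equivalently, the diamond built on it): `K` and `L` are neighbours
across the face `i` of `K`. Each interface between two control volumes of `𝔐` occurs once, with
the orientation `K < L` in the enumeration of `𝔐`. -/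
structure Interface where
  K : Fin 𝒯.n
  i : Fin (d + 1)
  L : 𝒯.CellBar
  adj : 𝒯.Adj K i L
  oriented : ∀ L', L = Sum.inl L' → K < L'

instance : Finite 𝒯.Interface := by
  refine Finite.of_injective
    (fun D : 𝒯.Interface => ((D.K, D.i, D.L) : Fin 𝒯.n × Fin (d + 1) × 𝒯.CellBar)) ?_
  rintro ⟨K, i, L, h1, h2⟩ ⟨K', i', L', h1', h2'⟩ h
  simp only [Prod.mk.injEq] at h
  obtain ⟨rfl, rfl, rfl⟩ := h
  rfl

instance : Fintype 𝒯.Interface := Fintype.ofFinite _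

/-- The vertices of the mesh; they are the centres `x_{K*}` of the dual control volumes, and
index the dual mesh. -/
abbrev Vertex : Type :=
  Set.range (fun e : Fin 𝒯.n × Fin (d + 1) => (𝒯.simplex e.1).points e.2)

instance : Fintype 𝒯.Vertex := Fintype.ofFinite _

/-- The `j`-th vertex of the control volume `K`. -/
def vtx (K : Fin 𝒯.n) (j : Fin (d + 1)) : 𝒯.Vertex :=
  ⟨(𝒯.simplex K).points j, (K, j), rfl⟩

/-- Admissibility of the mesh. -/
structure IsDDFV : Prop where
  /-- Delaunay condition: the open ball circumscribed around a control volume contains no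
  vertex of a neighbouring control volume. -/
  delaunay : ∀ K i L, 𝒯.Adj K i (Sum.inl L) → ∀ j,
    (𝒯.simplex K).circumradius ≤ dist ((𝒯.simplex L).points j) (𝒯.simplex K).circumcenter
  /-- Centres of neighbouring control volumes are distinct, so that `d_{KL} > 0`. -/
  center_ne : ∀ K i L, 𝒯.Adj K i (Sum.inl L) →
    (𝒯.simplex K).circumcenter ≠ (𝒯.simplex L).circumcenter
  /-- At a boundary face, the centre of `K` lies strictly on the same side as `K`. -/
  boundary : ∀ K i, 𝒯.IsBdryFace K i →
    (affineSpan ℝ (Set.range (𝒯.face K i).points)).SSameSide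
      (𝒯.simplex K).circumcenter ((𝒯.simplex K).points i)
  /-- If `d = 3`, each face contains the centre of its circumscribed circle. -/
  face_center : d = 3 → ∀ K i, (𝒯.face K i).circumcenter ∈ (𝒯.face K i).closedInterior

/-! ### The dual mesh -/

/-- The dual control volume `K*`: points of `Ω` that are closer to the vertex `v` than to any
other vertex, for the intrinsic distance of `closure Ω`. It belongs to `𝔐*` if `v ∈ Ω`, and to
`∂𝔐*` if `v ∈ ∂Ω`. -/
def dualCell (v : 𝒯.Vertex) : Set (Pt d) :=
  {x | x ∈ Ω ∧ ∀ w : 𝒯.Vertex, w ≠ v → geodDist Ω x v.1 < geodDist Ω x w.1}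

/-- Dual neighbours: distinct vertices of a common control volume. -/
def DualNbr (v w : 𝒯.Vertex) : Prop :=
  v ≠ w ∧ ∃ K j k, 𝒯.vtx K j = v ∧ 𝒯.vtx K k = w

/-- `d_{K* L*}`. -/
def dualDist (v w : 𝒯.Vertex) : ℝ := dist v.1 w.1

/-- `ν_{K* L*}`: unit normal to the dual interface, pointing from `K*` to `L*`. -/
def dualNormal (v w : 𝒯.Vertex) : Pt d := (𝒯.dualDist v w)⁻¹ • (w.1 - v.1)

/-! ### Interfaces, diamonds and subdiamonds -/

/-- `d_{KL}`. -/
def dKL (D : 𝒯.Interface) : ℝ := dist (𝒯.center (Sum.inl D.K)) (𝒯.center D.L)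

/-- `ν_{KL}`: the line of the two circumcentres is orthogonal to the interface and, by the
Delaunay condition, oriented from `K` to `L`. -/
def normal (D : 𝒯.Interface) : Pt d :=
  (𝒯.dKL D)⁻¹ • (𝒯.center D.L - 𝒯.center (Sum.inl D.K))

/-- The edges `[x_{K*}, x_{L*}]` of the face `i` of a simplex, as pairs of labels of vertices. The
subdiamonds `S^{K,L}_{K*,L*}` of the diamond `D^{K,L}` correspond to the edges of the face `K|L`
(one edge if `d = 2`, three if `d = 3`). -/
def edges (i : Fin (d + 1)) : Finset (Fin (d + 1) × Fin (d + 1)) :=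
  Finset.univ.filter fun e => e.1 < e.2 ∧ e.1 ≠ i ∧ e.2 ≠ i

/-- Measure of the part `σ_S` of the face: the segment `x_{K*} x_{L*}` if `d = 2`, the
triangle formed by `x_{K*}`, `x_{L*}` and the circumcentre of the face if `d = 3`. -/
def mSigma (K : Fin 𝒯.n) (i : Fin (d + 1)) (e : Fin (d + 1) × Fin (d + 1)) : ℝ :=
  if d = 2 then dist ((𝒯.simplex K).points e.1) ((𝒯.simplex K).points e.2)
  else triArea ((𝒯.simplex K).points e.1) ((𝒯.simplex K).points e.2) (𝒯.face K i).circumcenter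

/-- Measure of a face: the sum of the measures of its parts `σ_S`. -/
def mFace (K : Fin 𝒯.n) (i : Fin (d + 1)) : ℝ := ∑ e ∈ edges i, 𝒯.mSigma K i e

/-- Measure of the part `σ*_S` of the dual interface `K*|L*` lying in the subdiamond: the segment
`x_K x_L` if `d = 2`, the triangle formed by `x_K`, `x_L` and the midpoint of
`x_{K*} x_{L*}` if `d = 3`. -/
def mSigmaStar (D : 𝒯.Interface) (e : Fin (d + 1) × Fin (d + 1)) : ℝ :=
  if d = 2 then 𝒯.dKL D
  else triArea (𝒯.center (Sum.inl D.K)) (𝒯.center D.L)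
    (midpoint ℝ ((𝒯.simplex D.K).points e.1) ((𝒯.simplex D.K).points e.2))

/-- Volume of the subdiamond: sum (or difference, if `x_K` and `x_L` are on the same side of
`K|L`) of the volumes of the two pyramids of base `σ_S` and of apexes `x_K`, `x_L`; their
common axis is orthogonal to `K|L`, so that this is `m_{σ_S} d_{KL} / d`. -/
def mSub (D : 𝒯.Interface) (e : Fin (d + 1) × Fin (d + 1)) : ℝ :=
  𝒯.mSigma D.K D.i e * 𝒯.dKL D / d

/-- Volume of the diamond. -/
def mDiamond (D : 𝒯.Interface) : ℝ := ∑ e ∈ edges D.i, 𝒯.mSub D e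

open Classical in
/-- Measure of the dual interface `K*|L*`: the sum of the measures of its parts `σ*_S` over all
the subdiamonds `S = S^{K,L}_{K*,L*}`. -/
def mDualFace (v w : 𝒯.Vertex) : ℝ :=
  ∑ D : 𝒯.Interface, ∑ e ∈ edges D.i,
    if (𝒯.vtx D.K e.1 = v ∧ 𝒯.vtx D.K e.2 = w) ∨ (𝒯.vtx D.K e.1 = w ∧ 𝒯.vtx D.K e.2 = v)
    then 𝒯.mSigmaStar D e else 0

/-- The pyramid (possibly degenerate) with apex `x` and base the face `i` of `K`. -/
def pyramid (K : Fin 𝒯.n) (i : Fin (d + 1)) (x : Pt d) : Set (Pt d) :=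
  convexHull ℝ (insert x (Set.range (𝒯.face K i).points))

open Classical in
/-- The diamond `D^{K,L}` as a set: the union of the two pyramids of base `K|L` and apexes `x_K`,
`x_L`, or their difference if `x_K`, `x_L` are on the same side of `K|L`. -/
def diamond (D : 𝒯.Interface) : Set (Pt d) :=
  if (affineSpan ℝ (Set.range (𝒯.face D.K D.i).points)).SSameSide
      (𝒯.center (Sum.inl D.K)) (𝒯.center D.L)
  then symmDiff (𝒯.pyramid D.K D.i (𝒯.center (Sum.inl D.K)))
    (𝒯.pyramid D.K D.i (𝒯.center D.L))
  else 𝒯.pyramid D.K D.i (𝒯.center (Sum.inl D.K)) ∪ 𝒯.pyramid D.K D.i (𝒯.center D.L)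

/-! ### Measures, size and regularity -/

/-- The control volumes of `𝔐 ∪ ∂𝔐` as sets. -/
def cellSet : 𝒯.CellBar → Set (Pt d)
  | Sum.inl K => (𝒯.simplex K).interior
  | Sum.inr e => (𝒯.face e.1.1 e.1.2).interior

/-- `m_K` for `K ∈ 𝔐`. -/
def mCell (K : Fin 𝒯.n) : ℝ := volume.real (𝒯.simplex K).interior

/-- `m_K` for `K ∈ 𝔐 ∪ ∂𝔐`, in the natural dimension of `K`. -/
def mCellBar : 𝒯.CellBar → ℝ
  | Sum.inl K => 𝒯.mCell K
  | Sum.inr e => 𝒯.mFace e.1.1 e.1.2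

/-- `m_{K*}`. -/
def mDual (v : 𝒯.Vertex) : ℝ := volume.real (𝒯.dualCell v)

/-- `m_{K ∩ K*}`. -/
def mInter (K : Fin 𝒯.n) (v : 𝒯.Vertex) : ℝ :=
  volume.real ((𝒯.simplex K).interior ∩ 𝒯.dualCell v)

/-- `size(𝒯)`, the largest diameter of the primal and dual control volumes and of the diamonds. -/
def size : ℝ :=
  max (⨆ K : 𝒯.CellBar, Metric.diam (𝒯.cellSet K))
    (max (⨆ v : 𝒯.Vertex, Metric.diam (𝒯.dualCell v))
      (⨆ D : 𝒯.Interface, Metric.diam (𝒯.diamond D)))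

open Classical in
/-- `reg(𝒯)`, the regularity constant of the mesh. -/
def reg : ℝ :=
  max (⨆ v : 𝒯.Vertex, (((Finset.univ.filter fun w => 𝒯.DualNbr v w).card : ℕ) : ℝ))
    (max (⨆ K : 𝒯.CellBar, Metric.diam (𝒯.cellSet K) ^ d / 𝒯.mCellBar K)
      (max (⨆ v : 𝒯.Vertex, Metric.diam (𝒯.dualCell v) ^ d / 𝒯.mDual v)
        (max
          (⨆ q : 𝒯.CellBar × 𝒯.Interface,
            if (𝒯.cellSet q.1 ∩ 𝒯.diamond q.2).Nonempty then
              Metric.diam (𝒯.cellSet q.1) / Metric.diam (𝒯.diamond q.2) +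
                Metric.diam (𝒯.diamond q.2) / Metric.diam (𝒯.cellSet q.1)
            else 0)
          (⨆ q : 𝒯.Vertex × 𝒯.Interface,
            if (𝒯.dualCell q.1 ∩ 𝒯.diamond q.2).Nonempty then
              Metric.diam (𝒯.dualCell q.1) / Metric.diam (𝒯.diamond q.2) +
                Metric.diam (𝒯.diamond q.2) / Metric.diam (𝒯.dualCell q.1)
            else 0))))

/-! ### Discrete functions and discrete operators -/

/-- Discrete functions on `closure Ω`: a value for each element of `𝔐 ∪ ∂𝔐` and of
`𝔐* ∪ ∂𝔐*`. -/
structure DFun where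
  primal : 𝒯.CellBar → ℝ
  dual : 𝒯.Vertex → ℝ

variable {𝒯}

/-- Composition `A(u)` of a discrete function with a real function. -/
def DFun.comp (A : ℝ → ℝ) (u : 𝒯.DFun) : 𝒯.DFun where
  primal K := A (u.primal K)
  dual v := A (u.dual v)

/-- The discrete gradient. -/
def grad (w : 𝒯.DFun) (D : 𝒯.Interface) : Pt d :=
  ((w.primal D.L - w.primal (Sum.inl D.K)) / 𝒯.dKL D) • 𝒯.normal D +
    (((d : ℝ) - 1) / 𝒯.mDiamond D) • ∑ e ∈ edges D.i,
      (𝒯.mSub D e * ((w.dual (𝒯.vtx D.K e.2) - w.dual (𝒯.vtx D.K e.1)) /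
        𝒯.dualDist (𝒯.vtx D.K e.1) (𝒯.vtx D.K e.2))) •
          𝒯.dualNormal (𝒯.vtx D.K e.1) (𝒯.vtx D.K e.2)

open Classical in
/-- The unit normal to the interface `D` exterior to `K` if `D` is an interface of `K`; zero
otherwise. -/
def outNormal (K : Fin 𝒯.n) (D : 𝒯.Interface) : Pt d :=
  if D.K = K then 𝒯.normal D else if D.L = Sum.inl K then -𝒯.normal D else 0

open Classical in
/-- The unit normal to `σ*_S` exterior to the dual volume of `v` if `v` is an end point of the
edge `e` of the face `D`; zero otherwise. -/
def outDualNormal (v : 𝒯.Vertex) (D : 𝒯.Interface) (e : Fin (d + 1) × Fin (d + 1)) : Pt d :=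
  if 𝒯.vtx D.K e.1 = v then 𝒯.dualNormal (𝒯.vtx D.K e.1) (𝒯.vtx D.K e.2)
  else if 𝒯.vtx D.K e.2 = v then -𝒯.dualNormal (𝒯.vtx D.K e.1) (𝒯.vtx D.K e.2) else 0

/-- The discrete divergence, component on `𝔐`. -/
def divPrimal (F : 𝒯.Interface → Pt d) (K : Fin 𝒯.n) : ℝ :=
  (𝒯.mCell K)⁻¹ * ∑ D : 𝒯.Interface, ∑ e ∈ edges D.i,
    𝒯.mSigma D.K D.i e * inner ℝ (F D) (outNormal K D)

/-- The discrete divergence, component on `𝔐*`. -/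
def divDual (F : 𝒯.Interface → Pt d) (v : 𝒯.Vertex) : ℝ :=
  (𝒯.mDual v)⁻¹ * ∑ D : 𝒯.Interface, ∑ e ∈ edges D.i,
    𝒯.mSigmaStar D e * inner ℝ (F D) (outDualNormal v D e)

/-- The penalization operator, component on `𝔐`. -/
def penPrimal (w : 𝒯.DFun) (K : Fin 𝒯.n) : ℝ :=
  ((d : ℝ) - 1) * (𝒯.size)⁻¹ * (𝒯.mCell K)⁻¹ *
    ∑ v : 𝒯.Vertex, 𝒯.mInter K v * (w.primal (Sum.inl K) - w.dual v)

/-- The penalization operator, component on `𝔐*` (boundary volumes `K ∈ ∂𝔐` do not meet the dual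
volumes, which are included in `Ω`). -/
def penDual (w : 𝒯.DFun) (v : 𝒯.Vertex) : ℝ :=
  (𝒯.size)⁻¹ * (𝒯.mDual v)⁻¹ *
    ∑ K : Fin 𝒯.n, 𝒯.mInter K v * (w.dual v - w.primal (Sum.inl K))

variable (𝒯) in
/-- Families of numerical convection fluxes `g_{K,L}` on the primal mesh. -/
abbrev PFlux := 𝒯.CellBar → 𝒯.CellBar → ℝ → ℝ → ℝ

variable (𝒯) in
/-- Families of numerical convection fluxes `g_{K*,L*}` on the dual mesh. -/
abbrev DFlux := 𝒯.Vertex → 𝒯.Vertex → ℝ → ℝ → ℝ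

open Classical in
/-- The discrete convection operator, component on `𝔐`. -/
def convPrimal (g : 𝒯.PFlux) (u : 𝒯.DFun) (K : Fin 𝒯.n) : ℝ :=
  (𝒯.mCell K)⁻¹ * ∑ D : 𝒯.Interface, 𝒯.mFace D.K D.i *
    (if D.K = K then g (Sum.inl K) D.L (u.primal (Sum.inl K)) (u.primal D.L)
     else if D.L = Sum.inl K then
       g (Sum.inl K) (Sum.inl D.K) (u.primal (Sum.inl K)) (u.primal (Sum.inl D.K))
     else 0)

open Classical in
/-- The discrete convection operator, component on `𝔐*`. -/
def convDual (gs : 𝒯.DFlux) (u : 𝒯.DFun) (v : 𝒯.Vertex) : ℝ :=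
  (𝒯.mDual v)⁻¹ * ∑ w ∈ Finset.univ.filter (fun w => 𝒯.DualNbr v w),
    𝒯.mDualFace v w * gs v w (u.dual v) (u.dual w)

open Classical in
/-- The scalar product `[[·,·]]` of discrete functions on `Ω` given by their components on `𝔐` and
`𝔐*`. -/
def pairing (a : Fin 𝒯.n → ℝ) (as : 𝒯.Vertex → ℝ) (b : Fin 𝒯.n → ℝ) (bs : 𝒯.Vertex → ℝ) : ℝ :=
  1 / (d : ℝ) * ∑ K, 𝒯.mCell K * a K * b K +
    ((d : ℝ) - 1) / d *
      ∑ v ∈ Finset.univ.filter (fun v : 𝒯.Vertex => v.1 ∈ Ω), 𝒯.mDual v * as v * bs v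

/-- The convective dissipation `I_Id[u^𝔐, 1]`. -/
def dissPrimal (g : 𝒯.PFlux) (u : 𝒯.DFun) : ℝ :=
  1 / (d : ℝ) * ∑ D : 𝒯.Interface, 𝒯.mFace D.K D.i *
    ∫ s in (u.primal (Sum.inl D.K))..(u.primal D.L),
      (g (Sum.inl D.K) D.L s s
        - g (Sum.inl D.K) D.L (u.primal (Sum.inl D.K)) (u.primal D.L))

open Classical in
/-- The convective dissipation `I*_Id[u^𝔐*, 1]`; the factor `1/2` accounts for the fact that each
dual interface appears twice in the double sum. -/
def dissDual (gs : 𝒯.DFlux) (u : 𝒯.DFun) : ℝ :=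
  ((d : ℝ) - 1) / d * (1 / 2 * ∑ v : 𝒯.Vertex,
    ∑ w ∈ Finset.univ.filter (fun w => 𝒯.DualNbr v w), 𝒯.mDualFace v w *
      ∫ s in (u.dual v)..(u.dual w), (gs v w s s - gs v w (u.dual v) (u.dual w)))

end Triangulation

/-! ### Data of the problem -/

/-- `𝔞(ξ) = k(ξ) ξ` is continuous, strictly monotone, with growth and coercivity of order
`p`. -/
structure IsDiffusion {d : ℕ} (p c : ℝ) (k : Pt d → ℝ) : Prop where
  one_lt : 1 < p
  pos : 0 < c
  cont : Continuous fun ξ => k ξ • ξ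
  mono : ∀ ξ η, ξ ≠ η → 0 < inner ℝ (k ξ • ξ - k η • η) (ξ - η)
  lower : ∀ ξ, ξ ≠ 0 → 1 / c * ‖ξ‖ ^ (p - 2) ≤ k ξ
  upper : ∀ ξ, ξ ≠ 0 → k ξ ≤ c * ‖ξ‖ ^ (p - 2)

/-- `M = ‖u₀‖_∞ + ∫₀ᵀ ‖S(t,·)‖_∞ dt`. -/
def dataBound {d : ℕ} (Ω : Set (Pt d)) (T : ℝ) (u₀ : Pt d → ℝ) (S : ℝ → Pt d → ℝ) : ℝ :=
  (eLpNorm u₀ ∞ (volume.restrict Ω)).toReal +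
    (∫⁻ t in Ioo 0 T, eLpNorm (S t) ∞ (volume.restrict Ω)).toReal

/-- `ω` is a (concave, continuous) modulus of continuity of `f` on `[-M, M]`. -/
structure IsModulusOn {d : ℕ} (f : ℝ → Pt d) (M : ℝ) (ω : ℝ → ℝ) : Prop where
  cont : ContinuousOn ω (Icc 0 (2 * M))
  concave : ConcaveOn ℝ (Icc 0 (2 * M)) ω
  zero : ω 0 = 0
  bound : ∀ a ∈ Icc (-M) M, ∀ b ∈ Icc (-M) M, ‖f a - f b‖ ≤ ω |a - b|

/-- Conditions on the numerical flux `g = g_{K,L}` through an interface of unit normal `ν`; `g'` is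
the flux `g_{L,K}` in the opposite direction. -/
structure IsNumFlux {d : ℕ} (f : ℝ → Pt d) (M : ℝ) (ω : ℝ → ℝ) (c : ℝ) (ν : Pt d)
    (g g' : ℝ → ℝ → ℝ) : Prop where
  cont : Continuous fun q : ℝ × ℝ => g q.1 q.2
  mono : ∀ b, Monotone fun a => g a b
  anti : ∀ a, Antitone fun b => g a b
  consistent : ∀ a, g a a = inner ℝ (f a) ν
  conservative : ∀ a b, g a b = -g' b a
  modulus : ∀ a ∈ Icc (-M) M, ∀ b ∈ Icc (-M) M, ∀ a' ∈ Icc (-M) M, ∀ b' ∈ Icc (-M) M,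
    |g a b - g a' b'| ≤ c * (ω |a - a'| + ω |b - b'|)

/-- Mean value of `φ` on the set `B`. -/
def mean {d : ℕ} (B : Set (Pt d)) (φ : Pt d → ℝ) : ℝ := (volume.real B)⁻¹ * ∫ x in B, φ x

/-- Mean value of the source on the `n`-th time interval. -/
def timeMean {d : ℕ} (S : ℝ → Pt d → ℝ) (Δt : ℝ) (n : ℕ) (x : Pt d) : ℝ :=
  Δt⁻¹ * ∫ t in (((n : ℝ) - 1) * Δt)..((n : ℝ) * Δt), S t x

/-! ### The scheme -/

section Scheme

variable {d : ℕ} [NeZero d] {Ω : Set (Pt d)}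

/-- Number of time steps: the integer part of `T / Δt`. -/
def numSteps (T Δt : ℝ) : ℕ := ⌊T / Δt⌋₊

/-- `u = (u^0, …, u^N)` solves the finite volume scheme with its discrete boundary and initial
conditions. -/
structure IsDiscreteSolution (𝒯 : Triangulation d Ω) (T Δt : ℝ) (u₀ : Pt d → ℝ)
    (S : ℝ → Pt d → ℝ) (k : Pt d → ℝ) (A : ℝ → ℝ) (g : 𝒯.PFlux) (gs : 𝒯.DFlux)
    (u : ℕ → 𝒯.DFun) : Prop where
  init_primal : ∀ K, (u 0).primal (Sum.inl K) = mean (𝒯.simplex K).interior u₀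
  init_dual : ∀ v : 𝒯.Vertex, v.1 ∈ Ω → (u 0).dual v = mean (𝒯.dualCell v) u₀
  bdry_primal : ∀ n ∈ Finset.Icc 1 (numSteps T Δt), ∀ e, (u n).primal (Sum.inr e) = 0
  bdry_dual : ∀ n ∈ Finset.Icc 1 (numSteps T Δt), ∀ v : 𝒯.Vertex, v.1 ∈ frontier Ω →
    (u n).dual v = 0
  eq_primal : ∀ n ∈ Finset.Icc 1 (numSteps T Δt), ∀ K,
    ((u n).primal (Sum.inl K) - (u (n - 1)).primal (Sum.inl K)) / Δt
      + Triangulation.convPrimal g (u n) K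
      - Triangulation.divPrimal (fun D => k (Triangulation.grad ((u n).comp A) D) •
          Triangulation.grad ((u n).comp A) D) K
      + Triangulation.penPrimal ((u n).comp A) K
      = mean (𝒯.simplex K).interior (timeMean S Δt n)
  eq_dual : ∀ n ∈ Finset.Icc 1 (numSteps T Δt), ∀ v : 𝒯.Vertex, v.1 ∈ Ω →
    ((u n).dual v - (u (n - 1)).dual v) / Δt
      + Triangulation.convDual gs (u n) v
      - Triangulation.divDual (fun D => k (Triangulation.grad ((u n).comp A) D) •
          Triangulation.grad ((u n).comp A) D) v
      + Triangulation.penDual ((u n).comp A) v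
      = mean (𝒯.dualCell v) (timeMean S Δt n)

/-- The piecewise constant function `v^{𝔐,Δt}`; it is zero for `t ≥ N Δt`. -/
def primalFun (𝒯 : Triangulation d Ω) (T Δt : ℝ) (w : ℕ → 𝒯.DFun) (t : ℝ) (x : Pt d) : ℝ :=
  ∑ n ∈ Finset.Icc 1 (numSteps T Δt), ∑ K : Fin 𝒯.n,
    (Ico (((n : ℝ) - 1) * Δt) ((n : ℝ) * Δt) ×ˢ (𝒯.simplex K).interior).indicator
      (fun _ => (w n).primal (Sum.inl K)) (t, x)

open Classical in
/-- The piecewise constant function `v^{𝔐*,Δt}`; it is zero for `t ≥ N Δt`. -/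
def dualFun (𝒯 : Triangulation d Ω) (T Δt : ℝ) (w : ℕ → 𝒯.DFun) (t : ℝ) (x : Pt d) : ℝ :=
  ∑ n ∈ Finset.Icc 1 (numSteps T Δt),
    ∑ v ∈ Finset.univ.filter (fun v : 𝒯.Vertex => v.1 ∈ Ω),
      (Ico (((n : ℝ) - 1) * Δt) ((n : ℝ) * Δt) ×ˢ 𝒯.dualCell v).indicator
        (fun _ => (w n).dual v) (t, x)

/-- The `L^p(Q)` norm of the discrete gradient of `w`, a field which is constant on each
`[(n-1)Δt, nΔt) × D`. -/
def gradNorm (𝒯 : Triangulation d Ω) (p T Δt : ℝ) (w : ℕ → 𝒯.DFun) : ℝ :=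
  (∑ n ∈ Finset.Icc 1 (numSteps T Δt), Δt * ∑ D : 𝒯.Interface,
    𝒯.mDiamond D * ‖Triangulation.grad (w n) D‖ ^ p) ^ (1 / p)

/-- `[[𝒫[w], w]]`. -/
def penEnergy (𝒯 : Triangulation d Ω) (w : 𝒯.DFun) : ℝ :=
  Triangulation.pairing (Triangulation.penPrimal w) (Triangulation.penDual w)
    (fun K => w.primal (Sum.inl K)) w.dual

end Scheme

end DDFV

end

/-!
All estimates come from testing the scheme with a monotone function `θ(uⁿ)` of the solution. The
pairing `[[·,·]]` turns it into a weak form (`IsScheme.weak`) made of the time increment and of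
the convection, diffusion and penalization forms `convForm`, `divForm`, `penForm`, and each of the
three forms is nonnegative on `θ(uⁿ)`.

The geometry enters in three facts.

* Orientation. The difference of the centres on the two sides of an interface is a multiple of the
  exterior normal, namely the sum of the signed distances of the centres to the interface. The
  Delaunay condition, or the condition at the boundary, makes this sum positive
  (`height_add_secondSide_pos`), although each term may be negative. Hence `ν_{KL}` is the
  exterior normal and the signed contributions of the control volumes to the volume of the
  diamonds add up, which bounds the total volume of the diamonds by a multiple of the volume of
  `Ω` (`sum_mDiamond_le`).
* Reconstruction. On a face, the edge vectors weighted by the parts of the face reproduce the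
  tangential gradients of the nodal functions (`starVec_eq`). Hence the discrete gradient has the
  prescribed components along `ν_{KL}` and along every `ν_{K^*L^*}` (`inner_grad_normal`,
  `inner_grad_dualNormal`), and it is dual to the divergence (`divForm_eq`).
* Closedness. Constant fields have no flux through the boundary of a primal control volume, nor
  through that of the dual control volume of an interior vertex, with the measures `m_{K|L}` and
  `m_{K^*|L^*}` of the scheme (`sum_mFace_outNormal`, `sum_mSigmaStar_outDualNormal`). In the dual
  case the measures of the interfaces need not be those of pieces of the boundary of `K^*`, so
  this is an algebraic identity: on each simplex the tangential gradients are exchanged for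
  normals to the faces, with coefficients that depend on the faces only and therefore cancel
  between neighbours.

Convection. For a monotone consistent flux, `g(a,b) (θ(a) - θ(b)) ≥ (F(a) - F(b)) · ν` with an
entropy flux `F` (`IsEntropyFlux`): a Kruzhkov flux when `θ` is a step function, a Stieltjes
integral of `𝔣` when `θ` is continuous. By closedness the right-hand sides sum to zero
(`convForm_comp_nonneg`). For `θ = id` the difference of the two sides is exactly the integral
that defines `I[u]` and `I^*[u]` (`convForm_self`). Diffusion and penalization are nonnegative on
`θ(u)` because `A` and `θ` are both monotone; for the diffusion this uses the components of the
discrete gradient one at a time.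

Maximum principle. With `θ` equal to the sign on `|z| > κ` and to zero elsewhere, where `κ` is the
bound at time `n - 1` plus the contribution of the source, every term of the weak form has a sign,
so that `θ(uⁿ) = 0` (`IsScheme.abs_le_stepBound`).

Energy. With `θ` continuous, the increment dominates that of the primitive of `θ`, and the sum
over the time steps telescopes (`IsScheme.energy`); `θ = A` bounds the gradient and the
penalization, `θ = id` bounds the convective dissipation.

Time translates. The weak form and the energy estimate bound `[[uʲ - uʲ⁻¹, wᵐ]]` by a term in `j`
plus a term in `m`, both summable in time (`IsScheme.abs_incrPair_le`). Telescoping over the steps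
of a translate by `q` steps gives `∑ Δt [[u^{n+q} - uⁿ, w^{n+q} - wⁿ]] ≤ C q Δt`
(`IsScheme.sum_monotonePair_le`). By uniform continuity of `A` on the range of the solution,
`|A x - A y| ≤ ε + b(ε) (x - y) (A x - A y)` (`exists_modulus_monotone`), so the `L¹` norm of the
translate is at most `ε a + δ b'(ε)` for every `ε > 0`; the infimum over `ε` is concave in `δ` and
is the modulus sought (`exists_modulus_of_forall_le`). A translate by `δ = (q + τ) Δt` is a convex
combination of the translates by `q` and by `q + 1` steps (`lintegral_lintegral_translate_le`),
which extends the bound to all `δ`.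
-/

set_option linter.unusedSectionVars false

noncomputable section

namespace DDFV

/-! ### Barycentric coordinates of a simplex and their gradients -/

section Bary

variable {d : ℕ} (s : Affine.Simplex ℝ (Pt d) d)

/-- The vertices of a full-dimensional simplex, as an affine basis of the whole space. -/
def baryBasis : AffineBasis (Fin (d + 1)) ℝ (Pt d) where
  toFun := s.points
  ind' := s.independent
  tot' := by
    rw [s.independent.affineSpan_eq_top_iff_card_eq_finrank_add_one]
    simp

/-- The `a`-th barycentric coordinate with respect to the simplex `s`. -/
def bary (a : Fin (d + 1)) (x : Pt d) : ℝ := (baryBasis s).coord a x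

/-- The (constant) gradient of the `a`-th barycentric coordinate. -/
def baryGrad (a : Fin (d + 1)) : Pt d :=
  (InnerProductSpace.toDual ℝ (Pt d)).symm ((baryBasis s).coord a).linear.toContinuousLinearMap

theorem bary_sub (a : Fin (d + 1)) (x y : Pt d) :
    bary s a x - bary s a y = inner ℝ (baryGrad s a) (x - y) := by
  rw [baryGrad, InnerProductSpace.toDual_symm_apply]
  simp only [LinearMap.coe_toContinuousLinearMap']
  have := ((baryBasis s).coord a).linearMap_vsub x y
  simpa [bary] using this.symm

theorem bary_points (a b : Fin (d + 1)) : bary s a (s.points b) = if a = b then 1 else 0 :=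
  (baryBasis s).coord_apply a b

theorem sum_bary (x : Pt d) : ∑ a, bary s a x = 1 :=
  (baryBasis s).sum_coord_apply_eq_one x

theorem sum_bary_smul (x : Pt d) : ∑ a, bary s a x • s.points a = x :=
  (baryBasis s).linear_combination_coord_eq_self x

theorem continuous_bary (a : Fin (d + 1)) : Continuous (bary s a) :=
  continuous_barycentric_coord (baryBasis s) a

theorem inner_baryGrad (a b c : Fin (d + 1)) :
    inner ℝ (baryGrad s a) (s.points b - s.points c)
      = (if a = b then 1 else 0) - (if a = c then 1 else 0) := by
  rw [← bary_sub, bary_points, bary_points]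

/-- A vector orthogonal to all the edges issued from one vertex is zero. -/
theorem eq_zero_of_inner_edges {y : Pt d} (c : Fin (d + 1))
    (h : ∀ b, inner ℝ y (s.points b - s.points c) = 0) : y = 0 := by
  have key : ∀ x : Pt d, inner ℝ y (x - s.points c) = 0 := by
    intro x
    have hx : x - s.points c = ∑ a, bary s a x • (s.points a - s.points c) := by
      simp only [smul_sub, Finset.sum_sub_distrib, sum_bary_smul, ← Finset.sum_smul, sum_bary,
        one_smul]
    rw [hx, inner_sum]
    simp [inner_smul_right, h]
  have := key (y + s.points c)
  simpa using this

theorem sum_baryGrad : ∑ a, baryGrad s a = 0 := by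
  refine eq_zero_of_inner_edges s 0 fun b => ?_
  simp [sum_inner, inner_baryGrad]

/-- A vector orthogonal to the face opposite to the vertex `i` is a multiple of the gradient of
the `i`-th barycentric coordinate. -/
theorem eq_smul_baryGrad {y : Pt d} {i c : Fin (d + 1)} (hc : c ≠ i)
    (h : ∀ b, b ≠ i → inner ℝ y (s.points b - s.points c) = 0) :
    y = (inner ℝ y (s.points i - s.points c)) • baryGrad s i := by
  rw [← sub_eq_zero]
  refine eq_zero_of_inner_edges s c fun b => ?_
  rw [inner_sub_left, inner_smul_left, inner_baryGrad]
  by_cases hb : b = i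
  · subst hb; simp [hc.symm]
  · simp [h b hb, hc.symm, Ne.symm hb]

theorem mem_closedInterior_iff (x : Pt d) : x ∈ s.closedInterior ↔ ∀ a, 0 ≤ bary s a x := by
  rw [← s.convexHull_eq_closedInterior]
  have := (baryBasis s).convexHull_eq_nonneg_coord
  have h2 : Set.range (baryBasis s) = Set.range s.points := rfl
  rw [← h2, this]; rfl

theorem bary_affineCombination (w : Fin (d + 1) → ℝ) (hw : ∑ a, w a = 1) (a : Fin (d + 1)) :
    bary s a (Finset.univ.affineCombination ℝ s.points w) = w a :=
  (baryBasis s).coord_apply_combination_of_mem (Finset.mem_univ a) hw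

/-- The point `(1-t) x + t y` has interpolated barycentric coordinates. -/
theorem bary_lineMap (a : Fin (d + 1)) (x y : Pt d) (t : ℝ) :
    bary s a (x + t • (y - x)) = bary s a x + t * (bary s a y - bary s a x) := by
  have := bary_sub s a (x + t • (y - x)) x
  rw [add_sub_cancel_left, inner_smul_right, ← bary_sub] at this
  linarith

/-- The barycentre of a simplex. -/
def bcenter : Pt d := Finset.univ.affineCombination ℝ s.points (fun _ => ((d : ℝ) + 1)⁻¹)

theorem bary_bcenter (a : Fin (d + 1)) : bary s a (bcenter s) = ((d : ℝ) + 1)⁻¹ := by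
  refine bary_affineCombination s _ ?_ a
  have : ((d : ℝ) + 1) ≠ 0 := by positivity
  simp [this]

theorem isClosed_closedInterior : IsClosed s.closedInterior := by
  have : s.closedInterior = ⋂ a, {x | 0 ≤ bary s a x} := by
    ext x; simp [mem_closedInterior_iff]
  rw [this]
  exact isClosed_iInter fun a => isClosed_le continuous_const (continuous_bary s a)

variable [NeZero d]

theorem exists_ne_index (i : Fin (d + 1)) : ∃ c, c ≠ i := by
  have : Nontrivial (Fin (d + 1)) := Fin.nontrivial_iff_two_le.2 (by
    have := NeZero.pos d; omega)
  exact exists_ne i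

theorem baryGrad_ne_zero (i : Fin (d + 1)) : baryGrad s i ≠ 0 := by
  intro h
  obtain ⟨c, hc⟩ := exists_ne_index i
  have := inner_baryGrad s i i c
  simp [h, hc.symm] at this

theorem norm_baryGrad_pos (i : Fin (d + 1)) : 0 < ‖baryGrad s i‖ :=
  norm_pos_iff.2 (baryGrad_ne_zero s i)

theorem mem_interior_iff (x : Pt d) : x ∈ s.interior ↔ ∀ a, 0 < bary s a x := by
  constructor
  · rintro ⟨w, hw, h01, rfl⟩ a
    rw [bary_affineCombination s w hw]
    exact (h01 a).1
  · intro h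
    refine ⟨fun a => bary s a x, sum_bary s x, fun a => ⟨h a, ?_⟩, ?_⟩
    · obtain ⟨c, hc⟩ := exists_ne_index a
      have h2 : ∑ b ∈ ({a, c} : Finset _), bary s b x = bary s a x + bary s c x :=
        Finset.sum_pair hc.symm
      have h1 : ∑ b ∈ ({a, c} : Finset _), bary s b x ≤ ∑ b, bary s b x :=
        Finset.sum_le_sum_of_subset_of_nonneg (Finset.subset_univ _) fun b _ _ => (h b).le
      rw [sum_bary] at h1
      linarith [h c]
    · exact (baryBasis s).affineCombination_coord_eq_self x

theorem isOpen_interior : IsOpen s.interior := by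
  have : s.interior = ⋂ a, {x | 0 < bary s a x} := by
    ext x; simp [mem_interior_iff]
  rw [this]
  exact isOpen_iInter_of_finite fun a => isOpen_lt continuous_const (continuous_bary s a)

theorem interior_nonempty : s.interior.Nonempty :=
  ⟨bcenter s, (mem_interior_iff s _).2 fun a => by rw [bary_bcenter]; positivity⟩

theorem closedInterior_subset_closure : s.closedInterior ⊆ closure s.interior := by
  intro x hx
  rw [mem_closedInterior_iff] at hx
  have ht : Filter.Tendsto (fun t : ℝ => x + t • (bcenter s - x)) (nhdsWithin 0 (Ioi 0))
      (nhds x) := by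
    have : Filter.Tendsto (fun t : ℝ => x + t • (bcenter s - x)) (nhds 0)
        (nhds (x + (0 : ℝ) • (bcenter s - x))) := by
      apply Continuous.tendsto; fun_prop
    simp only [zero_smul, add_zero] at this
    exact this.mono_left nhdsWithin_le_nhds
  refine mem_closure_of_tendsto ht ?_
  have h1 : ∀ᶠ t : ℝ in nhdsWithin 0 (Ioi 0), t < 1 :=
    nhdsWithin_le_nhds (Iio_mem_nhds one_pos)
  filter_upwards [h1, self_mem_nhdsWithin] with t ht1 ht0
  rw [mem_interior_iff]
  intro a
  rw [bary_lineMap, bary_bcenter]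
  have h0 : (0 : ℝ) < ((d : ℝ) + 1)⁻¹ := by positivity
  have := hx a
  have ht0' : 0 < t := ht0
  nlinarith [mul_nonneg (sub_nonneg.2 ht1.le) this, mul_pos ht0' h0]

theorem closure_interior : closure s.interior = s.closedInterior :=
  (closure_minimal s.interior_subset_closedInterior (isClosed_closedInterior s)).antisymm
    (closedInterior_subset_closure s)

theorem measurableSet_interior : MeasurableSet s.interior := (isOpen_interior s).measurableSet

end Bary

/-! ### Faces and circumcentres -/

section Faces

/-- The line through two points that are both equidistant from `P` and `Q` is orthogonal to
`Q - P`. -/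
theorem inner_sub_eq_zero_of_dist_eq {d : ℕ} {x y P Q : Pt d} (hx : dist P x = dist Q x)
    (hy : dist P y = dist Q y) : inner ℝ (y - x) (P - Q) = 0 := by
  have h1 : ∀ z : Pt d, dist P z = dist Q z →
      inner ℝ P P - 2 * inner ℝ z P = inner ℝ Q Q - 2 * inner ℝ z Q := by
    intro z hz
    rw [dist_eq_norm, dist_eq_norm] at hz
    have h2 : ‖P - z‖ ^ 2 = ‖Q - z‖ ^ 2 := by rw [hz]
    rw [← real_inner_self_eq_norm_sq, ← real_inner_self_eq_norm_sq] at h2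
    simp only [inner_sub_left, inner_sub_right] at h2
    rw [real_inner_comm z P, real_inner_comm z Q] at h2
    linarith
  have := h1 x hx
  have := h1 y hy
  simp only [inner_sub_left, inner_sub_right]
  linarith

variable {d : ℕ} (s : Affine.Simplex ℝ (Pt d) d)

theorem dist_circumcenter_eq (b c : Fin (d + 1)) :
    dist (s.points b) s.circumcenter = dist (s.points c) s.circumcenter := by
  rw [Affine.Simplex.dist_circumcenter_eq_circumradius,
    Affine.Simplex.dist_circumcenter_eq_circumradius]

/-- Two affine functions that agree on a set agree on its affine span. -/
theorem affine_eq_on_span {S : Set (Pt d)} {f g : Pt d →ᵃ[ℝ] ℝ} (h : ∀ p ∈ S, f p = g p)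
    {x : Pt d} (hx : x ∈ affineSpan ℝ S) : f x = g x := by
  have h1 := AffineMap.eqOn_affineSpan (f := f) (g := g) (s := S)
  exact (h1 fun p hp => h p hp) hx

/-- The gradient, within the face opposite to `i`, of the `a`-th barycentric coordinate. -/
def faceGrad (i a : Fin (d + 1)) : Pt d :=
  baryGrad s a - (inner ℝ (baryGrad s a) (baryGrad s i) / ‖baryGrad s i‖ ^ 2) • baryGrad s i

theorem inner_faceGrad_edge {i b c : Fin (d + 1)} (a : Fin (d + 1)) (hb : b ≠ i) (hc : c ≠ i) :
    inner ℝ (faceGrad s i a) (s.points b - s.points c)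
      = (if a = b then 1 else 0) - (if a = c then 1 else 0) := by
  rw [faceGrad, inner_sub_left, inner_smul_left, inner_baryGrad, inner_baryGrad]
  simp [hb.symm, hc.symm]

/-- A vector parallel to the face opposite to `i` is determined by its products with the edges
of that face. -/
theorem eq_of_inner_face {y z : Pt d} {i c : Fin (d + 1)} (hc : c ≠ i)
    (hy : inner ℝ y (baryGrad s i) = 0) (hz : inner ℝ z (baryGrad s i) = 0)
    (h : ∀ b, b ≠ i → inner ℝ y (s.points b - s.points c) = inner ℝ z (s.points b - s.points c)) :
    y = z := by
  rw [← sub_eq_zero]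
  have h1 := eq_smul_baryGrad s (y := y - z) hc (fun b hb => by rw [inner_sub_left, h b hb, sub_self])
  have h2 : inner ℝ (y - z) (y - z) = (0 : ℝ) := by
    nth_rewrite 2 [h1]
    rw [inner_smul_right, inner_sub_left (z := baryGrad s i), hy, hz]; simp
  exact inner_self_eq_zero.1 h2

variable [NeZero d]

theorem mem_face_range {i b : Fin (d + 1)} :
    s.points b ∈ Set.range (s.faceOpposite i).points ↔ b ≠ i := by
  rw [Affine.Simplex.range_faceOpposite_points]
  constructor
  · rintro ⟨c, hc, h⟩ rfl
    exact hc (s.independent.injective h)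
  · intro h; exact ⟨b, h, rfl⟩

theorem dist_face_circumcenter {i b c : Fin (d + 1)} (hb : b ≠ i) (hc : c ≠ i) :
    dist (s.points b) (s.faceOpposite i).circumcenter
      = dist (s.points c) (s.faceOpposite i).circumcenter := by
  obtain ⟨b', hb'⟩ := (mem_face_range s).2 hb
  obtain ⟨c', hc'⟩ := (mem_face_range s).2 hc
  rw [← hb', ← hc', Affine.Simplex.dist_circumcenter_eq_circumradius,
    Affine.Simplex.dist_circumcenter_eq_circumradius]

theorem bary_eq_zero_of_mem_affineSpan {i : Fin (d + 1)} {x : Pt d}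
    (hx : x ∈ affineSpan ℝ (Set.range (s.faceOpposite i).points)) : bary s i x = 0 := by
  have := affine_eq_on_span (f := (baryBasis s).coord i) (g := 0)
    (S := Set.range (s.faceOpposite i).points) ?_ hx
  · exact this
  · rw [Affine.Simplex.range_faceOpposite_points]
    rintro _ ⟨b, hb, rfl⟩
    have := bary_points s i b
    rw [if_neg (Ne.symm hb)] at this
    exact this

theorem bary_face_circumcenter (i : Fin (d + 1)) :
    bary s i (s.faceOpposite i).circumcenter = 0 :=
  bary_eq_zero_of_mem_affineSpan s (Affine.Simplex.circumcenter_mem_affineSpan _)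

theorem mem_face_closedInterior_iff (i : Fin (d + 1)) (x : Pt d) :
    x ∈ (s.faceOpposite i).closedInterior ↔ bary s i x = 0 ∧ ∀ a, 0 ≤ bary s a x := by
  constructor
  · intro h
    exact ⟨bary_eq_zero_of_mem_affineSpan s (Affine.Simplex.closedInterior_subset_affineSpan h),
      (mem_closedInterior_iff s x).1
        (s.closedInterior_faceOpposite_subset_closedInterior i h)⟩
  · rintro ⟨h0, hpos⟩
    rw [← Affine.Simplex.convexHull_eq_closedInterior]
    have hx := sum_bary_smul s x
    rw [← Finset.sum_erase Finset.univ (a := i) (by simp [h0])] at hx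
    rw [← hx]
    refine (convex_convexHull ℝ _).sum_mem (fun a _ => hpos a) ?_ ?_
    · rw [Finset.sum_erase (f := fun a => bary s a x) Finset.univ h0]
      exact sum_bary s x
    · intro a ha
      exact subset_convexHull ℝ _ ((mem_face_range s).2 (Finset.ne_of_mem_erase ha))

/-- The centre of a simplex projects orthogonally onto the centre of each of its faces. -/
theorem circumcenter_sub_face_circumcenter (i : Fin (d + 1)) :
    s.circumcenter - (s.faceOpposite i).circumcenter
      = (bary s i s.circumcenter / ‖baryGrad s i‖ ^ 2) • baryGrad s i := by
  obtain ⟨c, hc⟩ := exists_ne_index i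
  have h := eq_smul_baryGrad s (y := s.circumcenter - (s.faceOpposite i).circumcenter) hc
    (fun b hb => inner_sub_eq_zero_of_dist_eq (dist_face_circumcenter s hb hc)
      (dist_circumcenter_eq s b c))
  have h2 := bary_sub s i s.circumcenter (s.faceOpposite i).circumcenter
  rw [bary_face_circumcenter, sub_zero] at h2
  have hn := norm_baryGrad_pos s i
  have h3 : bary s i s.circumcenter / ‖baryGrad s i‖ ^ 2 =
      inner ℝ (s.circumcenter - (s.faceOpposite i).circumcenter) (s.points i - s.points c) := by
    rw [h2]
    generalize s.circumcenter - (s.faceOpposite i).circumcenter = y at h ⊢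
    generalize inner ℝ y (s.points i - s.points c) = η at h ⊢
    rw [h, inner_smul_right, real_inner_self_eq_norm_sq]
    field_simp
  rw [h3]; exact h

/-- The barycentric coordinates of the centre of a face, in terms of those of the centre of the
simplex. -/
theorem bary_face_circumcenter_eq (i a : Fin (d + 1)) :
    bary s a (s.faceOpposite i).circumcenter = bary s a s.circumcenter
      - bary s i s.circumcenter * inner ℝ (baryGrad s a) (baryGrad s i) / ‖baryGrad s i‖ ^ 2 := by
  have h := bary_sub s a s.circumcenter (s.faceOpposite i).circumcenter
  rw [circumcenter_sub_face_circumcenter, inner_smul_right] at h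
  rw [div_mul_eq_mul_div] at h
  linarith

theorem inner_faceGrad_baryGrad (i a : Fin (d + 1)) :
    inner ℝ (faceGrad s i a) (baryGrad s i) = 0 := by
  have hn := norm_baryGrad_pos s i
  rw [faceGrad, inner_sub_left, inner_smul_left, real_inner_self_eq_norm_sq]
  simp
  field_simp
  simp

/-- The exchange of the gradients tangential to the faces that contain the vertex `a` for normals
to these faces. On the right, up to the length of the gradient, the coefficient of each normal
depends only on the position of `a` within the face, hence it is the same for the two simplices
that share the face. -/
theorem sum_faceGrad_mul (a : Fin (d + 1)) :
    ∑ j ∈ Finset.univ.erase a, bary s j s.circumcenter • faceGrad s j a =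
      ∑ j ∈ Finset.univ.erase a,
        (bary s a (s.faceOpposite j).circumcenter - 1) • baryGrad s j := by
  have h1 : ∀ j, bary s j s.circumcenter • faceGrad s j a =
      bary s j s.circumcenter • baryGrad s a
      + (bary s a (s.faceOpposite j).circumcenter - bary s a s.circumcenter) • baryGrad s j := by
    intro j
    rw [bary_face_circumcenter_eq, faceGrad, smul_sub, smul_smul]
    rw [sub_sub_cancel_left, neg_smul, ← sub_eq_add_neg, mul_div_assoc]
  simp_rw [h1, sub_smul, Finset.sum_add_distrib, Finset.sum_sub_distrib, ← Finset.sum_smul]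
  have h2 := sum_bary s s.circumcenter
  rw [← Finset.add_sum_erase _ _ (Finset.mem_univ a)] at h2
  have h3 := sum_baryGrad s
  rw [← Finset.add_sum_erase _ _ (Finset.mem_univ a)] at h3
  have h4 : ∑ x ∈ Finset.univ.erase a, baryGrad s x = - baryGrad s a := by
    rw [← add_eq_zero_iff_eq_neg, add_comm]; exact h3
  have h5 : ∑ i ∈ Finset.univ.erase a, bary s i s.circumcenter = 1 - bary s a s.circumcenter := by
    linarith
  rw [← Finset.smul_sum, h4, h5]
  simp only [one_smul, sub_smul, smul_neg, h4]
  abel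

end Faces

/-! ### Volume of a simplex -/

section Volume

variable {d : ℕ}

/-- The open corner simplex spanned by the origin and the canonical basis. -/
def stdCorner (d : ℕ) : Set (Pt d) := {y | (∀ j, 0 < y j) ∧ ∑ j, y j < 1}

/-- The matrix whose columns are the edges of the simplex issued from the vertex `0`. -/
def edgeMatrix (s : Affine.Simplex ℝ (Pt d) d) : Matrix (Fin d) (Fin d) ℝ :=
  Matrix.of fun r j => (s.points j.succ - s.points 0) r

theorem toLin_edgeMatrix (s : Affine.Simplex ℝ (Pt d) d) (y : Pt d) :
    Matrix.toLin (EuclideanSpace.basisFun (Fin d) ℝ).toBasis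
      (EuclideanSpace.basisFun (Fin d) ℝ).toBasis (edgeMatrix s) y
      = ∑ j, y j • (s.points j.succ - s.points 0) := by
  ext r
  rw [Matrix.toLin_apply]
  simp [edgeMatrix, Matrix.mulVec, dotProduct, Pi.single_apply]
  exact Finset.sum_congr rfl fun _ _ => by ring

theorem interior_eq_image [NeZero d] (s : Affine.Simplex ℝ (Pt d) d) :
    s.interior = (fun y => y + s.points 0) '' (Matrix.toLin
      (EuclideanSpace.basisFun (Fin d) ℝ).toBasis
      (EuclideanSpace.basisFun (Fin d) ℝ).toBasis (edgeMatrix s) '' stdCorner d) := by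
  ext x
  rw [mem_interior_iff]
  constructor
  · intro h
    refine ⟨_, ⟨WithLp.toLp 2 fun j => bary s j.succ x, ⟨fun j => h _, ?_⟩, rfl⟩, ?_⟩
    · have := sum_bary s x
      rw [Fin.sum_univ_succ] at this
      have := h 0
      simp only
      linarith
    · simp only [toLin_edgeMatrix]
      have h1 := sum_bary_smul s x
      have h2 := sum_bary s x
      rw [Fin.sum_univ_succ] at h1 h2
      simp only [smul_sub, Finset.sum_sub_distrib, ← Finset.sum_smul]
      have h3 : ∑ j : Fin d, bary s j.succ x = 1 - bary s 0 x := by linarith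
      rw [h3, sub_smul, one_smul]
      conv_rhs => rw [← h1]
      abel
  · rintro ⟨_, ⟨y, ⟨hy, hy1⟩, rfl⟩, rfl⟩ a
    simp only [toLin_edgeMatrix]
    have hx : bary s a (∑ j, y j • (s.points j.succ - s.points 0) + s.points 0) =
        bary s a (s.points 0) + ∑ j, y j * ((if a = j.succ then 1 else 0) -
          (if a = 0 then 1 else 0)) := by
      have := bary_sub s a (∑ j, y j • (s.points j.succ - s.points 0) + s.points 0) (s.points 0)
      rw [add_sub_cancel_right, inner_sum] at this
      simp only [inner_smul_right, inner_baryGrad] at this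
      linarith
    rw [hx, bary_points]
    refine Fin.cases ?_ (fun b => ?_) a
    · simp [(Fin.succ_ne_zero _).symm]
      linarith
    · simp [Fin.succ_ne_zero]
      exact hy b

theorem volume_interior [NeZero d] (s : Affine.Simplex ℝ (Pt d) d) :
    volume.real s.interior = |(edgeMatrix s).det| * volume.real (stdCorner d) := by
  rw [interior_eq_image, measureReal_def, Set.image_add_right, measure_preimage_add_right,
    Measure.addHaar_image_linearMap, LinearMap.det_toLin, ENNReal.toReal_mul,
    ENNReal.toReal_ofReal (abs_nonneg _)]
  rfl

theorem isBounded_interior [NeZero d] (s : Affine.Simplex ℝ (Pt d) d) :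
    Bornology.IsBounded s.interior := by
  refine Bornology.IsBounded.subset ?_ s.interior_subset_closedInterior
  rw [← Affine.Simplex.convexHull_eq_closedInterior]
  exact (isBounded_convexHull).2 (Set.finite_range _).isBounded

theorem volume_interior_pos [NeZero d] (s : Affine.Simplex ℝ (Pt d) d) :
    0 < volume.real s.interior := by
  rw [measureReal_def, ENNReal.toReal_pos_iff]
  exact ⟨(isOpen_interior s).measure_pos _ (interior_nonempty s),
    (isBounded_interior s).measure_lt_top⟩

theorem volume_stdCorner_pos [NeZero d] (s : Affine.Simplex ℝ (Pt d) d) :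
    0 < volume.real (stdCorner d) := by
  have h := volume_interior_pos s
  rw [volume_interior] at h
  exact pos_of_mul_pos_right h (abs_nonneg _)

end Volume

/-! ### Areas of triangles -/

section Triangle

variable {d : ℕ}

theorem triArea_nonneg (a b c : Pt d) : 0 ≤ triArea a b c := by
  unfold triArea; positivity

theorem triArea_swap_left (a b c : Pt d) : triArea b a c = triArea a b c := by
  unfold triArea
  congr 2
  have h1 : a - b = -(b - a) := by abel
  have h2 : c - b = (c - a) - (b - a) := by abel
  rw [h1, h2]
  generalize b - a = u
  generalize c - a = v
  rw [← real_inner_self_eq_norm_sq, ← real_inner_self_eq_norm_sq, ← real_inner_self_eq_norm_sq,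
    ← real_inner_self_eq_norm_sq]
  simp only [inner_neg_left, inner_neg_right, inner_sub_left, inner_sub_right]
  rw [real_inner_comm u v]
  ring

/-- Moving the third summit inside the plane of a triangle scales the area by the modulus of
its barycentric coordinate. -/
theorem triArea_smul {a b c x : Pt d} {β γ : ℝ} (h : x - a = β • (b - a) + γ • (c - a)) :
    triArea a b x = |γ| * triArea a b c := by
  unfold triArea
  rw [h]
  generalize b - a = u
  generalize c - a = v
  rw [← mul_div_assoc, ← Real.sqrt_sq_eq_abs, ← Real.sqrt_mul (sq_nonneg _)]
  congr 2
  simp only [← real_inner_self_eq_norm_sq]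
  simp only [inner_add_left, inner_add_right, inner_smul_left, inner_smul_right]
  rw [real_inner_comm u v]
  simp
  ring

/-- Area of a triangle whose third summit `m` and first summit `a` differ by a vector whose part
`a - c` is parallel to the base and whose part `m - c` is orthogonal to it. -/
theorem triArea_of_orthogonal {a b m c : Pt d} {t : ℝ} (h1 : a - c = t • (b - a))
    (h2 : inner ℝ (b - a) (m - c) = 0) : triArea a b m = dist a b * ‖m - c‖ / 2 := by
  unfold triArea
  congr 1
  have hc : m - a = (m - c) - t • (b - a) := by rw [← h1]; abel
  rw [hc, dist_comm a b, dist_eq_norm b a]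
  generalize m - c = y at *
  generalize b - a = u at *
  rw [← Real.sqrt_sq (by positivity : 0 ≤ ‖u‖ * ‖y‖)]
  congr 1
  rw [mul_pow]
  simp only [← real_inner_self_eq_norm_sq]
  simp only [inner_sub_left, inner_sub_right, inner_smul_left, inner_smul_right]
  rw [real_inner_comm u y, h2]
  simp
  ring

/-- If the third summit is equidistant from the first two, the area is half the product of the base
and of the height drawn at the midpoint of the base. -/
theorem triArea_isosceles {a b c : Pt d} (h : dist a c = dist b c) :
    triArea a b c = dist a b * ‖c - midpoint ℝ a b‖ / 2 := by
  refine triArea_of_orthogonal (t := -(1 / 2)) ?_ ?_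
  · rw [midpoint_eq_smul_add, invOf_eq_inv]
    module
  · rw [real_inner_comm]
    refine inner_sub_eq_zero_of_dist_eq ?_ h.symm
    rw [dist_comm b, dist_comm a, dist_midpoint_left, dist_midpoint_right]

end Triangle

/-! ### Base times height -/

section BaseHeight

/-- Twice the area of a planar triangle is the base times the height `1 / ‖g‖`. -/
theorem norm_eq_det_mul_two {u w g : Pt 2} (hu : inner ℝ g u = 0) (hw : inner ℝ g w = 1) :
    ‖u‖ = |u 0 * w 1 - u 1 * w 0| * ‖g‖ := by
  rw [← sq_eq_sq₀ (norm_nonneg _) (by positivity), mul_pow, sq_abs]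
  simp only [← real_inner_self_eq_norm_sq]
  simp only [PiLp.inner_apply, RCLike.inner_apply, conj_trivial, Fin.sum_univ_two] at *
  have h0 : (u 0 * w 1 - u 1 * w 0) * g 0 = - u 1 := by linear_combination w 1 * hu - u 1 * hw
  have h1 : (u 0 * w 1 - u 1 * w 0) * g 1 = u 0 := by linear_combination u 0 * hw - w 0 * hu
  calc u 0 * u 0 + u 1 * u 1 = ((u 0 * w 1 - u 1 * w 0) * g 0) ^ 2
        + ((u 0 * w 1 - u 1 * w 0) * g 1) ^ 2 := by rw [h0, h1]; ring
    _ = _ := by ring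

/-- Six times the volume of a tetrahedron is twice the area of the base times the height
`1 / ‖g‖`. -/
theorem two_mul_triArea_eq_det_mul {a b c : Pt 3} {w g : Pt 3} (hu : inner ℝ g (b - a) = 0)
    (hv : inner ℝ g (c - a) = 0) (hw : inner ℝ g w = 1) :
    2 * triArea a b c = |(b - a) 0 * (c - a) 1 * w 2 - (b - a) 0 * w 1 * (c - a) 2
      - (c - a) 0 * (b - a) 1 * w 2 + (c - a) 0 * w 1 * (b - a) 2
      + w 0 * (b - a) 1 * (c - a) 2 - w 0 * (c - a) 1 * (b - a) 2| * ‖g‖ := by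
  unfold triArea
  rw [mul_div_cancel₀ _ (two_ne_zero)]
  generalize b - a = u at *
  generalize c - a = v at *
  rw [← Real.sqrt_sq (norm_nonneg g), ← Real.sqrt_sq_eq_abs, ← Real.sqrt_mul (sq_nonneg _)]
  congr 1
  simp only [← real_inner_self_eq_norm_sq]
  simp only [PiLp.inner_apply, RCLike.inner_apply, conj_trivial, Fin.sum_univ_three] at *
  set D := u 0 * v 1 * w 2 - u 0 * w 1 * v 2 - v 0 * u 1 * w 2 + v 0 * w 1 * u 2
    + w 0 * u 1 * v 2 - w 0 * v 1 * u 2 with hD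
  have h0 : D * g 0 = u 1 * v 2 - u 2 * v 1 := by
    rw [hD]
    linear_combination (u 1 * v 2 - u 2 * v 1) * hw + (v 1 * w 2 - v 2 * w 1) * hu
      + (w 1 * u 2 - w 2 * u 1) * hv
  have h1 : D * g 1 = u 2 * v 0 - u 0 * v 2 := by
    rw [hD]
    linear_combination (u 2 * v 0 - u 0 * v 2) * hw + (v 2 * w 0 - v 0 * w 2) * hu
      + (w 2 * u 0 - w 0 * u 2) * hv
  have h2 : D * g 2 = u 0 * v 1 - u 1 * v 0 := by
    rw [hD]
    linear_combination (u 0 * v 1 - u 1 * v 0) * hw + (v 0 * w 1 - v 1 * w 0) * hu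
      + (w 0 * u 1 - w 1 * u 0) * hv
  calc _ = (D * g 0) ^ 2 + (D * g 1) ^ 2 + (D * g 2) ^ 2 := by rw [h0, h1, h2]; ring
    _ = _ := by ring

/-- The modulus of the determinant of the edges of a simplex, written through its volume so as to
be manifestly independent of the labelling of the vertices. -/
def detAbs {d : ℕ} (s : Affine.Simplex ℝ (Pt d) d) : ℝ :=
  volume.real s.interior / volume.real (stdCorner d)

theorem detAbs_pos {d : ℕ} [NeZero d] (s : Affine.Simplex ℝ (Pt d) d) : 0 < detAbs s :=
  div_pos (volume_interior_pos s) (volume_stdCorner_pos s)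

theorem detAbs_eq {d : ℕ} [NeZero d] (s : Affine.Simplex ℝ (Pt d) d)
    (σ : Fin (d + 1) → Fin (d + 1)) (hσ : Function.Injective σ) :
    detAbs s = |Matrix.det (Matrix.of fun r j : Fin d =>
      (s.points (σ j.succ) - s.points (σ 0)) r)| := by
  let e := (Equiv.ofBijective σ (Finite.injective_iff_bijective.1 hσ)).symm
  have h := volume_interior (s.reindex e)
  rw [Affine.Simplex.interior_reindex] at h
  rw [detAbs, h, mul_div_cancel_right₀ _ (volume_stdCorner_pos s).ne']
  rfl

theorem dist_eq_detAbs_mul (s : Affine.Simplex ℝ (Pt 2) 2) {a b i : Fin 3} (hab : a ≠ b)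
    (ha : a ≠ i) (hb : b ≠ i) :
    dist (s.points a) (s.points b) = detAbs s * ‖baryGrad s i‖ := by
  have h := norm_eq_det_mul_two (u := s.points b - s.points a) (w := s.points i - s.points a)
    (g := baryGrad s i) (by rw [inner_baryGrad]; simp [ha.symm, hb.symm])
    (by rw [inner_baryGrad]; simp [ha.symm])
  rw [dist_comm, dist_eq_norm, h, detAbs_eq s ![a, b, i]]
  · rw [Matrix.det_fin_two]
    congr 2
    simp [Matrix.of_apply]
    ring
  · intro x y; fin_cases x <;> fin_cases y <;> simp [hab, ha, hb, hab.symm, ha.symm, hb.symm]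

theorem two_mul_triArea_eq (s : Affine.Simplex ℝ (Pt 3) 3) {a b c i : Fin 4} (hab : a ≠ b)
    (hac : a ≠ c) (hbc : b ≠ c) (ha : a ≠ i) (hb : b ≠ i) (hc : c ≠ i) :
    2 * triArea (s.points a) (s.points b) (s.points c) = detAbs s * ‖baryGrad s i‖ := by
  have h := two_mul_triArea_eq_det_mul (a := s.points a) (b := s.points b) (c := s.points c)
    (w := s.points i - s.points a)
    (g := baryGrad s i) (by rw [inner_baryGrad]; simp [ha.symm, hb.symm])
    (by rw [inner_baryGrad]; simp [ha.symm, hc.symm])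
    (by rw [inner_baryGrad]; simp [ha.symm])
  rw [h, detAbs_eq s ![a, b, c, i]]
  · rw [Matrix.det_fin_three]
    congr 2
  · intro x y
    fin_cases x <;> fin_cases y <;>
      simp [hab, ha, hb, hc, hac, hbc, hab.symm, ha.symm, hb.symm, hc.symm, hac.symm, hbc.symm]

end BaseHeight

/-! ### Sums over the edges of a face -/

section Edges

variable {d : ℕ}

/-- Summing over the edges of a face, with both orientations. -/
theorem sum_edges_add_swap {β : Type*} [AddCommMonoid β] (i : Fin (d + 1))
    (f : Fin (d + 1) → Fin (d + 1) → β) :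
    ∑ e ∈ Triangulation.edges i, (f e.1 e.2 + f e.2 e.1)
      = ∑ a ∈ Finset.univ.erase i, ∑ b ∈ (Finset.univ.erase i).erase a, f a b := by
  have h1 : ∑ a ∈ Finset.univ.erase i, ∑ b ∈ (Finset.univ.erase i).erase a, f a b
      = ∑ e : Fin (d + 1) × Fin (d + 1), if e.1 ≠ e.2 ∧ e.1 ≠ i ∧ e.2 ≠ i then f e.1 e.2 else 0 := by
    rw [Fintype.sum_prod_type]
    rw [← Finset.sum_subset (Finset.subset_univ (Finset.univ.erase i))]
    · refine Finset.sum_congr rfl fun a ha => ?_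
      rw [← Finset.sum_filter]
      refine Finset.sum_congr ?_ fun _ _ => rfl
      ext b
      have := Finset.ne_of_mem_erase ha
      simp [this, eq_comm]
    · intro a _ ha
      simp at ha
      simp [ha]
  have h2 : ∑ e : Fin (d + 1) × Fin (d + 1), (if e.1 ≠ e.2 ∧ e.1 ≠ i ∧ e.2 ≠ i then f e.1 e.2 else 0)
      = ∑ e : Fin (d + 1) × Fin (d + 1), (if e.1 < e.2 ∧ e.1 ≠ i ∧ e.2 ≠ i then f e.1 e.2 else 0)
      + ∑ e : Fin (d + 1) × Fin (d + 1), (if e.2 < e.1 ∧ e.2 ≠ i ∧ e.1 ≠ i then f e.1 e.2 else 0) := by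
    rw [← Finset.sum_add_distrib]
    refine Finset.sum_congr rfl fun e _ => ?_
    rcases lt_trichotomy e.1 e.2 with h | h | h
    · simp [h, h.ne, h.not_gt]
    · simp [h]
    · have h3 : (e.1 ≠ i ∧ e.2 ≠ i) ↔ (e.2 ≠ i ∧ e.1 ≠ i) := and_comm
      simp [h, h.ne', h.not_gt, h3]
  rw [h1, h2, Finset.sum_add_distrib]
  congr 1
  · rw [Triangulation.edges, Finset.sum_filter]
  · rw [Triangulation.edges, Finset.sum_filter, ← (Equiv.prodComm _ _).sum_comp]
    rfl

end Edges

/-! ### Measures of faces and of dual faces -/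

namespace Triangulation

variable {d : ℕ} [NeZero d] {Ω : Set (Pt d)} (𝒯 : Triangulation d Ω)

theorem mSigma_nonneg (K : Fin 𝒯.n) (i : Fin (d + 1)) (e : Fin (d + 1) × Fin (d + 1)) :
    0 ≤ 𝒯.mSigma K i e := by
  unfold mSigma
  split_ifs
  · exact dist_nonneg
  · exact triArea_nonneg _ _ _

theorem mSigma_comm (K : Fin 𝒯.n) (i a b : Fin (d + 1)) :
    𝒯.mSigma K i (a, b) = 𝒯.mSigma K i (b, a) := by
  unfold mSigma
  split_ifs
  · exact dist_comm _ _
  · exact triArea_swap_left _ _ _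

theorem mFace_nonneg (K : Fin 𝒯.n) (i : Fin (d + 1)) : 0 ≤ 𝒯.mFace K i :=
  Finset.sum_nonneg fun e _ => 𝒯.mSigma_nonneg K i e

theorem two_mul_mFace (K : Fin 𝒯.n) (i : Fin (d + 1)) :
    2 * 𝒯.mFace K i = ∑ a ∈ Finset.univ.erase i, ∑ b ∈ (Finset.univ.erase i).erase a,
      𝒯.mSigma K i (a, b) := by
  rw [← sum_edges_add_swap i fun a b => 𝒯.mSigma K i (a, b), mFace, Finset.mul_sum]
  refine Finset.sum_congr rfl fun e _ => ?_
  rw [𝒯.mSigma_comm K i e.2 e.1, two_mul]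

/-- The vector `∑_b m_σ(a,b) (x_b - x_a) / |x_b - x_a|²`, sum over the edges of the face `i` of `K`
issued from its vertex `a`. -/
def starVec (K : Fin 𝒯.n) (i a : Fin (d + 1)) : Pt d :=
  ∑ b ∈ (Finset.univ.erase i).erase a,
    (𝒯.mSigma K i (a, b) / dist ((𝒯.simplex K).points a) ((𝒯.simplex K).points b) ^ 2) •
      ((𝒯.simplex K).points b - (𝒯.simplex K).points a)

end Triangulation

open Triangulation

section Two

theorem exists_third_two (i a : Fin 3) (h : a ≠ i) : ∃ b, b ≠ i ∧ b ≠ a ∧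
    (Finset.univ.erase i) = {a, b} ∧ (Finset.univ.erase i).erase a = {b} ∧
    (Finset.univ.erase i).erase b = {a} := by
  revert i a; decide

variable {Ω : Set (Pt 2)} (𝒯 : Triangulation 2 Ω)

theorem mFace_two (K : Fin 𝒯.n) (i : Fin 3) :
    𝒯.mFace K i = detAbs (𝒯.simplex K) * ‖baryGrad (𝒯.simplex K) i‖ := by
  obtain ⟨a, ha⟩ := exists_ne_index (d := 2) i
  obtain ⟨b, hb, hba, h1, h2, h3⟩ := exists_third_two i a ha
  have h := 𝒯.two_mul_mFace K i
  rw [h1, Finset.sum_pair hba.symm, ← h1, h2, h3, Finset.sum_singleton, Finset.sum_singleton,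
    𝒯.mSigma_comm K i b a, ← two_mul] at h
  rw [mul_left_cancel₀ two_ne_zero h, mSigma, if_pos rfl]
  exact dist_eq_detAbs_mul _ hba.symm ha hb

theorem starVec_two (K : Fin 𝒯.n) {i a : Fin 3} (ha : a ≠ i) :
    𝒯.starVec K i a = -(𝒯.mFace K i) • faceGrad (𝒯.simplex K) i a := by
  obtain ⟨b, hb, hba, h1, h2, h3⟩ := exists_third_two i a ha
  have hm : 𝒯.mFace K i = dist ((𝒯.simplex K).points a) ((𝒯.simplex K).points b) := by
    rw [mFace_two, dist_eq_detAbs_mul _ hba.symm ha hb]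
  have hd : dist ((𝒯.simplex K).points a) ((𝒯.simplex K).points b) ≠ 0 := by
    rw [dist_ne_zero]
    exact fun h => hba ((𝒯.simplex K).independent.injective h).symm
  have hs : 𝒯.mSigma K i (a, b) = dist ((𝒯.simplex K).points a) ((𝒯.simplex K).points b) := by
    rw [mSigma, if_pos rfl]
  refine eq_of_inner_face (𝒯.simplex K) ha ?_ ?_ ?_
  · rw [starVec, h2, Finset.sum_singleton, inner_smul_left, real_inner_comm, inner_baryGrad]
    simp [ha.symm, hb.symm]
  · rw [inner_smul_left, inner_faceGrad_baryGrad, mul_zero]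
  · intro c hc
    have hc' : c ∈ Finset.univ.erase i := by simp [hc]
    rw [h1, Finset.mem_insert, Finset.mem_singleton] at hc'
    rcases hc' with rfl | rfl
    · simp
    · rw [starVec, h2, Finset.sum_singleton, inner_smul_left, inner_smul_left,
        inner_faceGrad_edge _ _ hc ha, hs, hm, real_inner_self_eq_norm_sq, ← dist_eq_norm,
        dist_comm ((𝒯.simplex K).points c)]
      simp [hba.symm]
      field_simp

end Two

section Three

theorem exists_third_three (i a b : Fin 4) (h : a ≠ i) (hb : b ≠ i) (hab : a ≠ b) :
    ∃ c, c ≠ i ∧ c ≠ a ∧ c ≠ b ∧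
    (Finset.univ.erase i) = {a, b, c} ∧ (Finset.univ.erase i).erase a = {b, c} ∧
    (Finset.univ.erase i).erase b = {a, c} ∧ (Finset.univ.erase i).erase c = {a, b} := by
  revert i a b; decide

variable {Ω : Set (Pt 3)} (𝒯 : Triangulation 3 Ω)

/-- Each part of a face is the face scaled by a barycentric coordinate of its centre. -/
theorem mSigma_three (h𝒯 : 𝒯.IsDDFV) (K : Fin 𝒯.n) {a b c i : Fin 4} (hab : a ≠ b)
    (hac : a ≠ c) (hbc : b ≠ c) (ha : a ≠ i) (hb : b ≠ i) (hc : c ≠ i)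
    (huniv : (Finset.univ.erase i) = {a, b, c}) :
    𝒯.mSigma K i (a, b) = bary (𝒯.simplex K) c (𝒯.face K i).circumcenter *
      (detAbs (𝒯.simplex K) * ‖baryGrad (𝒯.simplex K) i‖ / 2) := by
  set s := 𝒯.simplex K with hs
  set x := (𝒯.face K i).circumcenter with hx
  have hi : bary s i x = 0 := bary_face_circumcenter s i
  have hpos := ((mem_face_closedInterior_iff s i x).1 (h𝒯.face_center rfl K i)).2
  have hsum := sum_bary s x
  have hcomb := sum_bary_smul s x
  rw [← Finset.add_sum_erase _ _ (Finset.mem_univ i), hi, huniv,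
    Finset.sum_insert (by simp [hab, hac]), Finset.sum_pair hbc] at hsum hcomb
  have hcomb' : x - s.points a = bary s b x • (s.points b - s.points a) +
      bary s c x • (s.points c - s.points a) := by
    have h3 : bary s a x = 1 - bary s b x - bary s c x := by linarith
    conv_lhs => rw [← hcomb, h3]
    module
  rw [mSigma, if_neg (by norm_num)]
  change triArea (s.points a) (s.points b) x = _
  rw [triArea_smul hcomb', abs_of_nonneg (hpos c)]
  rw [← two_mul_triArea_eq s hab hac hbc ha hb hc]
  ring

theorem mFace_three (h𝒯 : 𝒯.IsDDFV) (K : Fin 𝒯.n) (i : Fin 4) :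
    2 * 𝒯.mFace K i = detAbs (𝒯.simplex K) * ‖baryGrad (𝒯.simplex K) i‖ := by
  obtain ⟨a, b, ha, hb, hab⟩ : ∃ a b : Fin 4, a ≠ i ∧ b ≠ i ∧ a ≠ b := by
    revert i; decide
  obtain ⟨c, hc, hca, hcb, h1, h2, h3, h4⟩ := exists_third_three i a b ha hb hab
  have h := 𝒯.two_mul_mFace K i
  rw [h1, Finset.sum_insert (by simp [hab, hca.symm]), Finset.sum_pair hcb.symm, ← h1, h2, h3, h4,
    Finset.sum_pair hcb.symm, Finset.sum_pair hca.symm, Finset.sum_pair hab,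
    𝒯.mSigma_comm K i b a, 𝒯.mSigma_comm K i c a, 𝒯.mSigma_comm K i c b,
    mSigma_three 𝒯 h𝒯 K hab hca.symm hcb.symm ha hb hc h1,
    mSigma_three 𝒯 h𝒯 K hca.symm hab hcb ha hc hb (by rw [h1]; congr 1; exact Finset.pair_comm _ _),
    mSigma_three 𝒯 h𝒯 K hcb.symm hab.symm hca hb hc ha
      (by rw [h1]; ext x; simp; tauto)] at h
  have hi := bary_face_circumcenter (𝒯.simplex K) i
  have hsum := sum_bary (𝒯.simplex K) (𝒯.face K i).circumcenter
  rw [← Finset.add_sum_erase _ _ (Finset.mem_univ i), h1,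
    Finset.sum_insert (by simp [hab, hca.symm]), Finset.sum_pair hcb.symm] at hsum
  change bary (𝒯.simplex K) i (𝒯.face K i).circumcenter = 0 at hi
  rw [h]
  linear_combination (detAbs (𝒯.simplex K) * ‖baryGrad (𝒯.simplex K) i‖) * (hsum - hi)

theorem starVec_three (h𝒯 : 𝒯.IsDDFV) (K : Fin 𝒯.n) {i a : Fin 4} (ha : a ≠ i) :
    (2 : ℝ) • 𝒯.starVec K i a = -(𝒯.mFace K i) • faceGrad (𝒯.simplex K) i a := by
  refine eq_of_inner_face (𝒯.simplex K) ha ?_ ?_ ?_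
  · rw [starVec, inner_smul_left, sum_inner, Finset.sum_eq_zero, mul_zero]
    intro b hb
    have hbi : b ≠ i := by simp at hb; exact hb.2
    rw [inner_smul_left, real_inner_comm, inner_baryGrad]
    simp [ha.symm, hbi.symm]
  · rw [inner_smul_left, inner_faceGrad_baryGrad, mul_zero]
  · intro b hb
    by_cases hab : a = b
    · subst hab; simp
    obtain ⟨c, hc, hca, hcb, h1, h2, h3, h4⟩ := exists_third_three i a b ha hb hab
    have hM := mFace_three 𝒯 h𝒯 K i
    set s := 𝒯.simplex K with hs
    set x := (𝒯.face K i).circumcenter with hx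
    have hd : ∀ b, a ≠ b → dist (s.points a) (s.points b) ≠ 0 := by
      intro b hab
      rw [dist_ne_zero]
      exact fun h => hab (s.independent.injective h)
    rw [starVec, h2, Finset.sum_pair hcb.symm, inner_smul_left, inner_smul_left,
      inner_faceGrad_edge _ _ hb ha,
      mSigma_three 𝒯 h𝒯 K hab hca.symm hcb.symm ha hb hc h1,
      mSigma_three 𝒯 h𝒯 K hca.symm hab hcb ha hc hb
        (by rw [h1]; congr 1; exact Finset.pair_comm _ _), ← hs, ← hx, ← hM,
      inner_add_left, inner_smul_left, inner_smul_left]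
    have e1 : ∀ b, inner ℝ (s.points b - s.points a) (s.points b - s.points a)
        = dist (s.points a) (s.points b) ^ 2 := by
      intro b
      rw [real_inner_self_eq_norm_sq, ← dist_eq_norm, dist_comm]
    -- the centre of the face projects onto the midpoint of each edge
    have hmid : 2 * inner ℝ (s.points c - s.points a) (x - s.points a)
        = dist (s.points a) (s.points c) ^ 2 := by
      have h5 := dist_face_circumcenter s ha hc
      change dist (s.points a) x = dist (s.points c) x at h5
      have h6 : inner ℝ (x - midpoint ℝ (s.points a) (s.points c)) (s.points c - s.points a)
          = (0 : ℝ) := by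
        refine inner_sub_eq_zero_of_dist_eq ?_ h5.symm
        rw [dist_comm (s.points c), dist_comm (s.points a), dist_midpoint_left,
          dist_midpoint_right]
      have h7 : x - s.points a = (x - midpoint ℝ (s.points a) (s.points c))
          + (1 / 2 : ℝ) • (s.points c - s.points a) := by
        rw [midpoint_eq_smul_add, invOf_eq_inv]
        module
      rw [h7, inner_add_right, inner_smul_right, real_inner_comm, h6, e1]
      ring
    have hi : bary s i x = 0 := bary_face_circumcenter s i
    have hsum := sum_bary s x
    have hcomb := sum_bary_smul s x
    rw [← Finset.add_sum_erase _ _ (Finset.mem_univ i), hi, h1,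
      Finset.sum_insert (by simp [hab, hca.symm]), Finset.sum_pair hcb.symm] at hsum hcomb
    have hcomb' : x - s.points a = bary s b x • (s.points b - s.points a) +
        bary s c x • (s.points c - s.points a) := by
      have h3 : bary s a x = 1 - bary s b x - bary s c x := by linarith
      conv_lhs => rw [← hcomb, h3]
      module
    rw [hcomb', inner_add_right, inner_smul_right, inner_smul_right, e1] at hmid
    rw [e1]
    have := hd b hab
    have := hd c hca.symm
    simp only [if_neg hab, if_true]
    simp only [conj_trivial]
    field_simp
    linear_combination (𝒯.mFace K i) * hmid

end Three

/-! ### Simplices sharing a face -/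

section SharedFace

variable {d : ℕ}

theorem bary_sum_smul (s : Affine.Simplex ℝ (Pt d) d) {ι : Type*} [Fintype ι] (w : ι → ℝ)
    (p : ι → Pt d) (hw : ∑ j, w j = 1) (a : Fin (d + 1)) :
    bary s a (∑ j, w j • p j) = ∑ j, w j * bary s a (p j) := by
  have h : ∑ j, w j • p j - s.points a = ∑ j, w j • (p j - s.points a) := by
    simp only [smul_sub, Finset.sum_sub_distrib, ← Finset.sum_smul, hw, one_smul]
  have h1 := bary_sub s a (∑ j, w j • p j) (s.points a)
  rw [h, inner_sum] at h1
  simp only [inner_smul_right, ← bary_sub, mul_sub, Finset.sum_sub_distrib, ← Finset.sum_mul, hw,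
    one_mul] at h1
  linarith

/-- The change of barycentric coordinates between two simplices. -/
theorem bary_change (s t : Affine.Simplex ℝ (Pt d) d) (a : Fin (d + 1)) (x : Pt d) :
    bary t a x = ∑ b, bary s b x * bary t a (s.points b) := by
  conv_lhs => rw [← sum_bary_smul s x]
  exact bary_sum_smul t _ _ (sum_bary s x) a

/-- The barycentre of the face opposite to the vertex `i`. -/
def faceCenter (s : Affine.Simplex ℝ (Pt d) d) (i : Fin (d + 1)) : Pt d :=
  bcenter s + (-(1 / (d : ℝ))) • (s.points i - bcenter s)

variable [NeZero d]

theorem bary_faceCenter_self (s : Affine.Simplex ℝ (Pt d) d) (i : Fin (d + 1)) :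
    bary s i (faceCenter s i) = 0 := by
  have : (d : ℝ) ≠ 0 := NeZero.ne _
  have : (d : ℝ) + 1 ≠ 0 := by positivity
  rw [faceCenter, bary_lineMap, bary_bcenter, bary_points, if_pos rfl]
  field_simp
  ring

theorem bary_faceCenter_pos (s : Affine.Simplex ℝ (Pt d) d) {i b : Fin (d + 1)} (hb : b ≠ i) :
    0 < bary s b (faceCenter s i) := by
  have : 0 < (d : ℝ) := by have := NeZero.pos d; positivity
  rw [faceCenter, bary_lineMap, bary_bcenter, bary_points, if_neg hb]
  have : (0 : ℝ) < ((d : ℝ) + 1)⁻¹ := by positivity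
  have : (0 : ℝ) < 1 / (d : ℝ) := by positivity
  nlinarith

/-- Two simplices with a common face have their vertices matched by a permutation of the labels,
apart from the vertices opposite to that face. -/
theorem exists_perm_of_range_eq {s t : Affine.Simplex ℝ (Pt d) d} {i j : Fin (d + 1)}
    (h : Set.range (s.faceOpposite i).points = Set.range (t.faceOpposite j).points) :
    ∃ σ : Equiv.Perm (Fin (d + 1)), σ i = j ∧ ∀ b, b ≠ i → t.points (σ b) = s.points b := by
  have h1 : ∀ b, ∃ b', (b = i → b' = j) ∧ (b ≠ i → b' ≠ j ∧ t.points b' = s.points b) := by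
    intro b
    by_cases hb : b = i
    · exact ⟨j, fun _ => rfl, fun h => absurd hb h⟩
    · have h2 := (mem_face_range s).2 hb
      rw [h, Affine.Simplex.range_faceOpposite_points] at h2
      obtain ⟨b', hb', h3⟩ := h2
      exact ⟨b', fun h => absurd h hb, fun _ => ⟨hb', h3⟩⟩
  choose σ hσ1 hσ2 using h1
  have hinj : Function.Injective σ := by
    intro a b hab
    by_cases ha : a = i
    · by_cases hb : b = i
      · rw [ha, hb]
      · exact absurd (hab.symm.trans (hσ1 a ha)) (hσ2 b hb).1
    · by_cases hb : b = i
      · exact absurd (hab.trans (hσ1 b hb)) (hσ2 a ha).1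
      · apply s.independent.injective
        rw [← (hσ2 a ha).2, ← (hσ2 b hb).2, hab]
  exact ⟨Equiv.ofBijective σ (Finite.injective_iff_bijective.1 hinj), hσ1 i rfl,
    fun b hb => (hσ2 b hb).2⟩

variable {s t : Affine.Simplex ℝ (Pt d) d} {i j : Fin (d + 1)}

theorem bary_opposite_eq
    (h : Set.range (s.faceOpposite i).points = Set.range (t.faceOpposite j).points) (x : Pt d) :
    bary t j x = bary s i x * bary t j (s.points i) := by
  obtain ⟨σ, hσ, hσ'⟩ := exists_perm_of_range_eq h
  rw [bary_change s t, Finset.sum_eq_single i]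
  · intro b _ hb
    rw [← hσ' b hb, bary_points, if_neg, mul_zero]
    rw [← hσ]
    exact fun h => hb (σ.injective h.symm)
  · simp

theorem baryGrad_opposite_eq
    (h : Set.range (s.faceOpposite i).points = Set.range (t.faceOpposite j).points) :
    baryGrad t j = bary t j (s.points i) • baryGrad s i := by
  refine eq_zero_of_inner_edges s i (fun b => ?_) |> sub_eq_zero.1
  rw [inner_sub_left, inner_smul_left, ← bary_sub, ← bary_sub, bary_opposite_eq h (s.points b),
    bary_opposite_eq h (s.points i)]
  simp only [bary_points, conj_trivial]
  split_ifs <;> simp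

theorem bary_opposite_ne_zero
    (h : Set.range (s.faceOpposite i).points = Set.range (t.faceOpposite j).points) :
    bary t j (s.points i) ≠ 0 := by
  intro h0
  apply baryGrad_ne_zero t j
  rw [baryGrad_opposite_eq h, h0, zero_smul]

/-- Two simplices that lie on the same side of a common face overlap. -/
theorem not_disjoint_of_same_side
    (h : Set.range (s.faceOpposite i).points = Set.range (t.faceOpposite j).points)
    (hpos : 0 < bary t j (s.points i)) : ¬ Disjoint s.interior t.interior := by
  obtain ⟨σ, hσ, hσ'⟩ := exists_perm_of_range_eq h
  have hface : ∀ b, b ≠ i → 0 < bary t (σ b) (faceCenter s i) := by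
    intro b hb
    rw [bary_change s t, Finset.sum_eq_single b]
    · rw [← hσ' b hb, bary_points, if_pos rfl, mul_one]
      exact bary_faceCenter_pos s hb
    · intro c _ hc
      by_cases hci : c = i
      · rw [hci, bary_faceCenter_self, zero_mul]
      · rw [← hσ' c hci, bary_points, if_neg, mul_zero]
        exact fun h => hc (σ.injective h.symm)
    · simp
  have hev : ∀ᶠ τ : ℝ in nhdsWithin 0 (Ioi 0),
      ∀ b, b ≠ i → 0 < bary t (σ b) (faceCenter s i + τ • (s.points i - faceCenter s i)) := by
    rw [Filter.eventually_all]
    intro b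
    by_cases hb : b = i
    · simp [hb]
    · simp only [ne_eq, hb, not_false_eq_true, forall_true_left]
      apply Filter.Eventually.filter_mono nhdsWithin_le_nhds
      have hc : Continuous fun τ : ℝ =>
          bary t (σ b) (faceCenter s i + τ • (s.points i - faceCenter s i)) :=
        (continuous_bary t _).comp (by fun_prop)
      apply hc.continuousAt.eventually_mem (isOpen_Ioi.mem_nhds _)
      simpa using hface b hb
  have h1 : ∀ᶠ τ : ℝ in nhdsWithin 0 (Ioi 0), τ < 1 := nhdsWithin_le_nhds (Iio_mem_nhds one_pos)
  obtain ⟨τ, ⟨hτ, hτ1⟩, hτ0⟩ := (hev.and h1 |>.and self_mem_nhdsWithin).exists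
  have hτ0' : 0 < τ := hτ0
  refine Set.not_disjoint_iff.2 ⟨faceCenter s i + τ • (s.points i - faceCenter s i), ?_, ?_⟩
  · rw [mem_interior_iff]
    intro b
    rw [bary_lineMap]
    by_cases hb : b = i
    · rw [hb, bary_faceCenter_self, bary_points, if_pos rfl]; linarith
    · rw [bary_points, if_neg hb]
      have := bary_faceCenter_pos s hb
      nlinarith
  · rw [mem_interior_iff]
    intro b
    obtain ⟨a, rfl⟩ := σ.surjective b
    by_cases ha : a = i
    · rw [ha, hσ, bary_opposite_eq h, bary_lineMap, bary_faceCenter_self, bary_points, if_pos rfl]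
      refine mul_pos ?_ hpos
      linarith
    · exact hτ a ha

end SharedFace

/-! ### Neighbours -/

namespace Triangulation

variable {d : ℕ} [NeZero d] {Ω : Set (Pt d)} (𝒯 : Triangulation d Ω)

theorem eq_of_same_side {K L : Fin 𝒯.n} {i j : Fin (d + 1)}
    (h : Set.range (𝒯.face K i).points = Set.range (𝒯.face L j).points)
    (hpos : 0 < bary (𝒯.simplex L) j ((𝒯.simplex K).points i)) : K = L := by
  by_contra hKL
  exact not_disjoint_of_same_side h hpos (𝒯.disjoint K L hKL)

/-- Neighbours lie on opposite sides of their common face. -/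
theorem bary_opposite_neg {K L : Fin 𝒯.n} {i j : Fin (d + 1)} (hKL : K ≠ L)
    (h : Set.range (𝒯.face K i).points = Set.range (𝒯.face L j).points) :
    bary (𝒯.simplex L) j ((𝒯.simplex K).points i) < 0 :=
  lt_of_le_of_ne (not_lt.1 fun hp => hKL (𝒯.eq_of_same_side h hp)) (bary_opposite_ne_zero h)

/-- At most two control volumes share a face. -/
theorem neighbour_unique {K L L' : Fin 𝒯.n} {i j j' : Fin (d + 1)} (hL : K ≠ L) (hL' : K ≠ L')
    (h : Set.range (𝒯.face K i).points = Set.range (𝒯.face L j).points)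
    (h' : Set.range (𝒯.face K i).points = Set.range (𝒯.face L' j').points) : L = L' := by
  have h1 := 𝒯.bary_opposite_neg hL h
  have h2 := 𝒯.bary_opposite_neg hL' h'
  refine 𝒯.eq_of_same_side (h.symm.trans h') ?_
  have h3 := bary_opposite_eq h ((𝒯.simplex L).points j)
  rw [bary_points, if_pos rfl] at h3
  rw [bary_opposite_eq h' ((𝒯.simplex L).points j)]
  have h4 : bary (𝒯.simplex K) i ((𝒯.simplex L).points j) < 0 := by
    by_contra hc
    rw [not_lt] at hc
    nlinarith [mul_nonneg hc (neg_nonneg.2 h1.le)]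
  exact mul_pos_of_neg_of_neg h4 h2

theorem face_index_unique {K : Fin 𝒯.n} {i j : Fin (d + 1)}
    (h : Set.range (𝒯.face K i).points = Set.range (𝒯.face K j).points) : i = j := by
  by_contra hij
  have h1 := (mem_face_range (𝒯.simplex K)).2 hij
  change (𝒯.simplex K).points i ∈ Set.range (𝒯.face K j).points at h1
  rw [← h] at h1
  exact (mem_face_range (𝒯.simplex K)).1 h1 rfl

theorem isBdryFace_iff_of_range_eq {K L : Fin 𝒯.n} {i j : Fin (d + 1)}
    (h : Set.range (𝒯.face K i).points = Set.range (𝒯.face L j).points) :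
    𝒯.IsBdryFace K i ↔ 𝒯.IsBdryFace L j := by
  unfold IsBdryFace
  rw [← Affine.Simplex.convexHull_eq_closedInterior, ← Affine.Simplex.convexHull_eq_closedInterior,
    h]

theorem closedInterior_subset_closure (K : Fin 𝒯.n) :
    (𝒯.simplex K).closedInterior ⊆ closure Ω :=
  (DDFV.closedInterior_subset_closure _).trans (closure_mono (𝒯.interior_subset K))

/-- A face that is not included in the boundary contains a relatively interior point that
belongs to `Ω`. -/
theorem exists_face_point (hΩ : IsOpen Ω) {K : Fin 𝒯.n} {i : Fin (d + 1)}
    (h : ¬ 𝒯.IsBdryFace K i) : ∃ y ∈ Ω, bary (𝒯.simplex K) i y = 0 ∧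
      ∀ b, b ≠ i → 0 < bary (𝒯.simplex K) b y := by
  obtain ⟨y, hy, hyf⟩ := Set.not_subset.1 h
  have hy' := (mem_face_closedInterior_iff (𝒯.simplex K) i y).1 hy
  have hyΩ : y ∈ Ω := by
    have h1 : y ∈ closure Ω :=
      𝒯.closedInterior_subset_closure K ((mem_closedInterior_iff _ _).2 hy'.2)
    by_contra hn
    exact hyf ⟨h1, by rwa [hΩ.interior_eq]⟩
  set m := faceCenter (𝒯.simplex K) i
  have hev : ∀ᶠ τ : ℝ in nhdsWithin 0 (Ioi 0), y + τ • (m - y) ∈ Ω := by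
    apply Filter.Eventually.filter_mono nhdsWithin_le_nhds
    have hc : Continuous fun τ : ℝ => y + τ • (m - y) := by fun_prop
    apply hc.continuousAt.eventually_mem (hΩ.mem_nhds _)
    simpa using hyΩ
  have h1 : ∀ᶠ τ : ℝ in nhdsWithin 0 (Ioi 0), τ < 1 := nhdsWithin_le_nhds (Iio_mem_nhds one_pos)
  obtain ⟨τ, ⟨hτ, hτ1⟩, hτ0⟩ := (hev.and h1 |>.and self_mem_nhdsWithin).exists
  have hτ0' : 0 < τ := hτ0
  refine ⟨_, hτ, ?_, fun b hb => ?_⟩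
  · rw [bary_lineMap, hy'.1, bary_faceCenter_self]; simp
  · rw [bary_lineMap]
    have := bary_faceCenter_pos (𝒯.simplex K) hb
    have := hy'.2 b
    nlinarith [mul_nonneg (sub_nonneg.2 hτ1.le) (hy'.2 b), mul_pos hτ0' (bary_faceCenter_pos (𝒯.simplex K) hb)]

/-- Across a face that is not included in the boundary there is another control volume. -/
theorem exists_neighbour (hΩ : IsOpen Ω) {K : Fin 𝒯.n} {i : Fin (d + 1)}
    (h : ¬ 𝒯.IsBdryFace K i) : ∃ L j, K ≠ L ∧
      Set.range (𝒯.face K i).points = Set.range (𝒯.face L j).points := by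
  obtain ⟨y, hyΩ, hyi, hyb⟩ := 𝒯.exists_face_point hΩ h
  -- close to `y`, beyond the face, there are points of other control volumes
  have hcl : y ∈ closure (⋃ L ∈ {L | L ≠ K}, (𝒯.simplex L).interior) := by
    rw [mem_closure_iff]
    intro o ho hyo
    have hU : IsOpen (o ∩ Ω ∩ {x | bary (𝒯.simplex K) i x < 0}) :=
      (ho.inter hΩ).inter (isOpen_lt (continuous_bary _ _) continuous_const)
    have hUne : (o ∩ Ω ∩ {x | bary (𝒯.simplex K) i x < 0}).Nonempty := by
      have hev : ∀ᶠ τ : ℝ in nhdsWithin 0 (Ioi 0),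
          y + (-τ) • ((𝒯.simplex K).points i - y) ∈ o ∩ Ω := by
        apply Filter.Eventually.filter_mono nhdsWithin_le_nhds
        have hc : Continuous fun τ : ℝ => y + (-τ) • ((𝒯.simplex K).points i - y) := by fun_prop
        apply hc.continuousAt.eventually_mem ((ho.inter hΩ).mem_nhds _)
        simpa using ⟨hyo, hyΩ⟩
      obtain ⟨τ, hτ, hτ0⟩ := (hev.and self_mem_nhdsWithin).exists
      refine ⟨_, hτ, ?_⟩
      have hτ0' : 0 < τ := hτ0
      simp only [mem_ofPred_eq]
      rw [bary_lineMap, hyi, bary_points, if_pos rfl]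
      linarith
    have hpos := hU.measure_pos volume hUne
    have hnot : ¬ (o ∩ Ω ∩ {x | bary (𝒯.simplex K) i x < 0}) ⊆
        Ω \ ⋃ K, (𝒯.simplex K).interior := by
      intro hsub
      exact hpos.ne' (measure_mono_null hsub 𝒯.cover)
    obtain ⟨x, hx, hx'⟩ := Set.not_subset.1 hnot
    have : x ∈ ⋃ K, (𝒯.simplex K).interior := by
      by_contra hn; exact hx' ⟨hx.1.2, hn⟩
    obtain ⟨L, hL⟩ := Set.mem_iUnion.1 this
    refine ⟨x, hx.1.1, Set.mem_biUnion (x := L) ?_ hL⟩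
    rintro rfl
    have h1 := (mem_interior_iff _ _).1 hL i
    have h2 : bary (𝒯.simplex L) i x < 0 := hx.2
    exact lt_asymm h1 h2
  rw [Set.Finite.closure_biUnion (Set.toFinite _)] at hcl
  simp only [Set.mem_iUnion] at hcl
  obtain ⟨L, hLK, hyL⟩ := hcl
  have hLK' : L ≠ K := hLK
  rw [closure_interior] at hyL
  have hyK : y ∈ (𝒯.simplex K).closedInterior := by
    rw [mem_closedInterior_iff]
    intro b
    by_cases hb : b = i
    · rw [hb, hyi]
    · exact (hyb b hb).le
  have hmem : y ∈ convexHull ℝ (Set.range (𝒯.simplex K).points ∩ Set.range (𝒯.simplex L).points) := by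
    rw [← 𝒯.conforming K L hLK'.symm]
    exact ⟨hyK, hyL⟩
  -- by conformity every vertex of the face is a vertex of `L`
  have hvert : ∀ b, b ≠ i → (𝒯.simplex K).points b ∈ Set.range (𝒯.simplex L).points := by
    intro b hb
    by_contra hn
    have h0 := affine_eq_on_span (f := (baryBasis (𝒯.simplex K)).coord b) (g := 0)
      (S := Set.range (𝒯.simplex K).points ∩ Set.range (𝒯.simplex L).points) ?_
      (convexHull_subset_affineSpan _ hmem)
    · exact (hyb b hb).ne' h0
    · rintro _ ⟨⟨c, rfl⟩, hc⟩
      have := bary_points (𝒯.simplex K) b c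
      rw [if_neg] at this
      · exact this
      · rintro rfl; exact hn hc
  have hvert' : ∀ b, ∃ b', b ≠ i → (𝒯.simplex L).points b' = (𝒯.simplex K).points b := by
    intro b
    by_cases hb : b = i
    · exact ⟨0, fun h => absurd hb h⟩
    · obtain ⟨b', hb'⟩ := hvert b hb; exact ⟨b', fun _ => hb'⟩
  choose σ hσ using hvert'
  -- the label missed by the vertices of the face
  have hcard : ((Finset.univ.erase i).image σ).card < (Finset.univ : Finset (Fin (d + 1))).card := by
    refine Finset.card_image_le.trans_lt ?_
    exact Finset.card_lt_card (Finset.erase_ssubset (Finset.mem_univ i))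
  have hinj : Set.InjOn σ (Finset.univ.erase i : Finset (Fin (d + 1))) := by
    intro a ha b hb hab
    simp at ha hb
    apply (𝒯.simplex K).independent.injective
    rw [← hσ a ha, ← hσ b hb, hab]
  obtain ⟨j, -, hj⟩ := Finset.exists_mem_notMem_of_card_lt_card hcard
  refine ⟨L, j, hLK'.symm, ?_⟩
  have himg : (Finset.univ.erase i).image σ = Finset.univ.erase j := by
    refine Finset.eq_of_subset_of_card_le ?_ ?_
    · intro b hb
      rw [Finset.mem_erase]
      exact ⟨fun h => hj (h ▸ hb), Finset.mem_univ _⟩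
    · rw [Finset.card_image_of_injOn hinj, Finset.card_erase_of_mem (Finset.mem_univ _),
        Finset.card_erase_of_mem (Finset.mem_univ _)]
  unfold face
  rw [Affine.Simplex.range_faceOpposite_points, Affine.Simplex.range_faceOpposite_points]
  ext x
  constructor
  · rintro ⟨b, hb, rfl⟩
    have hb' : b ≠ i := hb
    refine ⟨σ b, ?_, hσ b hb'⟩
    have : σ b ∈ (Finset.univ.erase i).image σ :=
      Finset.mem_image_of_mem _ (Finset.mem_erase.2 ⟨hb', Finset.mem_univ _⟩)
    rw [himg] at this
    exact Finset.ne_of_mem_erase this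
  · rintro ⟨b, hb, rfl⟩
    have hb' : b ∈ Finset.univ.erase j := Finset.mem_erase.2 ⟨hb, Finset.mem_univ _⟩
    rw [← himg, Finset.mem_image] at hb'
    obtain ⟨a, ha, rfl⟩ := hb'
    exact ⟨a, Finset.ne_of_mem_erase ha, (hσ a (Finset.ne_of_mem_erase ha)).symm⟩

end Triangulation

/-! ### Interfaces and the faces of control volumes -/

namespace Triangulation

variable {d : ℕ} [NeZero d] {Ω : Set (Pt d)} (𝒯 : Triangulation d Ω)

/-- The face `x.2` of the control volume `x.1` is the one through which the interface `D` is seen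
from its second side. -/
def IsSecondSide (D : 𝒯.Interface) (x : Fin 𝒯.n × Fin (d + 1)) : Prop :=
  D.L = Sum.inl x.1 ∧ Set.range (𝒯.face D.K D.i).points = Set.range (𝒯.face x.1 x.2).points

open Classical in
/-- The value of `Φ` at the face of the second control volume of the interface `D`; zero if `D` is
a boundary interface. -/
def secondSide {β : Type*} [AddCommMonoid β] (Φ : Fin 𝒯.n × Fin (d + 1) → β) (D : 𝒯.Interface) :
    β :=
  ∑ x, if 𝒯.IsSecondSide D x then Φ x else 0

variable {𝒯}

theorem Interface.ne {D : 𝒯.Interface} {L : Fin 𝒯.n} (h : D.L = Sum.inl L) : D.K ≠ L :=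
  (D.oriented L h).ne

theorem Interface.exists_second {D : 𝒯.Interface} {L : Fin 𝒯.n} (h : D.L = Sum.inl L) :
    ∃ j, 𝒯.IsSecondSide D (L, j) := by
  have := D.adj
  rw [h] at this
  obtain ⟨j, hj⟩ := this.2.2
  exact ⟨j, h, hj⟩

theorem Interface.bdry {D : 𝒯.Interface} {e : 𝒯.BCell} (h : D.L = Sum.inr e) :
    e.1 = (D.K, D.i) := by
  have := D.adj
  rw [h] at this
  exact this

theorem Interface.isBdryFace {D : 𝒯.Interface} {e : 𝒯.BCell} (h : D.L = Sum.inr e) :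
    𝒯.IsBdryFace D.K D.i := by
  have := e.2
  rwa [Interface.bdry h] at this

theorem Interface.not_isBdryFace {D : 𝒯.Interface} {L : Fin 𝒯.n} (h : D.L = Sum.inl L) :
    ¬ 𝒯.IsBdryFace D.K D.i := by
  have := D.adj
  rw [h] at this
  exact this.2.1

theorem IsSecondSide.ne {D : 𝒯.Interface} {x : Fin 𝒯.n × Fin (d + 1)}
    (h : 𝒯.IsSecondSide D x) : D.K ≠ x.1 := Interface.ne h.1

theorem secondSide_eq {β : Type*} [AddCommMonoid β] (Φ : Fin 𝒯.n × Fin (d + 1) → β)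
    {D : 𝒯.Interface} {x : Fin 𝒯.n × Fin (d + 1)} (h : 𝒯.IsSecondSide D x) :
    𝒯.secondSide Φ D = Φ x := by
  unfold secondSide
  rw [Finset.sum_eq_single x]
  · rw [if_pos h]
  · intro y _ hy
    rw [if_neg]
    rintro hy'
    apply hy
    have h1 : y.1 = x.1 := Sum.inl_injective (hy'.1.symm.trans h.1)
    obtain ⟨L, j⟩ := x
    obtain ⟨L', j'⟩ := y
    simp only at h1
    subst h1
    exact Prod.ext rfl (𝒯.face_index_unique (hy'.2.symm.trans h.2))
  · simp

theorem secondSide_bdry {β : Type*} [AddCommMonoid β] (Φ : Fin 𝒯.n × Fin (d + 1) → β)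
    {D : 𝒯.Interface} {e : 𝒯.BCell} (h : D.L = Sum.inr e) : 𝒯.secondSide Φ D = 0 := by
  unfold secondSide
  refine Finset.sum_eq_zero fun x _ => if_neg ?_
  rintro ⟨h1, -⟩
  rw [h] at h1
  cases h1

variable (𝒯) in
theorem exists_interface (hΩ : IsOpen Ω) (x : Fin 𝒯.n × Fin (d + 1)) :
    ∃ D : 𝒯.Interface, x = (D.K, D.i) ∨ 𝒯.IsSecondSide D x := by
  obtain ⟨K, i⟩ := x
  by_cases hb : 𝒯.IsBdryFace K i
  · exact ⟨⟨K, i, Sum.inr ⟨(K, i), hb⟩, rfl, fun L' h => by cases h⟩, Or.inl rfl⟩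
  · obtain ⟨L, j, hKL, h⟩ := 𝒯.exists_neighbour hΩ hb
    rcases lt_or_gt_of_ne hKL with hlt | hlt
    · refine ⟨⟨K, i, Sum.inl L, ⟨hKL.symm, hb, j, h⟩, ?_⟩, Or.inl rfl⟩
      intro L' h'
      rwa [← Sum.inl_injective h']
    · have hb' : ¬ 𝒯.IsBdryFace L j := by rwa [← 𝒯.isBdryFace_iff_of_range_eq h]
      refine ⟨⟨L, j, Sum.inl K, ⟨hKL, hb', i, h.symm⟩, ?_⟩, Or.inr ⟨rfl, h.symm⟩⟩
      intro L' h'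
      rwa [← Sum.inl_injective h']

theorem Interface.ext_of_first {D D' : 𝒯.Interface} (hK : D.K = D'.K) (hi : D.i = D'.i) :
    D = D' := by
  have hL : D.L = D'.L := by
    rcases hD : D.L with L | e <;> rcases hD' : D'.L with L' | e'
    · obtain ⟨j, hj⟩ := Interface.exists_second hD
      obtain ⟨j', hj'⟩ := Interface.exists_second hD'
      have h1 := hj.2
      rw [hK, hi] at h1
      exact congrArg Sum.inl
        (𝒯.neighbour_unique (by rw [← hK]; exact hj.ne) hj'.ne h1 hj'.2)
    · have h1 := Interface.isBdryFace hD'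
      rw [← hK, ← hi] at h1
      exact absurd h1 (Interface.not_isBdryFace hD)
    · have h1 := Interface.isBdryFace hD
      rw [hK, hi] at h1
      exact absurd h1 (Interface.not_isBdryFace hD')
    · congr 1
      apply Subtype.ext
      rw [Interface.bdry hD, Interface.bdry hD', hK, hi]
  obtain ⟨K, i, L, h1, h2⟩ := D
  obtain ⟨K', i', L', h1', h2'⟩ := D'
  simp only at hK hi hL
  subst hK hi hL
  rfl

theorem interface_unique {x : Fin 𝒯.n × Fin (d + 1)} {D D' : 𝒯.Interface}
    (h : x = (D.K, D.i) ∨ 𝒯.IsSecondSide D x) (h' : x = (D'.K, D'.i) ∨ 𝒯.IsSecondSide D' x) :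
    D = D' := by
  have aux : ∀ {D D' : 𝒯.Interface}, x = (D.K, D.i) → ¬ 𝒯.IsSecondSide D' x := by
    rintro D D' rfl h'
    have hlt : D'.K < D.K := D'.oriented _ h'.1
    have hnb : ¬ 𝒯.IsBdryFace D.K D.i := by
      rw [← 𝒯.isBdryFace_iff_of_range_eq h'.2]
      exact Interface.not_isBdryFace h'.1
    rcases hD : D.L with L | e
    · obtain ⟨j, hj⟩ := Interface.exists_second hD
      have h1 := 𝒯.neighbour_unique hlt.ne' hj.ne h'.2.symm hj.2
      exact lt_asymm hlt (h1 ▸ D.oriented _ hD)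
    · exact hnb (Interface.isBdryFace hD)
  rcases h with h | h <;> rcases h' with h' | h'
  · have h1 := h.symm.trans h'
    rw [Prod.mk.injEq] at h1
    exact Interface.ext_of_first h1.1 h1.2
  · exact absurd h' (aux h)
  · exact absurd h (aux h')
  · have hK : D.K = D'.K := 𝒯.neighbour_unique h.ne.symm h'.ne.symm h.2.symm h'.2.symm
    refine Interface.ext_of_first hK ?_
    have h1 := h.2.trans h'.2.symm
    generalize D.i = i at h1 ⊢
    rw [hK] at h1
    exact 𝒯.face_index_unique h1

/-- Each face of a control volume is one of the two sides of exactly one interface. -/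
theorem sum_faces_eq (hΩ : IsOpen Ω) {β : Type*} [AddCommMonoid β]
    (Φ : Fin 𝒯.n × Fin (d + 1) → β) :
    ∑ x, Φ x = ∑ D : 𝒯.Interface, (Φ (D.K, D.i) + 𝒯.secondSide Φ D) := by
  classical
  have h1 : ∀ D : 𝒯.Interface, Φ (D.K, D.i) + 𝒯.secondSide Φ D
      = ∑ x, if x = (D.K, D.i) ∨ 𝒯.IsSecondSide D x then Φ x else 0 := by
    intro D
    have : Φ (D.K, D.i) = ∑ x, if x = (D.K, D.i) then Φ x else 0 := by
      rw [Finset.sum_ite_eq' Finset.univ (D.K, D.i) Φ, if_pos (Finset.mem_univ _)]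
    rw [this, secondSide, ← Finset.sum_add_distrib]
    refine Finset.sum_congr rfl fun x _ => ?_
    by_cases hx : x = (D.K, D.i)
    · have : ¬ 𝒯.IsSecondSide D x := fun h => h.ne (by rw [hx])
      simp [hx, hx ▸ this]
    · simp [hx]
  simp_rw [h1]
  rw [Finset.sum_comm]
  refine Finset.sum_congr rfl fun x _ => ?_
  obtain ⟨D, hD⟩ := 𝒯.exists_interface hΩ x
  rw [Finset.sum_eq_single D, if_pos hD]
  · intro D' _ hne
    exact if_neg fun h => hne (interface_unique h hD)
  · simp

/-! ### Normals, heights and distances between centres -/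

variable (𝒯) in
/-- The outer unit normal to a face of a control volume. -/
def outer (x : Fin 𝒯.n × Fin (d + 1)) : Pt d :=
  -(‖baryGrad (𝒯.simplex x.1) x.2‖⁻¹ • baryGrad (𝒯.simplex x.1) x.2)

variable (𝒯) in
/-- The signed distance of the centre of a control volume to one of its faces. -/
def height (x : Fin 𝒯.n × Fin (d + 1)) : ℝ :=
  bary (𝒯.simplex x.1) x.2 (𝒯.simplex x.1).circumcenter / ‖baryGrad (𝒯.simplex x.1) x.2‖

theorem norm_outer (x : Fin 𝒯.n × Fin (d + 1)) : ‖𝒯.outer x‖ = 1 := by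
  have := norm_baryGrad_pos (𝒯.simplex x.1) x.2
  rw [outer, norm_neg, norm_smul, norm_inv, norm_norm]
  field_simp

theorem face_circumcenter_sub (K : Fin 𝒯.n) (i : Fin (d + 1)) :
    (𝒯.face K i).circumcenter - (𝒯.simplex K).circumcenter = 𝒯.height (K, i) • 𝒯.outer (K, i) := by
  have h := circumcenter_sub_face_circumcenter (𝒯.simplex K) i
  have hn := norm_baryGrad_pos (𝒯.simplex K) i
  rw [← neg_sub]
  change -((𝒯.simplex K).circumcenter - ((𝒯.simplex K).faceOpposite i).circumcenter) = _
  rw [h, height, outer, smul_neg, smul_smul]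
  congr 2
  field_simp

theorem face_circumcenter_eq {K L : Fin 𝒯.n} {i j : Fin (d + 1)}
    (h : Set.range (𝒯.face K i).points = Set.range (𝒯.face L j).points) :
    (𝒯.face K i).circumcenter = (𝒯.face L j).circumcenter :=
  Affine.Simplex.circumcenter_eq_of_range_eq h

/-- The outer normals to a common face are opposite. -/
theorem outer_second {D : 𝒯.Interface} {x : Fin 𝒯.n × Fin (d + 1)} (h : 𝒯.IsSecondSide D x) :
    𝒯.outer x = - 𝒯.outer (D.K, D.i) := by
  have h1 := baryGrad_opposite_eq h.2
  have h2 := 𝒯.bary_opposite_neg h.ne h.2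
  have hn := norm_baryGrad_pos (𝒯.simplex D.K) D.i
  rw [outer, outer, h1, norm_smul, Real.norm_of_nonpos h2.le, smul_smul, neg_neg, ← neg_smul]
  congr 1
  have := h2.ne
  field_simp

/-- The centres on the two sides of an interface differ by a multiple of the normal, the sum of
their signed distances to the interface. -/
theorem center_sub_center (D : 𝒯.Interface) :
    𝒯.center D.L - 𝒯.center (Sum.inl D.K) =
      (𝒯.height (D.K, D.i) + 𝒯.secondSide 𝒯.height D) • 𝒯.outer (D.K, D.i) := by
  have h1 := 𝒯.face_circumcenter_sub D.K D.i
  rcases hD : D.L with L | e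
  · obtain ⟨j, hj⟩ := Interface.exists_second hD
    have h2 := 𝒯.face_circumcenter_sub L j
    rw [secondSide_eq _ hj, add_smul, ← h1]
    rw [outer_second hj, smul_neg, ← 𝒯.face_circumcenter_eq hj.2] at h2
    have h3 : 𝒯.height (L, j) • 𝒯.outer (D.K, D.i)
        = (𝒯.simplex L).circumcenter - (𝒯.face D.K D.i).circumcenter := by
      rw [← neg_sub, h2, neg_neg]
    rw [h3]
    simp [center]
  · rw [secondSide_bdry _ hD, add_zero, ← h1]
    have h2 := Interface.bdry hD
    simp [center, h2]

/-- The Delaunay condition, or the condition on the centres at the boundary, orients the segment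
that joins the centres on the two sides of an interface. -/
theorem height_add_secondSide_pos (h𝒯 : 𝒯.IsDDFV) (D : 𝒯.Interface) :
    0 < 𝒯.height (D.K, D.i) + 𝒯.secondSide 𝒯.height D := by
  have hcc := center_sub_center D
  rcases hD : D.L with L | e
  · obtain ⟨j, hj⟩ := Interface.exists_second hD
    set η := 𝒯.height (D.K, D.i) + 𝒯.secondSide 𝒯.height D with hη
    have hadj := D.adj
    rw [hD] at hadj hcc
    have hdel := h𝒯.delaunay D.K D.i L hadj j
    have hne : η ≠ 0 := by
      intro h0
      rw [h0, zero_smul, sub_eq_zero] at hcc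
      exact h𝒯.center_ne D.K D.i L hadj hcc.symm
    refine lt_of_le_of_ne ?_ hne.symm
    -- compare the powers of the far vertex `q` of `L` with respect to the two circumscribed spheres
    obtain ⟨c, hc⟩ := exists_ne_index D.i
    obtain ⟨σ, hσ, hσ'⟩ := exists_perm_of_range_eq hj.2
    set q := (𝒯.simplex L).points j
    set P := (𝒯.simplex D.K).points c
    set xK := (𝒯.simplex D.K).circumcenter
    set xL := (𝒯.simplex L).circumcenter
    have hcc' : xL - xK = η • 𝒯.outer (D.K, D.i) := hcc
    have e1 : dist P xK = (𝒯.simplex D.K).circumradius :=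
      Affine.Simplex.dist_circumcenter_eq_circumradius _ _
    have e2 : dist q xL = dist P xL := by
      change dist ((𝒯.simplex L).points j) xL = dist ((𝒯.simplex D.K).points c) xL
      rw [← hσ' c hc]
      exact dist_circumcenter_eq _ _ _
    have hpow : 0 ≤ inner ℝ (xL - xK) (q - P) := by
      have h1 : dist P xK ≤ dist q xK := by rw [e1]; exact hdel
      rw [dist_eq_norm, dist_eq_norm] at h1 e2
      have h2 : ‖P - xK‖ ^ 2 ≤ ‖q - xK‖ ^ 2 := by gcongr
      have h3 : ‖q - xL‖ ^ 2 = ‖P - xL‖ ^ 2 := by rw [e2]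
      simp only [← real_inner_self_eq_norm_sq, inner_sub_left, inner_sub_right] at h2 h3 ⊢
      rw [real_inner_comm xK P, real_inner_comm xK q] at h2
      rw [real_inner_comm xL P, real_inner_comm xL q] at h3
      linarith
    have hq : 0 < inner ℝ (𝒯.outer (D.K, D.i)) (q - P) := by
      have hn := norm_baryGrad_pos (𝒯.simplex D.K) D.i
      have h4 := 𝒯.bary_opposite_neg hj.ne.symm hj.2.symm
      have h5 := bary_sub (𝒯.simplex D.K) D.i q P
      rw [bary_points, if_neg hc.symm, sub_zero] at h5
      simp only at h4
      rw [outer, inner_neg_left, inner_smul_left, ← h5]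
      simp only [map_inv₀, conj_trivial]
      have : 0 < ‖baryGrad (𝒯.simplex D.K) D.i‖⁻¹ := by positivity
      nlinarith
    rw [hcc', inner_smul_left] at hpow
    exact nonneg_of_mul_nonneg_left hpow hq
  · rw [secondSide_bdry _ hD, add_zero]
    have hb := h𝒯.boundary D.K D.i (Interface.isBdryFace hD)
    obtain ⟨c, hc⟩ := exists_ne_index D.i
    rw [height]
    refine div_pos ?_ (norm_baryGrad_pos _ _)
    obtain ⟨⟨p₁, hp₁, p₂, hp₂, hray⟩, hn1, hn2⟩ := hb
    have z1 : bary (𝒯.simplex D.K) D.i p₁ = 0 :=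
      bary_eq_zero_of_mem_affineSpan (𝒯.simplex D.K) hp₁
    have z2 : bary (𝒯.simplex D.K) D.i p₂ = 0 :=
      bary_eq_zero_of_mem_affineSpan (𝒯.simplex D.K) hp₂
    have e1 := bary_sub (𝒯.simplex D.K) D.i (𝒯.simplex D.K).circumcenter p₁
    have e2 := bary_sub (𝒯.simplex D.K) D.i ((𝒯.simplex D.K).points D.i) p₂
    rw [z1, sub_zero] at e1
    rw [z2, sub_zero, bary_points, if_pos rfl] at e2
    simp only
    rw [e1]
    rcases hray with h | h | ⟨r₁, r₂, hr₁, hr₂, h⟩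
    · exfalso
      rw [vsub_eq_sub, sub_eq_zero] at h
      exact hn1 (h ▸ hp₁)
    · exfalso
      rw [vsub_eq_sub, sub_eq_zero] at h
      exact hn2 (h ▸ hp₂)
    · rw [vsub_eq_sub, vsub_eq_sub] at h
      have h6 := congrArg (fun y => inner ℝ (baryGrad (𝒯.simplex D.K) D.i) y) h
      simp only [inner_smul_right] at h6
      rw [← e2, mul_one] at h6
      by_contra hc
      rw [not_lt] at hc
      nlinarith

theorem dKL_eq (h𝒯 : 𝒯.IsDDFV) (D : 𝒯.Interface) :
    𝒯.dKL D = 𝒯.height (D.K, D.i) + 𝒯.secondSide 𝒯.height D := by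
  rw [dKL, dist_comm, dist_eq_norm, center_sub_center, norm_smul, norm_outer, mul_one,
    Real.norm_of_nonneg (height_add_secondSide_pos h𝒯 D).le]

theorem dKL_pos (h𝒯 : 𝒯.IsDDFV) (D : 𝒯.Interface) : 0 < 𝒯.dKL D := by
  rw [dKL_eq h𝒯]; exact height_add_secondSide_pos h𝒯 D

/-- The vector `ν_{KL}` is the unit normal to the interface exterior to `K`. -/
theorem normal_eq (h𝒯 : 𝒯.IsDDFV) (D : 𝒯.Interface) : 𝒯.normal D = 𝒯.outer (D.K, D.i) := by
  rw [normal, center_sub_center, ← dKL_eq h𝒯, smul_smul, inv_mul_cancel₀ (dKL_pos h𝒯 D).ne',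
    one_smul]

theorem norm_normal (h𝒯 : 𝒯.IsDDFV) (D : 𝒯.Interface) : ‖𝒯.normal D‖ = 1 := by
  rw [normal_eq h𝒯, norm_outer]

end Triangulation

/-! ### Closedness of the primal and dual control volumes -/

namespace Triangulation

variable {d : ℕ} [NeZero d] {Ω : Set (Pt d)} {𝒯 : Triangulation d Ω}

/-- Base times height: the measure of a face is proportional to the length of the gradient of the
barycentric coordinate that vanishes on it. -/
theorem mFace_eq (hd : d = 2 ∨ d = 3) (h𝒯 : 𝒯.IsDDFV) (K : Fin 𝒯.n) (i : Fin (d + 1)) :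
    ((d : ℝ) - 1) * 𝒯.mFace K i = detAbs (𝒯.simplex K) * ‖baryGrad (𝒯.simplex K) i‖ := by
  rcases hd with rfl | rfl
  · rw [← mFace_two]; norm_num
  · rw [← mFace_three 𝒯 h𝒯]; norm_num

/-- The reconstruction property: the edges of a face, weighted by the parts of the face that
they support, reproduce the tangential gradients of the barycentric coordinates. For `d = 3` it
rests on the position of the centre of the face. -/
theorem starVec_eq (hd : d = 2 ∨ d = 3) (h𝒯 : 𝒯.IsDDFV) (K : Fin 𝒯.n) {i a : Fin (d + 1)}
    (ha : a ≠ i) :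
    ((d : ℝ) - 1) • 𝒯.starVec K i a = -(𝒯.mFace K i) • faceGrad (𝒯.simplex K) i a := by
  rcases hd with rfl | rfl
  · rw [← starVec_two 𝒯 K ha]; norm_num
  · rw [← starVec_three 𝒯 h𝒯 K ha]; norm_num

theorem one_le_sub_one (hd : d = 2 ∨ d = 3) : 1 ≤ (d : ℝ) - 1 := by
  rcases hd with rfl | rfl <;> norm_num

theorem mFace_pos (hd : d = 2 ∨ d = 3) (h𝒯 : 𝒯.IsDDFV) (K : Fin 𝒯.n) (i : Fin (d + 1)) :
    0 < 𝒯.mFace K i := by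
  have h := mFace_eq hd h𝒯 K i
  have h1 := mul_pos (detAbs_pos (𝒯.simplex K)) (norm_baryGrad_pos (𝒯.simplex K) i)
  rw [← h] at h1
  exact pos_of_mul_pos_right h1 (by linarith [one_le_sub_one hd])

/-- The measure of a common face does not depend on the side. -/
theorem mFace_congr (hd : d = 2 ∨ d = 3) (h𝒯 : 𝒯.IsDDFV) {K L : Fin 𝒯.n} {i j : Fin (d + 1)}
    (h : Set.range (𝒯.face K i).points = Set.range (𝒯.face L j).points) :
    𝒯.mFace K i = 𝒯.mFace L j := by
  have h1 := mFace_eq hd h𝒯 K i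
  have h2 := mFace_eq hd h𝒯 L j
  obtain ⟨σ, hσ, hσ'⟩ := exists_perm_of_range_eq h
  have hne : ∀ b, b ≠ i → σ b ≠ j := fun b hb h => hb (σ.injective (h.trans hσ.symm))
  have h3 : detAbs (𝒯.simplex K) * ‖baryGrad (𝒯.simplex K) i‖
      = detAbs (𝒯.simplex L) * ‖baryGrad (𝒯.simplex L) j‖ := by
    rcases hd with rfl | rfl
    · obtain ⟨a, b, ha, hb, hab⟩ : ∃ a b : Fin 3, a ≠ i ∧ b ≠ i ∧ a ≠ b := by
        clear * -; revert i; decide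
      rw [← dist_eq_detAbs_mul _ hab ha hb,
        ← dist_eq_detAbs_mul _ (σ.injective.ne hab) (hne a ha) (hne b hb), hσ' a ha, hσ' b hb]
    · obtain ⟨a, b, c, ha, hb, hc, hab, hac, hbc⟩ : ∃ a b c : Fin 4, a ≠ i ∧ b ≠ i ∧ c ≠ i ∧
          a ≠ b ∧ a ≠ c ∧ b ≠ c := by
        clear * -; revert i; decide
      rw [← two_mul_triArea_eq _ hab hac hbc ha hb hc,
        ← two_mul_triArea_eq _ (σ.injective.ne hab) (σ.injective.ne hac) (σ.injective.ne hbc)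
          (hne a ha) (hne b hb) (hne c hc), hσ' a ha, hσ' b hb, hσ' c hc]
  have h4 := one_le_sub_one hd
  rw [← h3, ← h1] at h2
  exact (mul_left_cancel₀ (by linarith) h2).symm

theorem mFace_second (hd : d = 2 ∨ d = 3) (h𝒯 : 𝒯.IsDDFV) {D : 𝒯.Interface}
    {x : Fin 𝒯.n × Fin (d + 1)} (h : 𝒯.IsSecondSide D x) :
    𝒯.mFace x.1 x.2 = 𝒯.mFace D.K D.i := (mFace_congr hd h𝒯 h.2).symm

theorem inner_outer_edge (K : Fin 𝒯.n) {i a b : Fin (d + 1)} (ha : a ≠ i) (hb : b ≠ i) :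
    inner ℝ (𝒯.outer (K, i)) ((𝒯.simplex K).points a - (𝒯.simplex K).points b) = 0 := by
  rw [outer, inner_neg_left, inner_smul_left]
  simp only
  rw [inner_baryGrad]
  simp [ha.symm, hb.symm]

theorem dist_points_pos (K : Fin 𝒯.n) {a b : Fin (d + 1)} (h : a ≠ b) :
    0 < dist ((𝒯.simplex K).points a) ((𝒯.simplex K).points b) :=
  dist_pos.2 fun h' => h ((𝒯.simplex K).independent.injective h')

theorem mem_edges {i : Fin (d + 1)} {e : Fin (d + 1) × Fin (d + 1)} :
    e ∈ edges i ↔ e.1 < e.2 ∧ e.1 ≠ i ∧ e.2 ≠ i := by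
  simp [edges]

/-- The two expressions of the volume of a subdiamond. -/
theorem mSigmaStar_mul (hd : d = 2 ∨ d = 3) (h𝒯 : 𝒯.IsDDFV) (D : 𝒯.Interface)
    {e : Fin (d + 1) × Fin (d + 1)} (he : e ∈ edges D.i) :
    𝒯.mSigmaStar D e * dist ((𝒯.simplex D.K).points e.1) ((𝒯.simplex D.K).points e.2) =
      𝒯.mSigma D.K D.i e * 𝒯.dKL D := by
  obtain ⟨-, h1, h2⟩ := mem_edges.1 he
  rcases hd with rfl | rfl
  · rw [mSigmaStar, if_pos rfl, mSigma, if_pos rfl, mul_comm]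
  · rw [mSigmaStar, if_neg (by norm_num), mSigma, if_neg (by norm_num)]
    have hpos := dKL_pos h𝒯 D
    have hcc := center_sub_center D
    rw [← dKL_eq h𝒯] at hcc
    have hf := 𝒯.face_circumcenter_sub D.K D.i
    have hiso : dist ((𝒯.simplex D.K).points e.1) (𝒯.face D.K D.i).circumcenter
        = dist ((𝒯.simplex D.K).points e.2) (𝒯.face D.K D.i).circumcenter :=
      dist_face_circumcenter (𝒯.simplex D.K) h1 h2
    rw [triArea_isosceles hiso,
      triArea_of_orthogonal (c := (𝒯.face D.K D.i).circumcenter)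
        (t := -(𝒯.height (D.K, D.i) / 𝒯.dKL D)) ?_ ?_]
    · rw [norm_sub_rev]
      change 𝒯.dKL D * _ / 2 * _ = _ * ‖(𝒯.face D.K D.i).circumcenter - _‖ / 2 * _
      ring
    · rw [hcc, smul_smul, ← neg_sub]
      change -((𝒯.face D.K D.i).circumcenter - (𝒯.simplex D.K).circumcenter) = _
      rw [hf, ← neg_smul]
      congr 1
      field_simp
    · rw [hcc, inner_smul_left, outer, inner_neg_left, inner_smul_left, ← bary_sub]
      have e1 : bary (𝒯.simplex D.K) D.i (𝒯.face D.K D.i).circumcenter = 0 :=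
        bary_face_circumcenter _ _
      have e2 : bary (𝒯.simplex D.K) D.i (midpoint ℝ ((𝒯.simplex D.K).points e.1)
          ((𝒯.simplex D.K).points e.2)) = 0 := by
        have : midpoint ℝ ((𝒯.simplex D.K).points e.1) ((𝒯.simplex D.K).points e.2)
            = (𝒯.simplex D.K).points e.1 + (1 / 2 : ℝ) • ((𝒯.simplex D.K).points e.2
              - (𝒯.simplex D.K).points e.1) := by
          rw [midpoint_eq_smul_add, invOf_eq_inv]
          module
        rw [this, bary_lineMap, bary_points, bary_points, if_neg h1.symm, if_neg h2.symm]
        ring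
      simp only
      rw [e1, e2]
      simp

theorem mFace_smul_outer (hd : d = 2 ∨ d = 3) (h𝒯 : 𝒯.IsDDFV) (x : Fin 𝒯.n × Fin (d + 1)) :
    (((d : ℝ) - 1) * 𝒯.mFace x.1 x.2) • 𝒯.outer x =
      -(detAbs (𝒯.simplex x.1) • baryGrad (𝒯.simplex x.1) x.2) := by
  have hn := norm_baryGrad_pos (𝒯.simplex x.1) x.2
  rw [mFace_eq hd h𝒯, outer, smul_neg, smul_smul]
  congr 2
  field_simp

theorem mFace_mul_height (hd : d = 2 ∨ d = 3) (h𝒯 : 𝒯.IsDDFV) (x : Fin 𝒯.n × Fin (d + 1)) :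
    ((d : ℝ) - 1) * 𝒯.mFace x.1 x.2 * 𝒯.height x =
      detAbs (𝒯.simplex x.1) * bary (𝒯.simplex x.1) x.2 (𝒯.simplex x.1).circumcenter := by
  have hn := norm_baryGrad_pos (𝒯.simplex x.1) x.2
  rw [mFace_eq hd h𝒯, height]
  field_simp

/-- The boundary of a control volume is closed. -/
theorem sum_mFace_outNormal (hΩ : IsOpen Ω) (hd : d = 2 ∨ d = 3) (h𝒯 : 𝒯.IsDDFV)
    (K : Fin 𝒯.n) : ∑ D : 𝒯.Interface, 𝒯.mFace D.K D.i • outNormal K D = 0 := by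
  classical
  have h1 : ∀ D : 𝒯.Interface, 𝒯.mFace D.K D.i • outNormal K D =
      (fun x : Fin 𝒯.n × Fin (d + 1) => if x.1 = K then 𝒯.mFace x.1 x.2 • 𝒯.outer x else 0)
        (D.K, D.i) +
      𝒯.secondSide (fun x => if x.1 = K then 𝒯.mFace x.1 x.2 • 𝒯.outer x else 0) D := by
    intro D
    rcases hD : D.L with L | e
    · obtain ⟨j, hj⟩ := Interface.exists_second hD
      rw [secondSide_eq _ hj, outNormal, hD]
      by_cases hK : D.K = K
      · have : L ≠ K := fun h => hj.ne (hK.trans h.symm)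
        simp [hK, this, normal_eq h𝒯]
      · by_cases hL : L = K
        · subst hL
          have h2 := mFace_second hd h𝒯 hj
          simp only at h2
          simp [hK, normal_eq h𝒯, outer_second hj, h2]
        · simp [hK, hL]
    · rw [secondSide_bdry _ hD, outNormal, hD]
      by_cases hK : D.K = K
      · simp [hK, normal_eq h𝒯]
      · simp [hK]
  refine (Finset.sum_congr rfl fun D _ => h1 D).trans ((sum_faces_eq hΩ
    (fun x : Fin 𝒯.n × Fin (d + 1) =>
      if x.1 = K then 𝒯.mFace x.1 x.2 • 𝒯.outer x else 0)).symm.trans ?_)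
  rw [Fintype.sum_prod_type, Finset.sum_eq_single K]
  · simp only [if_true]
    have h2 : ((d : ℝ) - 1) • ∑ i, 𝒯.mFace K i • 𝒯.outer (K, i) = 0 := by
      rw [Finset.smul_sum]
      simp_rw [smul_smul]
      have h3 := fun i => mFace_smul_outer hd h𝒯 (K, i)
      simp only at h3
      simp_rw [h3, Finset.sum_neg_distrib, ← Finset.smul_sum, sum_baryGrad, smul_zero, neg_zero]
    refine (smul_eq_zero.1 h2).resolve_left ?_
    linarith [one_le_sub_one hd]
  · intro L _ hL
    simp [hL]
  · simp

/-- Each control volume is the signed sum of the pyramids whose apex is its centre and whose bases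
are its faces; since the centre may lie outside of the control volume, the signs matter, and only
the sum of the two contributions to a diamond is known to be positive. -/
theorem sum_mFace_mul_dKL (hΩ : IsOpen Ω) (hd : d = 2 ∨ d = 3) (h𝒯 : 𝒯.IsDDFV) :
    ((d : ℝ) - 1) * ∑ D : 𝒯.Interface, 𝒯.mFace D.K D.i * 𝒯.dKL D =
      ∑ K, detAbs (𝒯.simplex K) := by
  have h1 : ∀ D : 𝒯.Interface, 𝒯.mFace D.K D.i * 𝒯.dKL D =
      (fun x : Fin 𝒯.n × Fin (d + 1) => 𝒯.mFace x.1 x.2 * 𝒯.height x) (D.K, D.i) +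
      𝒯.secondSide (fun x => 𝒯.mFace x.1 x.2 * 𝒯.height x) D := by
    intro D
    rw [dKL_eq h𝒯]
    rcases hD : D.L with L | e
    · obtain ⟨j, hj⟩ := Interface.exists_second hD
      rw [secondSide_eq _ hj, secondSide_eq _ hj, mFace_second hd h𝒯 hj]
      ring
    · rw [secondSide_bdry _ hD, secondSide_bdry _ hD]
      simp
  rw [(Finset.sum_congr rfl fun D _ => h1 D).trans ((sum_faces_eq hΩ
    (fun x : Fin 𝒯.n × Fin (d + 1) => 𝒯.mFace x.1 x.2 * 𝒯.height x)).symm),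
    Fintype.sum_prod_type, Finset.mul_sum]
  refine Finset.sum_congr rfl fun K _ => ?_
  rw [Finset.mul_sum]
  have h3 := fun i => mFace_mul_height hd h𝒯 (K, i)
  simp only at h3
  simp_rw [← mul_assoc, h3, ← Finset.mul_sum, sum_bary, mul_one]

open Classical in
/-- The tangential gradient, on a face, of the nodal function of the vertex `v`. -/
def nodalGrad (𝒯 : Triangulation d Ω) (v : 𝒯.Vertex) (x : Fin 𝒯.n × Fin (d + 1)) : Pt d :=
  ∑ a ∈ Finset.univ.erase x.2, if 𝒯.vtx x.1 a = v then faceGrad (𝒯.simplex x.1) x.2 a else 0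

open Classical in
/-- The coefficient of the exterior normal in the local form of the closedness of dual volumes. -/
def nodalCoeff (𝒯 : Triangulation d Ω) (v : 𝒯.Vertex) (x : Fin 𝒯.n × Fin (d + 1)) : ℝ :=
  𝒯.mFace x.1 x.2 * ∑ a ∈ Finset.univ.erase x.2, if 𝒯.vtx x.1 a = v then
    (1 - bary (𝒯.simplex x.1) a (𝒯.face x.1 x.2).circumcenter) else 0

theorem bary_second {K L : Fin 𝒯.n} {i : Fin (d + 1)}
    {σ : Equiv.Perm (Fin (d + 1))}
    (hσ' : ∀ b, b ≠ i → (𝒯.simplex L).points (σ b) = (𝒯.simplex K).points b)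
    {b : Fin (d + 1)} (hb : b ≠ i) {x : Pt d} (hx : bary (𝒯.simplex K) i x = 0) :
    bary (𝒯.simplex L) (σ b) x = bary (𝒯.simplex K) b x := by
  rw [bary_change (𝒯.simplex K) (𝒯.simplex L), Finset.sum_eq_single b]
  · rw [← hσ' b hb, bary_points, if_pos rfl, mul_one]
  · intro c _ hc
    by_cases hci : c = i
    · rw [hci, hx, zero_mul]
    · rw [← hσ' c hci, bary_points, if_neg, mul_zero]
      exact fun h => hc (σ.injective h.symm)
  · simp

theorem sum_face_congr {β : Type*} [AddCommMonoid β] {i j : Fin (d + 1)}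
    {σ : Equiv.Perm (Fin (d + 1))} (hσ : σ i = j) (f : Fin (d + 1) → β) :
    ∑ a ∈ Finset.univ.erase j, f a = ∑ a ∈ Finset.univ.erase i, f (σ a) := by
  refine (Finset.sum_bij (fun a _ => σ a) ?_ ?_ ?_ ?_).symm
  · intro a ha
    simp at ha ⊢
    rw [← hσ]
    exact σ.injective.ne ha
  · intro a _ b _ h; exact σ.injective h
  · intro b hb
    refine ⟨σ.symm b, ?_, by simp⟩
    simp at hb ⊢
    rintro rfl
    exact hb (by rw [← hσ, σ.apply_symm_apply])
  · intros; rfl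

theorem faceGrad_second {D : 𝒯.Interface} {x : Fin 𝒯.n × Fin (d + 1)}
    (h : 𝒯.IsSecondSide D x) {σ : Equiv.Perm (Fin (d + 1))} (hσ : σ D.i = x.2)
    (hσ' : ∀ b, b ≠ D.i → (𝒯.simplex x.1).points (σ b) = (𝒯.simplex D.K).points b)
    {a : Fin (d + 1)} :
    faceGrad (𝒯.simplex x.1) x.2 (σ a) = faceGrad (𝒯.simplex D.K) D.i a := by
  obtain ⟨c, hc⟩ := exists_ne_index D.i
  have hne : ∀ b, b ≠ D.i → σ b ≠ x.2 := fun b hb h => hb (σ.injective (h.trans hσ.symm))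
  refine eq_of_inner_face (𝒯.simplex D.K) hc ?_ (inner_faceGrad_baryGrad _ _ _) ?_
  · have h1 := inner_faceGrad_baryGrad (𝒯.simplex x.1) x.2 (σ a)
    rw [baryGrad_opposite_eq h.2, inner_smul_right] at h1
    exact (mul_eq_zero.1 h1).resolve_left (bary_opposite_ne_zero h.2)
  · intro b hb
    rw [inner_faceGrad_edge _ _ hb hc, ← hσ' b hb, ← hσ' c hc,
      inner_faceGrad_edge _ _ (hne b hb) (hne c hc)]
    simp

theorem nodalGrad_second {D : 𝒯.Interface} {x : Fin 𝒯.n × Fin (d + 1)}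
    (h : 𝒯.IsSecondSide D x) (v : 𝒯.Vertex) : 𝒯.nodalGrad v x = 𝒯.nodalGrad v (D.K, D.i) := by
  classical
  obtain ⟨σ, hσ, hσ'⟩ := exists_perm_of_range_eq h.2
  rw [nodalGrad, nodalGrad, sum_face_congr hσ]
  refine Finset.sum_congr rfl fun a ha => ?_
  have ha' := Finset.ne_of_mem_erase ha
  have h1 : 𝒯.vtx x.1 (σ a) = 𝒯.vtx D.K a := Subtype.ext (hσ' a ha')
  rw [h1, faceGrad_second h hσ hσ']

theorem nodalCoeff_second (hd : d = 2 ∨ d = 3) (h𝒯 : 𝒯.IsDDFV) {D : 𝒯.Interface}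
    {x : Fin 𝒯.n × Fin (d + 1)}
    (h : 𝒯.IsSecondSide D x) (v : 𝒯.Vertex) : 𝒯.nodalCoeff v x = 𝒯.nodalCoeff v (D.K, D.i) := by
  classical
  obtain ⟨σ, hσ, hσ'⟩ := exists_perm_of_range_eq h.2
  rw [nodalCoeff, nodalCoeff, sum_face_congr hσ, mFace_second hd h𝒯 h]
  congr 1
  refine Finset.sum_congr rfl fun a ha => ?_
  have ha' := Finset.ne_of_mem_erase ha
  have h1 : 𝒯.vtx x.1 (σ a) = 𝒯.vtx D.K a := Subtype.ext (hσ' a ha')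
  have h0 : bary (𝒯.simplex D.K) D.i (𝒯.face D.K D.i).circumcenter = 0 :=
    bary_face_circumcenter (𝒯.simplex D.K) D.i
  rw [h1, ← 𝒯.face_circumcenter_eq h.2, bary_second hσ' ha' h0]

/-- The closedness of the dual control volume of an interior vertex, in terms of tangential
gradients: on each control volume these are exchanged for exterior normals with coefficients
`nodalCoeff`, which cancel between neighbours and vanish on the boundary faces. -/
theorem sum_height_nodalGrad (hΩ : IsOpen Ω) (hd : d = 2 ∨ d = 3) (h𝒯 : 𝒯.IsDDFV) {v : 𝒯.Vertex}
    (hv : v.1 ∈ Ω) :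
    ∑ D : 𝒯.Interface, (𝒯.mFace D.K D.i * 𝒯.dKL D) • 𝒯.nodalGrad v (D.K, D.i) = 0 := by
  classical
  have h1 : ∀ D : 𝒯.Interface, (𝒯.mFace D.K D.i * 𝒯.dKL D) • 𝒯.nodalGrad v (D.K, D.i) =
      (fun x : Fin 𝒯.n × Fin (d + 1) => (𝒯.mFace x.1 x.2 * 𝒯.height x) • 𝒯.nodalGrad v x)
        (D.K, D.i) +
      𝒯.secondSide (fun x => (𝒯.mFace x.1 x.2 * 𝒯.height x) • 𝒯.nodalGrad v x) D := by
    intro D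
    rw [dKL_eq h𝒯]
    rcases hD : D.L with L | e
    · obtain ⟨j, hj⟩ := Interface.exists_second hD
      rw [secondSide_eq _ hj, secondSide_eq _ hj, mFace_second hd h𝒯 hj, nodalGrad_second hj,
        mul_add, add_smul]
    · rw [secondSide_bdry _ hD, secondSide_bdry _ hD]
      simp
  refine (Finset.sum_congr rfl fun D _ => h1 D).trans ((sum_faces_eq hΩ
    (fun x : Fin 𝒯.n × Fin (d + 1) =>
      (𝒯.mFace x.1 x.2 * 𝒯.height x) • 𝒯.nodalGrad v x)).symm.trans ?_)
  -- on each control volume, replace tangential gradients by normals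
  have hloc : ∀ K, ((d : ℝ) - 1) • ∑ i, (𝒯.mFace K i * 𝒯.height (K, i)) • 𝒯.nodalGrad v (K, i)
      = ∑ i, (((d : ℝ) - 1) * 𝒯.nodalCoeff v (K, i)) • 𝒯.outer (K, i) := by
    intro K
    have hl : ((d : ℝ) - 1) • ∑ i, (𝒯.mFace K i * 𝒯.height (K, i)) • 𝒯.nodalGrad v (K, i)
        = ∑ a, if 𝒯.vtx K a = v then detAbs (𝒯.simplex K) • ∑ i ∈ Finset.univ.erase a,
          bary (𝒯.simplex K) i (𝒯.simplex K).circumcenter • faceGrad (𝒯.simplex K) i a else 0 := by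
      rw [Finset.smul_sum]
      have h3 := fun i => mFace_mul_height hd h𝒯 (K, i)
      simp only at h3
      simp_rw [smul_smul, ← mul_assoc, h3, nodalGrad, Finset.smul_sum]
      simp_rw [← Finset.filter_ne', Finset.sum_filter]
      rw [Finset.sum_comm]
      refine Finset.sum_congr rfl fun a _ => ?_
      by_cases ha : 𝒯.vtx K a = v
      · simp only [ha, if_true]
        refine Finset.sum_congr rfl fun i _ => ?_
        by_cases hai : a = i
        · simp [hai]
        · simp [hai, Ne.symm hai, smul_smul]
      · simp [ha]
    have hr : ∑ i, (((d : ℝ) - 1) * 𝒯.nodalCoeff v (K, i)) • 𝒯.outer (K, i)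
        = ∑ a, if 𝒯.vtx K a = v then detAbs (𝒯.simplex K) • ∑ i ∈ Finset.univ.erase a,
          (bary (𝒯.simplex K) a ((𝒯.simplex K).faceOpposite i).circumcenter - 1) •
            baryGrad (𝒯.simplex K) i else 0 := by
      have h3 := fun i => mFace_smul_outer hd h𝒯 (K, i)
      simp only at h3
      have h4 : ∀ i, (((d : ℝ) - 1) * 𝒯.nodalCoeff v (K, i)) • 𝒯.outer (K, i) =
          ∑ a ∈ Finset.univ.erase i, if 𝒯.vtx K a = v then detAbs (𝒯.simplex K) •
            ((bary (𝒯.simplex K) a (𝒯.face K i).circumcenter - 1) • baryGrad (𝒯.simplex K) i)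
            else 0 := by
        intro i
        rw [nodalCoeff, ← mul_assoc, mul_comm, mul_smul, h3, Finset.sum_smul]
        refine Finset.sum_congr rfl fun a _ => ?_
        by_cases ha : 𝒯.vtx K a = v
        · simp only [ha, if_true]
          module
        · simp [ha]
      simp_rw [h4, ← Finset.filter_ne', Finset.sum_filter]
      rw [Finset.sum_comm]
      refine Finset.sum_congr rfl fun a _ => ?_
      by_cases ha : 𝒯.vtx K a = v
      · simp only [ha, if_true]
        rw [Finset.smul_sum]
        refine Finset.sum_congr rfl fun i _ => ?_
        by_cases hai : a = i
        · simp [hai]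
        · simp [hai, Ne.symm hai, face]
      · simp [ha]
    rw [hl, hr]
    refine Finset.sum_congr rfl fun a _ => ?_
    rw [sum_faceGrad_mul]
  have h2 : ((d : ℝ) - 1) • ∑ x : Fin 𝒯.n × Fin (d + 1),
      (𝒯.mFace x.1 x.2 * 𝒯.height x) • 𝒯.nodalGrad v x = 0 := by
    rw [Fintype.sum_prod_type, Finset.smul_sum]
    simp_rw [hloc]
    rw [← Fintype.sum_prod_type (f := fun x : Fin 𝒯.n × Fin (d + 1) =>
      (((d : ℝ) - 1) * 𝒯.nodalCoeff v x) • 𝒯.outer x), sum_faces_eq hΩ]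
    refine Finset.sum_eq_zero fun D _ => ?_
    rcases hD : D.L with L | e
    · obtain ⟨j, hj⟩ := Interface.exists_second hD
      rw [secondSide_eq _ hj, nodalCoeff_second hd h𝒯 hj, outer_second hj, smul_neg,
        add_neg_cancel]
    · rw [secondSide_bdry _ hD, add_zero, nodalCoeff, Finset.sum_eq_zero, mul_zero, mul_zero,
        zero_smul]
      intro a ha
      rw [if_neg]
      rintro rfl
      -- an interior vertex does not belong to a boundary face
      have h3 : (𝒯.simplex D.K).points a ∈ (𝒯.face D.K D.i).closedInterior := by
        rw [← Affine.Simplex.convexHull_eq_closedInterior]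
        exact subset_convexHull ℝ _ ((mem_face_range _).2 (Finset.ne_of_mem_erase ha))
      have h4 := Interface.isBdryFace hD h3
      rw [hΩ.frontier_eq] at h4
      exact h4.2 hv
  refine (smul_eq_zero.1 h2).resolve_left ?_
  linarith [one_le_sub_one hd]

/-- The exterior normals to `K^*` on the dual interfaces that cross `D`, weighted by their measures,
reproduce, up to a factor, the tangential gradient of the nodal function of `x_{K^*}`. -/
theorem sum_edges_outDualNormal (hd : d = 2 ∨ d = 3) (h𝒯 : 𝒯.IsDDFV) (v : 𝒯.Vertex)
    (D : 𝒯.Interface) :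
    ((d : ℝ) - 1) • ∑ e ∈ edges D.i, 𝒯.mSigmaStar D e • outDualNormal v D e
      = -((𝒯.mFace D.K D.i * 𝒯.dKL D) • 𝒯.nodalGrad v (D.K, D.i)) := by
  classical
  have h1 : ∀ e ∈ edges D.i, 𝒯.mSigmaStar D e • outDualNormal v D e =
      (if 𝒯.vtx D.K e.1 = v then (𝒯.dKL D * (𝒯.mSigma D.K D.i (e.1, e.2) /
          dist ((𝒯.simplex D.K).points e.1) ((𝒯.simplex D.K).points e.2) ^ 2)) •
          ((𝒯.simplex D.K).points e.2 - (𝒯.simplex D.K).points e.1) else 0) +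
      (if 𝒯.vtx D.K e.2 = v then (𝒯.dKL D * (𝒯.mSigma D.K D.i (e.2, e.1) /
          dist ((𝒯.simplex D.K).points e.2) ((𝒯.simplex D.K).points e.1) ^ 2)) •
          ((𝒯.simplex D.K).points e.1 - (𝒯.simplex D.K).points e.2) else 0) := by
    intro e he
    have hlt := (mem_edges.1 he).1
    have hG := mSigmaStar_mul hd h𝒯 D he
    have hpos := dist_points_pos (𝒯 := 𝒯) D.K hlt.ne
    have hnv : 𝒯.vtx D.K e.1 ≠ 𝒯.vtx D.K e.2 := fun h =>
      hlt.ne ((𝒯.simplex D.K).independent.injective (congrArg Subtype.val h))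
    have hs : 𝒯.mSigmaStar D e • 𝒯.dualNormal (𝒯.vtx D.K e.1) (𝒯.vtx D.K e.2) =
        (𝒯.dKL D * (𝒯.mSigma D.K D.i e /
          dist ((𝒯.simplex D.K).points e.1) ((𝒯.simplex D.K).points e.2) ^ 2)) •
          ((𝒯.simplex D.K).points e.2 - (𝒯.simplex D.K).points e.1) := by
      rw [dualNormal, smul_smul]
      congr 1
      change 𝒯.mSigmaStar D e * (dist ((𝒯.simplex D.K).points e.1) ((𝒯.simplex D.K).points e.2))⁻¹
        = _
      field_simp
      linear_combination hG
    unfold outDualNormal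
    by_cases h1 : 𝒯.vtx D.K e.1 = v
    · have h2 : 𝒯.vtx D.K e.2 ≠ v := fun h => hnv (h1.trans h.symm)
      rw [if_pos h1, if_pos h1, if_neg h2, add_zero, hs]
    · rw [if_neg h1, if_neg h1, zero_add]
      by_cases h2 : 𝒯.vtx D.K e.2 = v
      · rw [if_pos h2, if_pos h2, smul_neg, hs, ← smul_neg, neg_sub, dist_comm, 𝒯.mSigma_comm]
      · rw [if_neg h2, if_neg h2, smul_zero]
  rw [Finset.sum_congr rfl h1]
  rw [sum_edges_add_swap D.i fun a b => if 𝒯.vtx D.K a = v then (𝒯.dKL D * (𝒯.mSigma D.K D.i (a, b) /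
          dist ((𝒯.simplex D.K).points a) ((𝒯.simplex D.K).points b) ^ 2)) •
          ((𝒯.simplex D.K).points b - (𝒯.simplex D.K).points a) else 0]
  rw [nodalGrad, Finset.smul_sum, Finset.smul_sum, ← Finset.sum_neg_distrib]
  refine Finset.sum_congr rfl fun a ha => ?_
  by_cases hv : 𝒯.vtx D.K a = v
  · simp only [hv, if_true]
    have h2 := starVec_eq hd h𝒯 D.K (Finset.ne_of_mem_erase ha)
    simp_rw [mul_smul]
    rw [← Finset.smul_sum]
    change ((d : ℝ) - 1) • 𝒯.dKL D • 𝒯.starVec D.K D.i a = _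
    rw [smul_comm, h2]
    module
  · simp [hv]

/-- The boundary of the dual control volume of an interior vertex is closed. -/
theorem sum_mSigmaStar_outDualNormal (hΩ : IsOpen Ω) (hd : d = 2 ∨ d = 3) (h𝒯 : 𝒯.IsDDFV)
    {v : 𝒯.Vertex} (hv : v.1 ∈ Ω) :
    ∑ D : 𝒯.Interface, ∑ e ∈ edges D.i, 𝒯.mSigmaStar D e • outDualNormal v D e = 0 := by
  have h2 : ((d : ℝ) - 1) • ∑ D : 𝒯.Interface, ∑ e ∈ edges D.i,
      𝒯.mSigmaStar D e • outDualNormal v D e = 0 := by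
    rw [Finset.smul_sum]
    simp_rw [sum_edges_outDualNormal hd h𝒯]
    rw [Finset.sum_neg_distrib, sum_height_nodalGrad hΩ hd h𝒯 hv, neg_zero]
  refine (smul_eq_zero.1 h2).resolve_left ?_
  linarith [one_le_sub_one hd]

end Triangulation

/-! ### Intrinsic distance and dual control volumes -/

section Geodesic

variable {d : ℕ} {Ω : Set (Pt d)}

theorem eVariationOn_trans_le {x y z : Pt d} (γ : Path x y) (γ' : Path y z) :
    eVariationOn (γ.trans γ') univ ≤ eVariationOn γ univ + eVariationOn γ' univ := by
  set h : unitInterval := ⟨1 / 2, by norm_num, by norm_num⟩ with hh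
  have hu : (univ : Set unitInterval) = Iic h ∪ Ici h := Set.Iic_union_Ici.symm
  rw [hu, eVariationOn.union _ (isGreatest_Iic) (isLeast_Ici)]
  refine add_le_add ?_ ?_
  · have h1 : EqOn (γ.trans γ') (γ ∘ fun t : unitInterval => Set.projIcc 0 1 zero_le_one (2 * (t : ℝ)))
        (Iic h) := by
      intro t ht
      have ht' : (t : ℝ) ≤ 1 / 2 := ht
      simp only [Path.trans_apply, ht', dif_pos, Function.comp]
      congr 1
      rw [Set.projIcc_of_mem]
    rw [eVariationOn.congr h1]
    refine (eVariationOn.comp_le_of_monotoneOn _ (t := Iic h) _ ?_ (mapsTo_univ _ _)).trans ?_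
    · intro a _ b _ hab
      exact Set.monotone_projIcc _ (by have : (a : ℝ) ≤ b := hab; linarith)
    · rw [← hu]
  · have h1 : EqOn (γ.trans γ')
        (γ' ∘ fun t : unitInterval => Set.projIcc 0 1 zero_le_one (2 * (t : ℝ) - 1)) (Ici h) := by
      intro t ht
      have ht' : 1 / 2 ≤ (t : ℝ) := ht
      simp only [Path.trans_apply, Function.comp]
      split_ifs with h2
      · have h3 : (t : ℝ) = 1 / 2 := le_antisymm h2 ht'
        simp [h3]
      · congr 1
        rw [Set.projIcc_of_mem]
    rw [eVariationOn.congr h1]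
    refine (eVariationOn.comp_le_of_monotoneOn _ (t := Ici h) _ ?_ (mapsTo_univ _ _)).trans ?_
    · intro a _ b _ hab
      exact Set.monotone_projIcc _ (by have : (a : ℝ) ≤ b := hab; linarith)
    · rw [← hu]

theorem eVariationOn_segment_le (x y : Pt d) : eVariationOn (Path.segment x y) univ ≤ edist x y := by
  have hL : LipschitzOnWith (nndist x y) (AffineMap.lineMap x y : ℝ → Pt d) univ :=
    (lipschitzWith_lineMap x y).lipschitzOnWith
  have h1 := hL.comp_eVariationOn_le (g := ((↑) : unitInterval → ℝ)) (s := univ) (mapsTo_univ _ _)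
  have h2 : eVariationOn ((↑) : unitInterval → ℝ) univ ≤ 1 := by
    have h3 := MonotoneOn.eVariationOn_eq (f := ((↑) : unitInterval → ℝ)) (s := univ)
      (fun a _ b _ h => h) (mem_univ 0) (mem_univ 1)
    rw [univ_inter] at h3
    have h4 : Icc (0 : unitInterval) 1 = univ := Set.Icc_bot_top
    rw [h4] at h3
    simpa using h3.le
  calc eVariationOn (Path.segment x y) univ ≤ _ := h1
    _ ≤ (nndist x y : ℝ≥0∞) * 1 := by gcongr
    _ = edist x y := by rw [mul_one, edist_nndist]

theorem geodDist_le_add {x y z : Pt d} (h : segment ℝ x y ⊆ closure Ω) :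
    geodDist Ω x z ≤ edist x y + geodDist Ω y z := by
  have h0 : geodDist Ω y z = ⨅ γ : {γ : Path y z // Set.range γ ⊆ closure Ω},
      eVariationOn γ.1 univ := iInf_subtype'
  rw [h0, ENNReal.add_iInf]
  refine le_iInf fun γ => ?_
  refine (iInf₂_le ((Path.segment x y).trans γ.1) ?_).trans
    ((eVariationOn_trans_le _ _).trans (by gcongr; exact eVariationOn_segment_le x y))
  rw [Path.trans_range, Path.range_segment]
  exact union_subset h γ.2

theorem edist_le_geodDist (x y : Pt d) : edist x y ≤ geodDist Ω x y := by
  refine le_iInf₂ fun γ _ => ?_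
  have := eVariationOn.edist_le (γ : unitInterval → Pt d) (mem_univ 0) (mem_univ 1)
  simpa using this

theorem geodDist_self {x : Pt d} (hx : x ∈ closure Ω) : geodDist Ω x x = 0 := by
  refine le_antisymm ?_ bot_le
  refine (iInf₂_le (Path.refl x) ?_).trans ?_
  · simpa using hx
  · exact (eVariationOn.constant_on (by simp [Set.Subsingleton])).le

end Geodesic

namespace Triangulation

variable {d : ℕ} [NeZero d] {Ω : Set (Pt d)} (𝒯 : Triangulation d Ω)

theorem isOpen_dualCell (hΩ : IsOpen Ω) (v : 𝒯.Vertex) : IsOpen (𝒯.dualCell v) := by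
  rw [isOpen_iff_mem_nhds]
  rintro x ⟨hx, hxv⟩
  have key : ∀ w : 𝒯.Vertex, ∀ᶠ y in nhds x, w ≠ v → geodDist Ω y v.1 < geodDist Ω y w.1 := by
    intro w
    by_cases hw : w = v
    · simp [hw]
    -- the intrinsic distance is locally nonexpansive: the inequality survives in a small ball
    obtain ⟨r, hr, hlt⟩ := ENNReal.lt_iff_exists_add_pos_lt.1 (hxv w hw)
    obtain ⟨ε, hε, hball⟩ := Metric.isOpen_iff.1 hΩ x hx
    have hmem : Metric.ball x ε ∩ Metric.eball x (r / 2) ∈ nhds x :=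
      Filter.inter_mem (Metric.ball_mem_nhds x hε)
        (Metric.eball_mem_nhds x (by simpa using hr.ne'))
    filter_upwards [hmem] with y hy _
    have hseg : segment ℝ x y ⊆ closure Ω :=
      ((convex_ball x ε).segment_subset (Metric.mem_ball_self hε) hy.1).trans
        (hball.trans subset_closure)
    have hseg' : segment ℝ y x ⊆ closure Ω := by rwa [segment_symm]
    have h1 := geodDist_le_add (z := w.1) hseg
    have h2 := geodDist_le_add (z := v.1) hseg'
    have h3 : edist y x < r / 2 := hy.2
    by_contra hcon
    rw [not_lt] at hcon
    have h4 : geodDist Ω x w.1 ≤ geodDist Ω x v.1 + r := by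
      calc geodDist Ω x w.1 ≤ edist x y + geodDist Ω y w.1 := h1
        _ ≤ edist y x + (edist y x + geodDist Ω x v.1) := by
            rw [edist_comm x y]; gcongr; exact hcon.trans h2
        _ ≤ (r : ℝ≥0∞) / 2 + ((r : ℝ≥0∞) / 2 + geodDist Ω x v.1) := by gcongr
        _ = geodDist Ω x v.1 + r := by rw [← add_assoc, ENNReal.add_halves, add_comm]
    exact absurd hlt (not_lt.2 h4)
  have hall := Filter.eventually_all.2 key
  filter_upwards [hall, hΩ.mem_nhds hx] with y hy hyΩ
  exact ⟨hyΩ, fun w hw => hy w hw⟩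

theorem measurableSet_dualCell (hΩ : IsOpen Ω) (v : 𝒯.Vertex) : MeasurableSet (𝒯.dualCell v) :=
  (𝒯.isOpen_dualCell hΩ v).measurableSet

theorem dualCell_subset (v : 𝒯.Vertex) : 𝒯.dualCell v ⊆ Ω := fun _ hx => hx.1

theorem disjoint_dualCell {v w : 𝒯.Vertex} (h : v ≠ w) :
    Disjoint (𝒯.dualCell v) (𝒯.dualCell w) := by
  rw [Set.disjoint_left]
  intro x hx hx'
  exact lt_asymm (hx.2 w h.symm) (hx'.2 v h)

theorem vertex_mem_closure (v : 𝒯.Vertex) : v.1 ∈ closure Ω := by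
  obtain ⟨_, ⟨⟨K, j⟩, rfl⟩⟩ := v
  exact 𝒯.closedInterior_subset_closure K ((𝒯.simplex K).point_mem_closedInterior j)

theorem vertex_mem_frontier (hΩ : IsOpen Ω) {v : 𝒯.Vertex} (h : v.1 ∉ Ω) : v.1 ∈ frontier Ω := by
  rw [hΩ.frontier_eq]
  exact ⟨𝒯.vertex_mem_closure v, h⟩

theorem mem_dualCell_self {v : 𝒯.Vertex} (hv : v.1 ∈ Ω) : v.1 ∈ 𝒯.dualCell v := by
  refine ⟨hv, fun w hw => ?_⟩
  rw [geodDist_self (subset_closure hv)]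
  refine lt_of_lt_of_le ?_ (edist_le_geodDist _ _)
  rw [edist_pos]
  exact fun h => hw (Subtype.ext h.symm)

theorem volume_lt_top_of_subset (hΩb : Bornology.IsBounded Ω) {B : Set (Pt d)} (hB : B ⊆ Ω) :
    volume B < ∞ := (hΩb.subset hB).measure_lt_top

theorem mDual_pos (hΩ : IsOpen Ω) (hΩb : Bornology.IsBounded Ω) {v : 𝒯.Vertex} (hv : v.1 ∈ Ω) :
    0 < 𝒯.mDual v := by
  rw [mDual, measureReal_def, ENNReal.toReal_pos_iff]
  exact ⟨(𝒯.isOpen_dualCell hΩ v).measure_pos _ ⟨_, 𝒯.mem_dualCell_self hv⟩,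
    volume_lt_top_of_subset hΩb (𝒯.dualCell_subset v)⟩

theorem mCell_pos (K : Fin 𝒯.n) : 0 < 𝒯.mCell K := volume_interior_pos _

theorem sum_measureReal_le {ι : Type*} (s : Finset ι) (B : ι → Set (Pt d))
    (hΩb : Bornology.IsBounded Ω) (hB : ∀ i, B i ⊆ Ω) (hm : ∀ i, MeasurableSet (B i))
    (hd : ∀ i j, i ≠ j → Disjoint (B i) (B j)) :
    ∑ i ∈ s, volume.real (B i) ≤ volume.real Ω := by
  have hfin : ∀ i ∈ s, volume (B i) ≠ ∞ := fun i _ => (volume_lt_top_of_subset hΩb (hB i)).ne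
  rw [← measureReal_biUnion_finset (fun i _ j _ hij => hd i j hij) (fun i _ => hm i) hfin]
  exact measureReal_mono (iUnion₂_subset fun i _ => hB i)
    (volume_lt_top_of_subset hΩb subset_rfl).ne

theorem sum_mCell_le (hΩb : Bornology.IsBounded Ω) : ∑ K, 𝒯.mCell K ≤ volume.real Ω :=
  sum_measureReal_le _ _ hΩb 𝒯.interior_subset (fun _ => measurableSet_interior _) 𝒯.disjoint

theorem sum_mDual_le (hΩ : IsOpen Ω) (hΩb : Bornology.IsBounded Ω) (s : Finset 𝒯.Vertex) :
    ∑ v ∈ s, 𝒯.mDual v ≤ volume.real Ω :=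
  sum_measureReal_le _ _ hΩb 𝒯.dualCell_subset (𝒯.measurableSet_dualCell hΩ)
    fun _ _ => 𝒯.disjoint_dualCell

theorem sum_mDiamond_le (hΩ : IsOpen Ω) (hΩb : Bornology.IsBounded Ω) (hd : d = 2 ∨ d = 3)
    (h𝒯 : 𝒯.IsDDFV) :
    ∑ D : 𝒯.Interface, 𝒯.mDiamond D ≤ volume.real Ω / volume.real (stdCorner d) := by
  have h1 := sum_mFace_mul_dKL hΩ hd h𝒯
  have h2 := one_le_sub_one hd
  have h3 : ∀ D : 𝒯.Interface, 𝒯.mDiamond D = (d : ℝ)⁻¹ * (𝒯.mFace D.K D.i * 𝒯.dKL D) := by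
    intro D
    rw [mDiamond, mFace, Finset.sum_mul, Finset.mul_sum]
    refine Finset.sum_congr rfl fun e _ => ?_
    rw [mSub]; ring
  simp_rw [h3]
  rw [← Finset.mul_sum]
  have h4 : 0 ≤ ∑ D : 𝒯.Interface, 𝒯.mFace D.K D.i * 𝒯.dKL D :=
    Finset.sum_nonneg fun D _ => mul_nonneg (𝒯.mFace_nonneg _ _) (dKL_pos h𝒯 D).le
  have h5 : ∑ D : 𝒯.Interface, 𝒯.mFace D.K D.i * 𝒯.dKL D ≤ ∑ K, detAbs (𝒯.simplex K) := by
    rw [← h1]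
    nlinarith
  have h6 : ∑ K, detAbs (𝒯.simplex K) ≤ volume.real Ω / volume.real (stdCorner d) := by
    unfold detAbs
    rw [← Finset.sum_div]
    exact div_le_div_of_nonneg_right (𝒯.sum_mCell_le hΩb) measureReal_nonneg
  have h7 : (d : ℝ)⁻¹ ≤ 1 := inv_le_one_of_one_le₀ (by linarith)
  calc _ ≤ 1 * ∑ D : 𝒯.Interface, 𝒯.mFace D.K D.i * 𝒯.dKL D := by gcongr
    _ ≤ _ := by rw [one_mul]; exact h5.trans h6

/-! ### Components of the discrete gradient -/

variable {𝒯}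

theorem mDiamond_eq (D : 𝒯.Interface) :
    𝒯.mDiamond D = 𝒯.mFace D.K D.i * 𝒯.dKL D / d := by
  rw [mDiamond, mFace, Finset.sum_mul, Finset.sum_div]
  rfl

theorem mDiamond_pos (hd : d = 2 ∨ d = 3) (h𝒯 : 𝒯.IsDDFV) (D : 𝒯.Interface) :
    0 < 𝒯.mDiamond D := by
  rw [mDiamond_eq]
  have := one_le_sub_one hd
  exact div_pos (mul_pos (mFace_pos hd h𝒯 _ _) (dKL_pos h𝒯 D)) (by linarith)

/-- The part of the discrete gradient built on the dual values is the tangential gradient of their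
affine interpolation on the face. -/
theorem grad_eq (hd : d = 2 ∨ d = 3) (h𝒯 : 𝒯.IsDDFV) (w : 𝒯.DFun) (D : 𝒯.Interface) :
    grad w D = ((w.primal D.L - w.primal (Sum.inl D.K)) / 𝒯.dKL D) • 𝒯.normal D +
      ∑ a ∈ Finset.univ.erase D.i, w.dual (𝒯.vtx D.K a) • faceGrad (𝒯.simplex D.K) D.i a := by
  rw [grad]
  congr 1
  have hm := mFace_pos hd h𝒯 D.K D.i
  have hk := dKL_pos h𝒯 D
  have hd1 := one_le_sub_one hd
  have hd0 : (d : ℝ) ≠ 0 := by linarith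
  have h1 : ∀ e ∈ edges D.i, (𝒯.mSub D e * ((w.dual (𝒯.vtx D.K e.2) - w.dual (𝒯.vtx D.K e.1)) /
        𝒯.dualDist (𝒯.vtx D.K e.1) (𝒯.vtx D.K e.2))) •
          𝒯.dualNormal (𝒯.vtx D.K e.1) (𝒯.vtx D.K e.2) =
      (-(𝒯.dKL D / d)) • ((w.dual (𝒯.vtx D.K e.1) * (𝒯.mSigma D.K D.i (e.1, e.2) /
          dist ((𝒯.simplex D.K).points e.1) ((𝒯.simplex D.K).points e.2) ^ 2)) •
          ((𝒯.simplex D.K).points e.2 - (𝒯.simplex D.K).points e.1) +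
        (w.dual (𝒯.vtx D.K e.2) * (𝒯.mSigma D.K D.i (e.2, e.1) /
          dist ((𝒯.simplex D.K).points e.2) ((𝒯.simplex D.K).points e.1) ^ 2)) •
          ((𝒯.simplex D.K).points e.1 - (𝒯.simplex D.K).points e.2)) := by
    intro e he
    have hpos := dist_points_pos (𝒯 := 𝒯) D.K (mem_edges.1 he).1.ne
    rw [dualNormal, smul_smul, mSub, 𝒯.mSigma_comm D.K D.i e.2 e.1,
      dist_comm ((𝒯.simplex D.K).points e.2), ← neg_sub ((𝒯.simplex D.K).points e.2), smul_neg,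
      ← neg_smul, ← add_smul, smul_smul]
    congr 1
    change 𝒯.mSigma D.K D.i e * 𝒯.dKL D / d * (_ /
      dist ((𝒯.simplex D.K).points e.1) ((𝒯.simplex D.K).points e.2)) *
      (dist ((𝒯.simplex D.K).points e.1) ((𝒯.simplex D.K).points e.2))⁻¹ = _
    field_simp
    ring
  rw [Finset.sum_congr rfl h1, ← Finset.smul_sum]
  rw [sum_edges_add_swap D.i fun a b => (w.dual (𝒯.vtx D.K a) * (𝒯.mSigma D.K D.i (a, b) /
          dist ((𝒯.simplex D.K).points a) ((𝒯.simplex D.K).points b) ^ 2)) •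
          ((𝒯.simplex D.K).points b - (𝒯.simplex D.K).points a)]
  rw [smul_smul, Finset.smul_sum]
  refine Finset.sum_congr rfl fun a ha => ?_
  have h2 := starVec_eq hd h𝒯 D.K (Finset.ne_of_mem_erase ha)
  simp_rw [mul_smul]
  rw [← Finset.smul_sum]
  change (((d : ℝ) - 1) / 𝒯.mDiamond D) • (-(𝒯.dKL D / d)) • w.dual (𝒯.vtx D.K a) •
    𝒯.starVec D.K D.i a = _
  rw [mDiamond_eq]
  have h3 : (((d : ℝ) - 1) / (𝒯.mFace D.K D.i * 𝒯.dKL D / d)) • (-(𝒯.dKL D / d)) •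
      w.dual (𝒯.vtx D.K a) • 𝒯.starVec D.K D.i a =
      (-(w.dual (𝒯.vtx D.K a) / 𝒯.mFace D.K D.i)) • ((d : ℝ) - 1) • 𝒯.starVec D.K D.i a := by
    rw [smul_smul, smul_smul, smul_smul]
    congr 1
    field_simp
  rw [h3, h2, smul_smul]
  congr 1
  field_simp

theorem inner_grad_normal (hd : d = 2 ∨ d = 3) (h𝒯 : 𝒯.IsDDFV) (w : 𝒯.DFun) (D : 𝒯.Interface) :
    inner ℝ (grad w D) (𝒯.normal D) =
      (w.primal D.L - w.primal (Sum.inl D.K)) / 𝒯.dKL D := by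
  rw [grad_eq hd h𝒯, inner_add_left, inner_smul_left, real_inner_self_eq_norm_sq, norm_normal h𝒯,
    sum_inner, Finset.sum_eq_zero]
  · simp
  · intro a _
    rw [inner_smul_left, normal_eq h𝒯, outer, inner_neg_right, inner_smul_right,
      inner_faceGrad_baryGrad]
    simp

theorem inner_normal_dualNormal (h𝒯 : 𝒯.IsDDFV) (D : 𝒯.Interface)
    {e : Fin (d + 1) × Fin (d + 1)} (he : e ∈ edges D.i) :
    inner ℝ (𝒯.normal D) (𝒯.dualNormal (𝒯.vtx D.K e.1) (𝒯.vtx D.K e.2)) = 0 := by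
  obtain ⟨-, h1, h2⟩ := mem_edges.1 he
  rw [normal_eq h𝒯, dualNormal, inner_smul_right]
  have := inner_outer_edge (𝒯 := 𝒯) D.K h2 h1
  change _ * inner ℝ (𝒯.outer (D.K, D.i)) ((𝒯.simplex D.K).points e.2 -
    (𝒯.simplex D.K).points e.1) = 0
  rw [this, mul_zero]

theorem dualDist_pos (D : 𝒯.Interface) {e : Fin (d + 1) × Fin (d + 1)} (he : e ∈ edges D.i) :
    0 < 𝒯.dualDist (𝒯.vtx D.K e.1) (𝒯.vtx D.K e.2) :=
  dist_points_pos (𝒯 := 𝒯) D.K (mem_edges.1 he).1.ne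

theorem inner_grad_dualNormal (hd : d = 2 ∨ d = 3) (h𝒯 : 𝒯.IsDDFV) (w : 𝒯.DFun)
    (D : 𝒯.Interface) {e : Fin (d + 1) × Fin (d + 1)} (he : e ∈ edges D.i) :
    inner ℝ (grad w D) (𝒯.dualNormal (𝒯.vtx D.K e.1) (𝒯.vtx D.K e.2)) =
      (w.dual (𝒯.vtx D.K e.2) - w.dual (𝒯.vtx D.K e.1)) /
        𝒯.dualDist (𝒯.vtx D.K e.1) (𝒯.vtx D.K e.2) := by
  obtain ⟨-, h1, h2⟩ := mem_edges.1 he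
  rw [grad_eq hd h𝒯, inner_add_left, inner_smul_left, inner_normal_dualNormal h𝒯 D he, mul_zero,
    zero_add, sum_inner, dualNormal]
  have h3 : ∀ a ∈ Finset.univ.erase D.i, inner ℝ (w.dual (𝒯.vtx D.K a) •
      faceGrad (𝒯.simplex D.K) D.i a) ((𝒯.dualDist (𝒯.vtx D.K e.1) (𝒯.vtx D.K e.2))⁻¹ •
        ((𝒯.vtx D.K e.2).1 - (𝒯.vtx D.K e.1).1)) =
      (𝒯.dualDist (𝒯.vtx D.K e.1) (𝒯.vtx D.K e.2))⁻¹ * ((if a = e.2 then w.dual (𝒯.vtx D.K a) else 0)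
        - (if a = e.1 then w.dual (𝒯.vtx D.K a) else 0)) := by
    intro a _
    rw [inner_smul_left, inner_smul_right]
    change _ * (_ * inner ℝ (faceGrad (𝒯.simplex D.K) D.i a) ((𝒯.simplex D.K).points e.2 -
      (𝒯.simplex D.K).points e.1)) = _
    rw [inner_faceGrad_edge _ _ h2 h1]
    simp only [conj_trivial]
    split_ifs <;> ring
  rw [Finset.sum_congr rfl h3, ← Finset.mul_sum, Finset.sum_sub_distrib, Finset.sum_ite_eq',
    Finset.sum_ite_eq', if_pos (by simp [h2]), if_pos (by simp [h1]), div_eq_inv_mul]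

theorem norm_dualNormal (D : 𝒯.Interface) {e : Fin (d + 1) × Fin (d + 1)} (he : e ∈ edges D.i) :
    ‖𝒯.dualNormal (𝒯.vtx D.K e.1) (𝒯.vtx D.K e.2)‖ = 1 := by
  have := dualDist_pos D he
  rw [dualNormal, norm_smul, norm_inv, Real.norm_of_nonneg this.le, ← dist_eq_norm, dist_comm]
  exact inv_mul_cancel₀ this.ne'

end Triangulation

/-! ### Summation by parts -/

namespace Triangulation

variable {d : ℕ} [NeZero d] {Ω : Set (Pt d)} {𝒯 : Triangulation d Ω}

/-- Discrete functions that vanish on the boundary control volumes, primal and dual. -/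
structure VanishesOnBdry (φ : 𝒯.DFun) : Prop where
  primal : ∀ e, φ.primal (Sum.inr e) = 0
  dual : ∀ v : 𝒯.Vertex, v.1 ∉ Ω → φ.dual v = 0

open Classical in
/-- Sum over the two sides of an interface. -/
theorem sum_sides {β : Type*} [AddCommMonoid β] (D : 𝒯.Interface) (α : Fin 𝒯.n → β)
    (γ : 𝒯.CellBar → β)
    (hγ : ∀ e, γ (Sum.inr e) = 0) :
    ∑ K, (if D.K = K then α K else if D.L = Sum.inl K then γ (Sum.inl K) else 0)
      = α D.K + γ D.L := by
  have h1 : ∀ K, (if D.K = K then α K else if D.L = Sum.inl K then γ (Sum.inl K) else 0)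
      = (if D.K = K then α K else 0) + (if D.L = Sum.inl K then γ (Sum.inl K) else 0) := by
    intro K
    by_cases h : D.K = K
    · have : D.L ≠ Sum.inl K := fun h' => Interface.ne h' h
      simp [h, this]
    · simp [h]
  simp_rw [h1, Finset.sum_add_distrib]
  congr 1
  · simp
  · rcases hD : D.L with L | e
    · simp
    · simp [hγ]

open Classical in
/-- Sum over the two end points of an edge. -/
theorem sum_ends {β : Type*} [AddCommMonoid β] {v w : 𝒯.Vertex} (hvw : v ≠ w)
    (α γ : 𝒯.Vertex → β) :
    ∑ z, (if v = z then α z else if w = z then γ z else 0) = α v + γ w := by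
  have h1 : ∀ z, (if v = z then α z else if w = z then γ z else 0)
      = (if v = z then α z else 0) + (if w = z then γ z else 0) := by
    intro z
    by_cases h : v = z
    · have : w ≠ z := fun h' => hvw (h.trans h'.symm)
      simp [h, this]
    · simp [h]
  simp_rw [h1, Finset.sum_add_distrib]
  simp

theorem vtx_ne {K : Fin 𝒯.n} {a b : Fin (d + 1)} (h : a ≠ b) : 𝒯.vtx K a ≠ 𝒯.vtx K b :=
  fun h' => h ((𝒯.simplex K).independent.injective (congrArg Subtype.val h'))

theorem vtx_ne_of_mem_edges {D : 𝒯.Interface} {e : Fin (d + 1) × Fin (d + 1)}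
    (he : e ∈ edges D.i) : 𝒯.vtx D.K e.1 ≠ 𝒯.vtx D.K e.2 :=
  vtx_ne (mem_edges.1 he).1.ne

theorem mDualFace_comm (v w : 𝒯.Vertex) : 𝒯.mDualFace v w = 𝒯.mDualFace w v := by
  unfold mDualFace
  refine Finset.sum_congr rfl fun D _ => Finset.sum_congr rfl fun e _ => ?_
  congr 1
  rw [or_comm]

theorem mSigmaStar_nonneg (D : 𝒯.Interface) (e : Fin (d + 1) × Fin (d + 1)) :
    0 ≤ 𝒯.mSigmaStar D e := by
  unfold mSigmaStar
  split_ifs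
  · exact dist_nonneg
  · exact triArea_nonneg _ _ _

theorem mDualFace_nonneg (v w : 𝒯.Vertex) : 0 ≤ 𝒯.mDualFace v w := by
  unfold mDualFace
  refine Finset.sum_nonneg fun D _ => Finset.sum_nonneg fun e _ => ?_
  split_ifs
  · exact mSigmaStar_nonneg _ _
  · exact le_rfl

theorem DualNbr.symm {v w : 𝒯.Vertex} (h : 𝒯.DualNbr v w) : 𝒯.DualNbr w v := by
  obtain ⟨h1, K, j, k, hj, hk⟩ := h
  exact ⟨h1.symm, K, k, j, hk, hj⟩

theorem dualNormal_comm (v w : 𝒯.Vertex) : 𝒯.dualNormal v w = - 𝒯.dualNormal w v := by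
  rw [dualNormal, dualNormal, dualDist, dualDist, dist_comm, ← smul_neg, neg_sub]

open Classical in
/-- Sums over the dual interfaces of a dual control volume, written over subdiamonds. -/
theorem sum_mDualFace {β : Type*} [AddCommGroup β] [Module ℝ β] (v : 𝒯.Vertex)
    (Y : 𝒯.Vertex → β) :
    ∑ w ∈ Finset.univ.filter (fun w => 𝒯.DualNbr v w), 𝒯.mDualFace v w • Y w =
      ∑ D : 𝒯.Interface, ∑ e ∈ edges D.i, 𝒯.mSigmaStar D e •
        (if 𝒯.vtx D.K e.1 = v then Y (𝒯.vtx D.K e.2)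
          else if 𝒯.vtx D.K e.2 = v then Y (𝒯.vtx D.K e.1) else 0) := by
  unfold mDualFace
  simp_rw [Finset.sum_smul]
  rw [Finset.sum_comm]
  refine Finset.sum_congr rfl fun D _ => ?_
  rw [Finset.sum_comm]
  refine Finset.sum_congr rfl fun e he => ?_
  have hne := vtx_ne_of_mem_edges he
  have hnbr : 𝒯.DualNbr (𝒯.vtx D.K e.1) (𝒯.vtx D.K e.2) := ⟨hne, D.K, e.1, e.2, rfl, rfl⟩
  by_cases h1 : 𝒯.vtx D.K e.1 = v
  · have h2 : 𝒯.vtx D.K e.2 ≠ v := fun h => hne (h1.trans h.symm)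
    rw [if_pos h1, Finset.sum_eq_single (𝒯.vtx D.K e.2)]
    · simp [h1]
    · intro w _ hw
      rw [if_neg, zero_smul]
      rintro (h | h)
      · exact hw h.2.symm
      · exact h2 h.2
    · intro h
      rw [h1] at hnbr
      simp [hnbr] at h
  · rw [if_neg h1]
    by_cases h2 : 𝒯.vtx D.K e.2 = v
    · rw [if_pos h2, Finset.sum_eq_single (𝒯.vtx D.K e.1)]
      · simp [h2]
      · intro w _ hw
        rw [if_neg, zero_smul]
        rintro (h | h)
        · exact h1 h.1
        · exact hw h.1.symm
      · intro h
        rw [h2] at hnbr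
        simp [hnbr.symm] at h
    · rw [if_neg h2, smul_zero]
      refine Finset.sum_eq_zero fun w _ => ?_
      rw [if_neg, zero_smul]
      rintro (h | h)
      · exact h1 h.1
      · exact h2 h.2

open Classical in
theorem sum_sum_mDualFace {β : Type*} [AddCommGroup β] [Module ℝ β]
    (Y : 𝒯.Vertex → 𝒯.Vertex → β) :
    ∑ v, ∑ w ∈ Finset.univ.filter (fun w => 𝒯.DualNbr v w), 𝒯.mDualFace v w • Y v w =
      ∑ D : 𝒯.Interface, ∑ e ∈ edges D.i, 𝒯.mSigmaStar D e •
        (Y (𝒯.vtx D.K e.1) (𝒯.vtx D.K e.2) + Y (𝒯.vtx D.K e.2) (𝒯.vtx D.K e.1)) := by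
  simp_rw [sum_mDualFace]
  rw [Finset.sum_comm]
  refine Finset.sum_congr rfl fun D _ => ?_
  rw [Finset.sum_comm]
  refine Finset.sum_congr rfl fun e he => ?_
  rw [← Finset.smul_sum]
  rw [sum_ends (vtx_ne_of_mem_edges he) (fun v => Y v (𝒯.vtx D.K e.2))
    (fun v => Y v (𝒯.vtx D.K e.1))]

open Classical in
theorem sum_mDualFace_dualNormal (hΩ : IsOpen Ω) (hd : d = 2 ∨ d = 3) (h𝒯 : 𝒯.IsDDFV)
    {v : 𝒯.Vertex} (hv : v.1 ∈ Ω) :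
    ∑ w ∈ Finset.univ.filter (fun w => 𝒯.DualNbr v w), 𝒯.mDualFace v w • 𝒯.dualNormal v w = 0 := by
  rw [sum_mDualFace]
  refine Eq.trans ?_ (sum_mSigmaStar_outDualNormal hΩ hd h𝒯 hv)
  refine Finset.sum_congr rfl fun D _ => Finset.sum_congr rfl fun e _ => ?_
  rw [outDualNormal]
  split_ifs with h1 h2
  · rw [h1]
  · rw [h2, dualNormal_comm]
  · rfl

open Classical in
/-- Antisymmetrization of a sum over pairs of dual neighbours. -/
theorem sum_dualNbr_antisymm {X : 𝒯.Vertex → 𝒯.Vertex → ℝ}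
    (hX : ∀ v w, 𝒯.DualNbr v w → X v w = - X w v) (φ : 𝒯.Vertex → ℝ) :
    ∑ v, (∑ w ∈ Finset.univ.filter (fun w => 𝒯.DualNbr v w), X v w) * φ v =
      1 / 2 * ∑ v, ∑ w ∈ Finset.univ.filter (fun w => 𝒯.DualNbr v w), X v w * (φ v - φ w) := by
  have h1 : ∑ v, ∑ w ∈ Finset.univ.filter (fun w => 𝒯.DualNbr v w), X v w * φ v =
      - ∑ v, ∑ w ∈ Finset.univ.filter (fun w => 𝒯.DualNbr v w), X v w * φ w := by
    simp_rw [Finset.sum_filter]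
    rw [Finset.sum_comm, ← Finset.sum_neg_distrib]
    refine Finset.sum_congr rfl fun v _ => ?_
    rw [← Finset.sum_neg_distrib]
    refine Finset.sum_congr rfl fun w _ => ?_
    by_cases h : 𝒯.DualNbr v w
    · rw [if_pos h, if_pos h.symm, hX v w h]; ring
    · rw [if_neg h, if_neg fun h' => h h'.symm, neg_zero]
  simp_rw [Finset.sum_mul, mul_sub, Finset.sum_sub_distrib]
  linarith

variable (𝒯) in
/-- The pairing of the components of a discrete operator with a discrete function. -/
def pairWith (a : Fin 𝒯.n → ℝ) (as : 𝒯.Vertex → ℝ) (φ : 𝒯.DFun) : ℝ :=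
  pairing a as (fun K => φ.primal (Sum.inl K)) φ.dual

open Classical in
theorem pairWith_eq (a : Fin 𝒯.n → ℝ) (as : 𝒯.Vertex → ℝ) {φ : 𝒯.DFun} (hφ : VanishesOnBdry φ) :
    𝒯.pairWith a as φ = 1 / (d : ℝ) * ∑ K, 𝒯.mCell K * a K * φ.primal (Sum.inl K) +
      ((d : ℝ) - 1) / d * ∑ v, 𝒯.mDual v * as v * φ.dual v := by
  rw [pairWith, pairing, Finset.sum_filter]
  congr 2
  refine Finset.sum_congr rfl fun v _ => ?_
  split_ifs with h
  · rfl
  · rw [hφ.dual v h, mul_zero]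

open Classical in
/-- The measures of the control volumes cancel. Those of the dual volumes of boundary vertices are
not known to be positive, but there `φ` vanishes. -/
theorem pairWith_inv_mul (hΩ : IsOpen Ω) (hΩb : Bornology.IsBounded Ω)
    (a : Fin 𝒯.n → ℝ) (as : 𝒯.Vertex → ℝ) {φ : 𝒯.DFun} (hφ : VanishesOnBdry φ) :
    𝒯.pairWith (fun K => (𝒯.mCell K)⁻¹ * a K) (fun v => (𝒯.mDual v)⁻¹ * as v) φ =
      1 / (d : ℝ) * ∑ K, a K * φ.primal (Sum.inl K) +
      ((d : ℝ) - 1) / d * ∑ v, as v * φ.dual v := by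
  rw [pairWith_eq _ _ hφ]
  congr 2
  · refine Finset.sum_congr rfl fun K _ => ?_
    rw [mul_inv_cancel_left₀ (𝒯.mCell_pos K).ne']
  · refine Finset.sum_congr rfl fun v _ => ?_
    by_cases h : v.1 ∈ Ω
    · rw [mul_inv_cancel_left₀ (𝒯.mDual_pos hΩ hΩb h).ne']
    · rw [hφ.dual v h, mul_zero, mul_zero]

open Classical in
/-- The bilinear form of the convection operator. -/
def convForm (g : 𝒯.PFlux) (gs : 𝒯.DFlux) (u φ : 𝒯.DFun) : ℝ :=
  1 / (d : ℝ) * ∑ D : 𝒯.Interface, 𝒯.mFace D.K D.i *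
      (g (Sum.inl D.K) D.L (u.primal (Sum.inl D.K)) (u.primal D.L) *
        (φ.primal (Sum.inl D.K) - φ.primal D.L)) +
    ((d : ℝ) - 1) / d * (1 / 2 * ∑ v, ∑ w ∈ Finset.univ.filter (fun w => 𝒯.DualNbr v w),
      𝒯.mDualFace v w * (gs v w (u.dual v) (u.dual w) * (φ.dual v - φ.dual w)))

theorem pairWith_conv (hΩ : IsOpen Ω) (hΩb : Bornology.IsBounded Ω) {g : 𝒯.PFlux} {gs : 𝒯.DFlux}
    (hg : ∀ (D : 𝒯.Interface) a b, g (Sum.inl D.K) D.L a b = - g D.L (Sum.inl D.K) b a)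
    (hgs : ∀ v w, 𝒯.DualNbr v w → ∀ a b, gs v w a b = - gs w v b a)
    (u : 𝒯.DFun) {φ : 𝒯.DFun} (hφ : VanishesOnBdry φ) :
    𝒯.pairWith (convPrimal g u) (convDual gs u) φ = convForm g gs u φ := by
  classical
  unfold convPrimal convDual
  rw [pairWith_inv_mul hΩ hΩb _ _ hφ, convForm]
  congr 2
  · simp_rw [Finset.sum_mul]
    rw [Finset.sum_comm]
    refine Finset.sum_congr rfl fun D _ => ?_
    simp_rw [mul_assoc, ← Finset.mul_sum]
    congr 1
    simp_rw [ite_mul, zero_mul]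
    rw [sum_sides D (fun K => g (Sum.inl K) D.L (u.primal (Sum.inl K)) (u.primal D.L) *
        φ.primal (Sum.inl K)) (fun L => g L (Sum.inl D.K) (u.primal L) (u.primal (Sum.inl D.K)) *
        φ.primal L) (fun e => by rw [hφ.primal, mul_zero]), hg D]
    ring
  · rw [sum_dualNbr_antisymm]
    · simp_rw [mul_assoc]
    · intro v w hvw
      rw [hgs v w hvw, mDualFace_comm]; ring

/-- The bilinear form of minus the divergence operator. -/
def divForm (F : 𝒯.Interface → Pt d) (φ : 𝒯.DFun) : ℝ :=
  1 / (d : ℝ) * ∑ D : 𝒯.Interface, 𝒯.mFace D.K D.i * (inner ℝ (F D) (𝒯.normal D) *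
        (φ.primal D.L - φ.primal (Sum.inl D.K))) +
    ((d : ℝ) - 1) / d * ∑ D : 𝒯.Interface, ∑ e ∈ edges D.i, 𝒯.mSigmaStar D e *
      (inner ℝ (F D) (𝒯.dualNormal (𝒯.vtx D.K e.1) (𝒯.vtx D.K e.2)) *
        (φ.dual (𝒯.vtx D.K e.2) - φ.dual (𝒯.vtx D.K e.1)))

theorem pairWith_div (hΩ : IsOpen Ω) (hΩb : Bornology.IsBounded Ω) (F : 𝒯.Interface → Pt d)
    {φ : 𝒯.DFun} (hφ : VanishesOnBdry φ) :
    𝒯.pairWith (divPrimal F) (divDual F) φ = - divForm F φ := by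
  classical
  unfold divPrimal divDual
  rw [pairWith_inv_mul hΩ hΩb _ _ hφ, divForm, neg_add, ← mul_neg, ← mul_neg]
  congr 2
  · simp_rw [← Finset.sum_mul]
    change ∑ K, (∑ D : 𝒯.Interface, 𝒯.mFace D.K D.i * inner ℝ (F D) (outNormal K D)) * _ = _
    simp_rw [Finset.sum_mul]
    rw [Finset.sum_comm, ← Finset.sum_neg_distrib]
    refine Finset.sum_congr rfl fun D _ => ?_
    simp_rw [mul_assoc, ← Finset.mul_sum]
    rw [← mul_neg]
    congr 1
    have h1 : ∀ K, inner ℝ (F D) (outNormal K D) * φ.primal (Sum.inl K) =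
        if D.K = K then inner ℝ (F D) (𝒯.normal D) * φ.primal (Sum.inl K) else
          if D.L = Sum.inl K then -(inner ℝ (F D) (𝒯.normal D) * φ.primal (Sum.inl K)) else 0 := by
      intro K
      rw [outNormal]
      split_ifs
      · rfl
      · rw [inner_neg_right, neg_mul]
      · rw [inner_zero_right, zero_mul]
    simp_rw [h1]
    rw [sum_sides D (fun K => inner ℝ (F D) (𝒯.normal D) * φ.primal (Sum.inl K))
      (fun L => -(inner ℝ (F D) (𝒯.normal D) * φ.primal L))
      (fun e => by rw [hφ.primal, mul_zero, neg_zero])]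
    ring
  · simp_rw [Finset.sum_mul]
    rw [Finset.sum_comm, ← Finset.sum_neg_distrib]
    refine Finset.sum_congr rfl fun D _ => ?_
    rw [Finset.sum_comm, ← Finset.sum_neg_distrib]
    refine Finset.sum_congr rfl fun e he => ?_
    simp_rw [mul_assoc, ← Finset.mul_sum]
    rw [← mul_neg]
    congr 1
    set N := inner ℝ (F D) (𝒯.dualNormal (𝒯.vtx D.K e.1) (𝒯.vtx D.K e.2))
    have h1 : ∀ v, inner ℝ (F D) (outDualNormal v D e) * φ.dual v =
        if 𝒯.vtx D.K e.1 = v then N * φ.dual v else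
          if 𝒯.vtx D.K e.2 = v then -(N * φ.dual v) else 0 := by
      intro K
      rw [outDualNormal]
      split_ifs
      · rfl
      · rw [inner_neg_right, neg_mul]
      · rw [inner_zero_right, zero_mul]
    simp_rw [h1]
    rw [sum_ends (vtx_ne_of_mem_edges he)]
    ring

/-- The bilinear form of the penalization operator. -/
def penForm (w φ : 𝒯.DFun) : ℝ :=
  ((d : ℝ) - 1) / d * (𝒯.size)⁻¹ * ∑ K, ∑ v, 𝒯.mInter K v *
    ((w.primal (Sum.inl K) - w.dual v) * (φ.primal (Sum.inl K) - φ.dual v))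

theorem pairWith_pen (hΩ : IsOpen Ω) (hΩb : Bornology.IsBounded Ω) (w : 𝒯.DFun)
    {φ : 𝒯.DFun} (hφ : VanishesOnBdry φ) :
    𝒯.pairWith (penPrimal w) (penDual w) φ = penForm w φ := by
  classical
  have e1 : (penPrimal w : Fin 𝒯.n → ℝ) = fun K => (𝒯.mCell K)⁻¹ * (((d : ℝ) - 1) * (𝒯.size)⁻¹ *
      ∑ v : 𝒯.Vertex, 𝒯.mInter K v * (w.primal (Sum.inl K) - w.dual v)) := by
    funext K; rw [penPrimal]; ring
  have e2 : (penDual w : 𝒯.Vertex → ℝ) = fun v => (𝒯.mDual v)⁻¹ * ((𝒯.size)⁻¹ *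
      ∑ K : Fin 𝒯.n, 𝒯.mInter K v * (w.dual v - w.primal (Sum.inl K))) := by
    funext K; rw [penDual]; ring
  rw [e1, e2, pairWith_inv_mul hΩ hΩb _ _ hφ, penForm]
  have h2 : ∑ v, (𝒯.size)⁻¹ * (∑ K : Fin 𝒯.n, 𝒯.mInter K v * (w.dual v - w.primal (Sum.inl K))) *
      φ.dual v = (𝒯.size)⁻¹ * ∑ K, ∑ v, 𝒯.mInter K v *
        ((w.primal (Sum.inl K) - w.dual v) * (- φ.dual v)) := by
    rw [Finset.sum_comm, Finset.mul_sum]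
    refine Finset.sum_congr rfl fun v _ => ?_
    rw [mul_assoc, Finset.sum_mul]
    congr 1
    refine Finset.sum_congr rfl fun K _ => by ring
  have h1 : ∑ K, ((d : ℝ) - 1) * (𝒯.size)⁻¹ *
      (∑ v : 𝒯.Vertex, 𝒯.mInter K v * (w.primal (Sum.inl K) - w.dual v)) * φ.primal (Sum.inl K) =
      ((d : ℝ) - 1) * ((𝒯.size)⁻¹ * ∑ K, ∑ v, 𝒯.mInter K v *
        ((w.primal (Sum.inl K) - w.dual v) * φ.primal (Sum.inl K))) := by
    rw [Finset.mul_sum, Finset.mul_sum]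
    refine Finset.sum_congr rfl fun K _ => ?_
    rw [mul_assoc, mul_assoc, Finset.sum_mul]
    congr 2
    refine Finset.sum_congr rfl fun v _ => by ring
  have h3 : ∑ K, ∑ v, 𝒯.mInter K v *
      ((w.primal (Sum.inl K) - w.dual v) * (φ.primal (Sum.inl K) - φ.dual v)) =
      ∑ K, ∑ v, 𝒯.mInter K v * ((w.primal (Sum.inl K) - w.dual v) * φ.primal (Sum.inl K)) +
      ∑ K, ∑ v, 𝒯.mInter K v * ((w.primal (Sum.inl K) - w.dual v) * (- φ.dual v)) := by
    simp_rw [← Finset.sum_add_distrib]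
    refine Finset.sum_congr rfl fun K _ => Finset.sum_congr rfl fun v _ => by ring
  rw [h1, h2, h3]
  ring

/-! ### Constant fields have no flux through closed surfaces -/

theorem sum_interfaces_inner_eq_zero (hΩ : IsOpen Ω) (hd : d = 2 ∨ d = 3) (h𝒯 : 𝒯.IsDDFV)
    (V : 𝒯.CellBar → Pt d) (hV : ∀ e, V (Sum.inr e) = 0) :
    ∑ D : 𝒯.Interface, 𝒯.mFace D.K D.i * inner ℝ (V (Sum.inl D.K) - V D.L) (𝒯.normal D) = 0 := by
  classical
  have h1 : ∑ K, inner ℝ (V (Sum.inl K)) (∑ D : 𝒯.Interface, 𝒯.mFace D.K D.i • outNormal K D)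
      = (0 : ℝ) := by
    simp_rw [sum_mFace_outNormal hΩ hd h𝒯]
    simp
  rw [← h1]
  simp_rw [inner_sum]
  rw [Finset.sum_comm]
  refine Finset.sum_congr rfl fun D _ => ?_
  simp_rw [inner_smul_right, ← Finset.mul_sum]
  congr 1
  have h2 : ∀ K, inner ℝ (V (Sum.inl K)) (outNormal K D) =
      if D.K = K then inner ℝ (V (Sum.inl K)) (𝒯.normal D) else
        if D.L = Sum.inl K then inner ℝ (V (Sum.inl K)) (-𝒯.normal D) else 0 := by
    intro K
    rw [outNormal]
    split_ifs <;> simp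
  simp_rw [h2]
  rw [sum_sides D (fun K => inner ℝ (V (Sum.inl K)) (𝒯.normal D))
    (fun L => inner ℝ (V L) (-𝒯.normal D)) (fun e => by rw [hV, inner_zero_left]),
    inner_sub_left, inner_neg_right, sub_eq_add_neg]

open Classical in
theorem sum_dualNbr_inner_eq_zero (hΩ : IsOpen Ω) (hd : d = 2 ∨ d = 3) (h𝒯 : 𝒯.IsDDFV)
    (V : 𝒯.Vertex → Pt d) (hV : ∀ v : 𝒯.Vertex, v.1 ∉ Ω → V v = 0) :
    ∑ v, ∑ w ∈ Finset.univ.filter (fun w => 𝒯.DualNbr v w),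
      𝒯.mDualFace v w * inner ℝ (V v - V w) (𝒯.dualNormal v w) = 0 := by
  have h1 : ∑ v, inner ℝ (V v) (∑ w ∈ Finset.univ.filter (fun w => 𝒯.DualNbr v w),
      𝒯.mDualFace v w • 𝒯.dualNormal v w) = (0 : ℝ) := by
    refine Finset.sum_eq_zero fun v _ => ?_
    by_cases h : v.1 ∈ Ω
    · rw [sum_mDualFace_dualNormal hΩ hd h𝒯 h, inner_zero_right]
    · rw [hV v h, inner_zero_left]
  simp_rw [inner_sum, inner_smul_right] at h1
  have h2 : ∑ v, ∑ w ∈ Finset.univ.filter (fun w => 𝒯.DualNbr v w),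
      𝒯.mDualFace v w * inner ℝ (V w) (𝒯.dualNormal v w) = 0 := by
    rw [← neg_eq_zero, ← h1]
    simp_rw [Finset.sum_filter]
    rw [Finset.sum_comm, ← Finset.sum_neg_distrib]
    refine Finset.sum_congr rfl fun v _ => ?_
    rw [← Finset.sum_neg_distrib]
    refine Finset.sum_congr rfl fun w _ => ?_
    by_cases h : 𝒯.DualNbr v w
    · rw [if_pos h, if_pos h.symm, dualNormal_comm w v, mDualFace_comm w v, inner_neg_right]
      ring
    · rw [if_neg h, if_neg fun h' => h h'.symm, neg_zero]
  simp_rw [inner_sub_left, mul_sub, Finset.sum_sub_distrib]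
  rw [h1, h2, sub_zero]

end Triangulation

/-! ### Entropy fluxes -/

/-- `F` is an entropy flux for the nondecreasing function `θ`: testing any monotone consistent
numerical flux with `θ` costs no more than the difference of the values of `F`. -/
structure IsEntropyFlux {d : ℕ} (f : ℝ → Pt d) (θ : ℝ → ℝ) (F : ℝ → Pt d) : Prop where
  zero : F 0 = 0
  le : ∀ (ν : Pt d) (g : ℝ → ℝ → ℝ), (∀ a, g a a = inner ℝ (f a) ν) →
    (∀ b, Monotone fun a => g a b) → (∀ a, Antitone fun b => g a b) →
    ∀ a b, inner ℝ (F a - F b) ν ≤ g a b * (θ a - θ b)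

namespace IsEntropyFlux

variable {d : ℕ} {f : ℝ → Pt d}

theorem add {θ η : ℝ → ℝ} {F G : ℝ → Pt d} (hF : IsEntropyFlux f θ F) (hG : IsEntropyFlux f η G) :
    IsEntropyFlux f (fun s => θ s + η s) (fun s => F s + G s) where
  zero := by simp only [hF.zero, hG.zero, add_zero]
  le ν g h1 h2 h3 a b := by
    have := hF.le ν g h1 h2 h3 a b
    have := hG.le ν g h1 h2 h3 a b
    rw [add_sub_add_comm, inner_add_left]
    linarith

/-- A Kruzhkov entropy flux, for the upper part of the test function of the maximum principle. -/
theorem step_pos {κ : ℝ} (hκ : 0 ≤ κ) :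
    IsEntropyFlux f (fun s => if κ < s then 1 else 0) (fun s => if κ < s then f κ else 0) where
  zero := if_neg hκ.not_gt
  le ν g h1 h2 h3 a b := by
    by_cases ha : κ < a <;> by_cases hb : κ < b
    · simp [ha, hb]
    · have h4 := h2 κ ha.le
      have h5 := h3 a (not_lt.1 hb)
      simp only [h1] at h4
      simp only [ha, hb, if_true, if_false, sub_zero, mul_one]
      linarith
    · have h4 := h2 κ (not_lt.1 ha)
      have h5 := h3 a hb.le
      simp only [h1] at h4
      simp only [ha, hb, if_true, if_false, zero_sub, mul_neg, mul_one, inner_neg_left]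
      linarith
    · simp [ha, hb]

/-- A Kruzhkov entropy flux, for the lower part of the test function of the maximum principle. -/
theorem step_neg {κ : ℝ} (hκ : 0 ≤ κ) :
    IsEntropyFlux f (fun s => if s < -κ then -1 else 0)
      (fun s => if s < -κ then -f (-κ) else 0) where
  zero := if_neg (by linarith)
  le ν g h1 h2 h3 a b := by
    by_cases ha : a < -κ <;> by_cases hb : b < -κ
    · simp [ha, hb]
    · have h4 := h2 (-κ) ha.le
      have h5 := h3 a (not_lt.1 hb)
      simp only [h1] at h4
      simp only [ha, hb, if_true, if_false, sub_zero, mul_neg, mul_one, inner_neg_left]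
      linarith
    · have h4 := h2 (-κ) (not_lt.1 ha)
      have h5 := h3 a hb.le
      simp only [h1] at h4
      simp only [ha, hb, if_true, if_false, zero_sub, neg_neg, mul_one]
      linarith
    · simp [ha, hb]

/-- Between `b` and `a`, monotonicity and consistency of `g` compare `g a b` with `f s · ν` at every
intermediate value `s`, on the side prescribed by the order of `a` and `b`. -/
theorem inner_intervalIntegral_le (hf : Continuous f) (A : StieltjesFunction ℝ) (ν : Pt d)
    (g : ℝ → ℝ → ℝ) (h1 : ∀ a, g a a = inner ℝ (f a) ν) (h2 : ∀ b, Monotone fun a => g a b)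
    (h3 : ∀ a, Antitone fun b => g a b) (a b : ℝ) :
    inner ℝ (∫ s in b..a, f s ∂A.measure) ν ≤ g a b * (A a - A b) := by
  have hν : Continuous fun s => inner ℝ (f s) ν := hf.inner continuous_const
  have e1 : inner ℝ (∫ s in b..a, f s ∂A.measure) ν = ∫ s in b..a, inner ℝ (f s) ν ∂A.measure := by
    rw [real_inner_comm]
    have := (innerSL ℝ ν).intervalIntegral_comp_comm (hf.intervalIntegrable (μ := A.measure) b a)
    simp only [innerSL_apply_apply] at this
    rw [← this]
    simp_rw [real_inner_comm ν]
  have hm : ∀ x y, x ≤ y → ∫ _ in x..y, g a b ∂A.measure = g a b * (A y - A x) := by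
    intro x y hxy
    rw [intervalIntegral.integral_const', Ioc_eq_empty_of_le hxy, measureReal_empty, sub_zero,
      measureReal_def, StieltjesFunction.measure_Ioc, ENNReal.toReal_ofReal
        (sub_nonneg.2 (A.mono hxy)), smul_eq_mul, mul_comm]
  rw [e1]
  rcases le_total b a with h | h
  · rw [← hm b a h]
    refine intervalIntegral.integral_mono_on h (hν.intervalIntegrable _ _) (by simp) ?_
    intro s hs
    have h4 := h2 s hs.2
    have h5 := h3 a hs.1
    simp only [h1] at h4
    linarith
  · have h6 : ∫ _ in a..b, g a b ∂A.measure ≤ ∫ s in a..b, inner ℝ (f s) ν ∂A.measure := by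
      refine intervalIntegral.integral_mono_on h (by simp) (hν.intervalIntegrable _ _) ?_
      intro s hs
      have h4 := h2 s hs.1
      have h5 := h3 a hs.2
      simp only [h1] at h4
      linarith
    rw [hm a b h] at h6
    rw [intervalIntegral.integral_symm]
    linarith

/-- The entropy flux of a continuous nondecreasing function `A` is the Stieltjes integral of the
flux against `A`. -/
theorem exists_of_monotone (hf : Continuous f) {A : ℝ → ℝ} (hA : Continuous A)
    (hA' : Monotone A) : ∃ F, IsEntropyFlux f A F := by
  let B : StieltjesFunction ℝ := ⟨A, hA', fun x => hA.continuousWithinAt⟩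
  refine ⟨fun a => ∫ s in (0 : ℝ)..a, f s ∂B.measure, intervalIntegral.integral_same, ?_⟩
  intro ν g h1 h2 h3 a b
  rw [intervalIntegral.integral_interval_sub_left (hf.intervalIntegrable _ _)
    (hf.intervalIntegrable _ _)]
  exact inner_intervalIntegral_le hf B ν g h1 h2 h3 a b

end IsEntropyFlux

theorem IsModulusOn.exists_bound {d : ℕ} {f : ℝ → Pt d} {M : ℝ} {ω : ℝ → ℝ}
    (hω : IsModulusOn f M ω) : ∃ W, 0 ≤ W ∧ ∀ z ∈ Icc 0 (2 * M), |ω z| ≤ W := by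
  obtain ⟨W, hW⟩ := isCompact_Icc.exists_bound_of_continuousOn hω.cont
  exact ⟨max W 0, le_max_right _ _, fun z hz => (hW z hz).trans (le_max_left _ _)⟩

theorem IsNumFlux.abs_apply_le {d : ℕ} {f : ℝ → Pt d} {M : ℝ} {ω : ℝ → ℝ} {c : ℝ} {ν : Pt d}
    {g g' : ℝ → ℝ → ℝ} (hg : IsNumFlux f M ω c ν g g') (hf0 : f 0 = 0) {W : ℝ}
    (hW : ∀ z ∈ Icc 0 (2 * M), |ω z| ≤ W) {a b : ℝ} (ha : |a| ≤ M) (hb : |b| ≤ M) :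
    |g a b| ≤ |c| * (2 * W) := by
  have hM : 0 ≤ M := (abs_nonneg _).trans ha
  have h0 : g 0 0 = 0 := by rw [hg.consistent, hf0, inner_zero_left]
  have h1 := hg.modulus a (abs_le.1 ha) b (abs_le.1 hb) 0 ⟨by linarith, hM⟩ 0 ⟨by linarith, hM⟩
  rw [h0, sub_zero, sub_zero, sub_zero] at h1
  have h2 := hW |a| ⟨abs_nonneg _, by linarith⟩
  have h3 := hW |b| ⟨abs_nonneg _, by linarith⟩
  calc |g a b| ≤ |c * (ω |a| + ω |b|)| := h1.trans (le_abs_self _)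
    _ = |c| * |ω (|a|) + ω (|b|)| := abs_mul _ _
    _ ≤ |c| * (2 * W) := by
      gcongr
      exact (abs_add_le _ _).trans (by linarith)

namespace Triangulation

variable {d : ℕ} [NeZero d] {Ω : Set (Pt d)} {𝒯 : Triangulation d Ω}

@[simp] theorem comp_primal (θ : ℝ → ℝ) (u : 𝒯.DFun) (K : 𝒯.CellBar) :
    (u.comp θ).primal K = θ (u.primal K) := rfl

@[simp] theorem comp_dual (θ : ℝ → ℝ) (u : 𝒯.DFun) (v : 𝒯.Vertex) :
    (u.comp θ).dual v = θ (u.dual v) := rfl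

theorem VanishesOnBdry.comp {u : 𝒯.DFun} (hu : VanishesOnBdry u) {θ : ℝ → ℝ} (hθ : θ 0 = 0) :
    VanishesOnBdry (u.comp θ) :=
  ⟨fun e => by rw [comp_primal, hu.primal, hθ], fun v hv => by rw [comp_dual, hu.dual v hv, hθ]⟩

/-- Convection dissipates every convex entropy that vanishes on the boundary. -/
theorem convForm_comp_nonneg (hΩ : IsOpen Ω) (hd : d = 2 ∨ d = 3) (h𝒯 : 𝒯.IsDDFV)
    {f : ℝ → Pt d} {M : ℝ} {ω : ℝ → ℝ} {c : ℝ} {g : 𝒯.PFlux} {gs : 𝒯.DFlux}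
    (hg : ∀ D : 𝒯.Interface, IsNumFlux f M ω c (𝒯.normal D)
      (g (Sum.inl D.K) D.L) (g D.L (Sum.inl D.K)))
    (hgs : ∀ v w, 𝒯.DualNbr v w → IsNumFlux f M ω c (𝒯.dualNormal v w) (gs v w) (gs w v))
    {θ : ℝ → ℝ} {F : ℝ → Pt d} (hF : IsEntropyFlux f θ F) {u : 𝒯.DFun} (hu : VanishesOnBdry u) :
    0 ≤ convForm g gs u (u.comp θ) := by
  classical
  have hd1 := one_le_sub_one hd
  have h1 := sum_interfaces_inner_eq_zero hΩ hd h𝒯 (fun K => F (u.primal K))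
    (fun e => by rw [hu.primal, hF.zero])
  have h2 := sum_dualNbr_inner_eq_zero hΩ hd h𝒯 (fun v => F (u.dual v))
    (fun v hv => by rw [hu.dual v hv, hF.zero])
  rw [convForm]
  refine add_nonneg (mul_nonneg (by positivity) ?_) (mul_nonneg (by
    apply div_nonneg <;> linarith) (mul_nonneg (by norm_num) ?_))
  · rw [← h1]
    refine Finset.sum_le_sum fun D _ => mul_le_mul_of_nonneg_left ?_ (𝒯.mFace_nonneg _ _)
    exact hF.le _ _ (hg D).consistent (hg D).mono (hg D).anti _ _
  · rw [← h2]
    refine Finset.sum_le_sum fun v _ => Finset.sum_le_sum fun w hw =>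
      mul_le_mul_of_nonneg_left ?_ (mDualFace_nonneg _ _)
    have := hgs v w (Finset.mem_filter.1 hw).2
    exact hF.le _ _ this.consistent this.mono this.anti _ _

/-- The convective dissipation is the convection form tested with the solution itself. -/
theorem convForm_self (hΩ : IsOpen Ω) (hd : d = 2 ∨ d = 3) (h𝒯 : 𝒯.IsDDFV)
    {f : ℝ → Pt d} (hf : Continuous f) {M : ℝ} {ω : ℝ → ℝ} {c : ℝ} {g : 𝒯.PFlux} {gs : 𝒯.DFlux}
    (hg : ∀ D : 𝒯.Interface, IsNumFlux f M ω c (𝒯.normal D)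
      (g (Sum.inl D.K) D.L) (g D.L (Sum.inl D.K)))
    (hgs : ∀ v w, 𝒯.DualNbr v w → IsNumFlux f M ω c (𝒯.dualNormal v w) (gs v w) (gs w v))
    {u : 𝒯.DFun} (hu : VanishesOnBdry u) :
    dissPrimal g u + dissDual gs u = convForm g gs u u := by
  classical
  set F : ℝ → Pt d := fun a => ∫ s in (0 : ℝ)..a, f s with hF
  have hF0 : F 0 = 0 := intervalIntegral.integral_same
  have key : ∀ (ν : Pt d) (g g' : ℝ → ℝ → ℝ), IsNumFlux f M ω c ν g g' → ∀ a b,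
      ∫ s in a..b, (g s s - g a b) = g a b * (a - b) - inner ℝ (F a - F b) ν := by
    intro ν g g' h a b
    have hν : Continuous fun s => inner ℝ (f s) ν := hf.inner continuous_const
    simp_rw [h.consistent]
    rw [intervalIntegral.integral_sub (hν.intervalIntegrable _ _) (by simp), hF]
    simp only
    rw [intervalIntegral.integral_interval_sub_left (hf.intervalIntegrable _ _)
      (hf.intervalIntegrable _ _), intervalIntegral.integral_const, real_inner_comm]
    have := (innerSL ℝ ν).intervalIntegral_comp_comm (hf.intervalIntegrable (μ := volume) b a)
    simp only [innerSL_apply_apply] at this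
    rw [← this, intervalIntegral.integral_symm b a]
    simp_rw [real_inner_comm ν]
    rw [smul_eq_mul]
    ring
  have h1 := sum_interfaces_inner_eq_zero hΩ hd h𝒯 (fun K => F (u.primal K))
    (fun e => by rw [hu.primal, hF0])
  have h2 := sum_dualNbr_inner_eq_zero hΩ hd h𝒯 (fun v => F (u.dual v))
    (fun v hv => by rw [hu.dual v hv, hF0])
  rw [dissPrimal, dissDual, convForm]
  congr 2
  · rw [← sub_zero (∑ D : 𝒯.Interface, 𝒯.mFace D.K D.i * (_ * _)), ← h1, ← Finset.sum_sub_distrib]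
    refine Finset.sum_congr rfl fun D _ => ?_
    rw [key _ _ _ (hg D), mul_sub]
  · congr 1
    rw [← sub_zero (∑ v, ∑ w ∈ _, 𝒯.mDualFace v w * (_ * _)), ← h2, ← Finset.sum_sub_distrib]
    refine Finset.sum_congr rfl fun v _ => ?_
    rw [← Finset.sum_sub_distrib]
    refine Finset.sum_congr rfl fun w hw => ?_
    rw [key _ _ _ (hgs v w (Finset.mem_filter.1 hw).2), mul_sub]

theorem abs_primal_sub_le (hd : d = 2 ∨ d = 3) (h𝒯 : 𝒯.IsDDFV) (φ : 𝒯.DFun) (D : 𝒯.Interface) :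
    |φ.primal D.L - φ.primal (Sum.inl D.K)| ≤ 𝒯.dKL D * ‖grad φ D‖ := by
  have hp := dKL_pos h𝒯 D
  have h := abs_real_inner_le_norm (grad φ D) (𝒯.normal D)
  rw [inner_grad_normal hd h𝒯, norm_normal h𝒯, mul_one, abs_div, abs_of_pos hp,
    div_le_iff₀ hp] at h
  linarith

theorem abs_dual_sub_le (hd : d = 2 ∨ d = 3) (h𝒯 : 𝒯.IsDDFV) (φ : 𝒯.DFun) (D : 𝒯.Interface)
    {e : Fin (d + 1) × Fin (d + 1)} (he : e ∈ edges D.i) :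
    |φ.dual (𝒯.vtx D.K e.2) - φ.dual (𝒯.vtx D.K e.1)| ≤
      𝒯.dualDist (𝒯.vtx D.K e.1) (𝒯.vtx D.K e.2) * ‖grad φ D‖ := by
  have hp := dualDist_pos D he
  have h := abs_real_inner_le_norm (grad φ D) (𝒯.dualNormal (𝒯.vtx D.K e.1) (𝒯.vtx D.K e.2))
  rw [inner_grad_dualNormal hd h𝒯 φ D he, norm_dualNormal D he, mul_one, abs_div, abs_of_pos hp,
    div_le_iff₀ hp] at h
  linarith

theorem sum_mSigmaStar_mul (hd : d = 2 ∨ d = 3) (h𝒯 : 𝒯.IsDDFV) (D : 𝒯.Interface) :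
    ∑ e ∈ edges D.i, 𝒯.mSigmaStar D e * 𝒯.dualDist (𝒯.vtx D.K e.1) (𝒯.vtx D.K e.2) =
      d * 𝒯.mDiamond D := by
  have hd1 := one_le_sub_one hd
  have hd0 : (d : ℝ) ≠ 0 := by linarith
  rw [mDiamond_eq, mul_div_cancel₀ _ hd0, mFace, Finset.sum_mul]
  exact Finset.sum_congr rfl fun e he => mSigmaStar_mul hd h𝒯 D he

/-- Bounded numerical fluxes: the convection form is bounded by the `L^1` norm of the discrete
gradient of the test function. -/
theorem abs_convForm_le (hd : d = 2 ∨ d = 3) (h𝒯 : 𝒯.IsDDFV) {g : 𝒯.PFlux} {gs : 𝒯.DFlux}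
    {u : 𝒯.DFun} {W : ℝ}
    (hg : ∀ D : 𝒯.Interface, |g (Sum.inl D.K) D.L (u.primal (Sum.inl D.K)) (u.primal D.L)| ≤ W)
    (hgs : ∀ v w, 𝒯.DualNbr v w → |gs v w (u.dual v) (u.dual w)| ≤ W) (φ : 𝒯.DFun) :
    |convForm g gs u φ| ≤ W * d * ∑ D, 𝒯.mDiamond D * ‖grad φ D‖ := by
  classical
  have hd1 := one_le_sub_one hd
  have hd0 : (d : ℝ) ≠ 0 := by linarith
  have hdp : 0 < (d : ℝ) := by linarith
  rw [convForm]
  have h1 : |∑ D : 𝒯.Interface, 𝒯.mFace D.K D.i *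
      (g (Sum.inl D.K) D.L (u.primal (Sum.inl D.K)) (u.primal D.L) *
        (φ.primal (Sum.inl D.K) - φ.primal D.L))| ≤ W * d * ∑ D, 𝒯.mDiamond D * ‖grad φ D‖ := by
    rw [Finset.mul_sum]
    refine (Finset.abs_sum_le_sum_abs _ _).trans (Finset.sum_le_sum fun D _ => ?_)
    have hm := 𝒯.mFace_nonneg D.K D.i
    have hW := (abs_nonneg _).trans (hg D)
    rw [abs_mul, abs_mul, abs_of_nonneg hm, abs_sub_comm]
    calc _ ≤ 𝒯.mFace D.K D.i * (W * (𝒯.dKL D * ‖grad φ D‖)) := by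
          gcongr
          · exact hg D
          · exact abs_primal_sub_le hd h𝒯 φ D
      _ = _ := by rw [mDiamond_eq]; field_simp
  have h2 : |1 / 2 * ∑ v, ∑ w ∈ Finset.univ.filter (fun w => 𝒯.DualNbr v w),
      𝒯.mDualFace v w * (gs v w (u.dual v) (u.dual w) * (φ.dual v - φ.dual w))| ≤
      W * d * ∑ D, 𝒯.mDiamond D * ‖grad φ D‖ := by
    have h3 := sum_sum_mDualFace (𝒯 := 𝒯) (β := ℝ)
      (fun v w => gs v w (u.dual v) (u.dual w) * (φ.dual v - φ.dual w))
    simp only [smul_eq_mul] at h3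
    rw [h3, Finset.mul_sum, Finset.mul_sum]
    refine (Finset.abs_sum_le_sum_abs _ _).trans (Finset.sum_le_sum fun D _ => ?_)
    have h4 : ∀ e ∈ edges D.i, |𝒯.mSigmaStar D e *
        (gs (𝒯.vtx D.K e.1) (𝒯.vtx D.K e.2) (u.dual (𝒯.vtx D.K e.1)) (u.dual (𝒯.vtx D.K e.2)) *
          (φ.dual (𝒯.vtx D.K e.1) - φ.dual (𝒯.vtx D.K e.2)) +
        gs (𝒯.vtx D.K e.2) (𝒯.vtx D.K e.1) (u.dual (𝒯.vtx D.K e.2)) (u.dual (𝒯.vtx D.K e.1)) *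
          (φ.dual (𝒯.vtx D.K e.2) - φ.dual (𝒯.vtx D.K e.1)))| ≤
        𝒯.mSigmaStar D e * 𝒯.dualDist (𝒯.vtx D.K e.1) (𝒯.vtx D.K e.2) *
          (2 * W * ‖grad φ D‖) := by
      intro e he
      have hnbr : 𝒯.DualNbr (𝒯.vtx D.K e.1) (𝒯.vtx D.K e.2) :=
        ⟨vtx_ne_of_mem_edges he, D.K, e.1, e.2, rfl, rfl⟩
      have hm := mSigmaStar_nonneg D e
      have hW := (abs_nonneg _).trans (hgs _ _ hnbr)
      rw [abs_mul, abs_of_nonneg hm, mul_assoc]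
      refine mul_le_mul_of_nonneg_left ?_ hm
      refine (abs_add_le _ _).trans ?_
      rw [abs_mul, abs_mul, abs_sub_comm (φ.dual (𝒯.vtx D.K e.1))]
      have h5 := mul_le_mul (hgs _ _ hnbr) (abs_dual_sub_le hd h𝒯 φ D he) (abs_nonneg _) hW
      have h6 := mul_le_mul (hgs _ _ hnbr.symm) (abs_dual_sub_le hd h𝒯 φ D he) (abs_nonneg _) hW
      linarith
    have h7 := (Finset.abs_sum_le_sum_abs _ _).trans (Finset.sum_le_sum h4)
    rw [← Finset.sum_mul, sum_mSigmaStar_mul hd h𝒯] at h7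
    rw [abs_mul, abs_of_pos (by norm_num : (0 : ℝ) < 1 / 2)]
    linarith
  calc _ ≤ 1 / (d : ℝ) * (W * d * ∑ D, 𝒯.mDiamond D * ‖grad φ D‖) +
        ((d : ℝ) - 1) / d * (W * d * ∑ D, 𝒯.mDiamond D * ‖grad φ D‖) := by
        refine (abs_add_le _ _).trans ?_
        have h8 : 0 ≤ ((d : ℝ) - 1) / d := div_nonneg (by linarith) hdp.le
        rw [abs_mul, abs_mul, abs_of_nonneg h8, abs_of_nonneg (by positivity : 0 ≤ 1 / (d : ℝ))]
        gcongr
    _ = _ := by field_simp; ring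

end Triangulation

/-! ### Diffusion and penalization -/

theorem Monotone.sub_mul_sub_nonneg {A θ : ℝ → ℝ} (hA : Monotone A) (hθ : Monotone θ) (a b : ℝ) :
    0 ≤ (A a - A b) * (θ a - θ b) := by
  rcases le_total a b with h | h
  · exact mul_nonneg_of_nonpos_of_nonpos (sub_nonpos.2 (hA h)) (sub_nonpos.2 (hθ h))
  · exact mul_nonneg (sub_nonneg.2 (hA h)) (sub_nonneg.2 (hθ h))

theorem rpow_sub_one_mul_le {p x y : ℝ} (hp : 1 < p) (hx : 0 < x) (hy : 0 ≤ y) :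
    x ^ (p - 1) * y ≤ x ^ p + y ^ p := by
  have h1 : ∀ z : ℝ, 0 < z → z ^ (p - 1) * z = z ^ p := fun z hz => by
    nth_rewrite 2 [← Real.rpow_one z]
    rw [← Real.rpow_add hz, sub_add_cancel]
  have h2 := Real.rpow_nonneg hx.le p
  have h3 := Real.rpow_nonneg hy p
  rcases le_total y x with h | h
  · have := mul_le_mul_of_nonneg_left h (Real.rpow_nonneg hx.le (p - 1))
    rw [h1 x hx] at this
    linarith
  · have := mul_le_mul_of_nonneg_right
      (Real.rpow_le_rpow hx.le h (by linarith : 0 ≤ p - 1)) hy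
    rw [h1 y (hx.trans_le h)] at this
    linarith

theorem le_one_add_rpow {p x : ℝ} (hp : 1 < p) (hx : 0 ≤ x) : x ≤ 1 + x ^ p := by
  have h2 := Real.rpow_nonneg hx p
  rcases le_total x 1 with h | h
  · linarith
  · have := Real.rpow_le_rpow_of_exponent_le h hp.le
    rw [Real.rpow_one] at this
    linarith

namespace IsDiffusion

variable {d : ℕ} {p c : ℝ} {k : Pt d → ℝ}

theorem nonneg (hk : IsDiffusion p c k) {ξ : Pt d} (hξ : ξ ≠ 0) : 0 ≤ k ξ :=
  le_trans (mul_nonneg (one_div_nonneg.2 hk.pos.le) (Real.rpow_nonneg (norm_nonneg _) _))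
    (hk.lower ξ hξ)

theorem inner_self_ge (hk : IsDiffusion p c k) (ξ : Pt d) :
    1 / c * ‖ξ‖ ^ p ≤ inner ℝ (k ξ • ξ) ξ := by
  rcases eq_or_ne ξ 0 with rfl | hξ
  · rw [norm_zero, Real.zero_rpow (by linarith [hk.one_lt]), mul_zero, inner_zero_right]
  · have hn := norm_pos_iff.2 hξ
    rw [inner_smul_left, real_inner_self_eq_norm_sq, conj_trivial]
    have h := mul_le_mul_of_nonneg_right (hk.lower ξ hξ) (sq_nonneg ‖ξ‖)
    rw [mul_assoc, ← Real.rpow_natCast, ← Real.rpow_add hn] at h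
    simpa using h

theorem abs_inner_le (hk : IsDiffusion p c k) (ξ η : Pt d) :
    |inner ℝ (k ξ • ξ) η| ≤ c * (‖ξ‖ ^ p + ‖η‖ ^ p) := by
  have hc := hk.pos
  rcases eq_or_ne ξ 0 with rfl | hξ
  · rw [smul_zero, inner_zero_left, abs_zero]
    positivity
  · have hn := norm_pos_iff.2 hξ
    refine (abs_real_inner_le_norm _ _).trans ?_
    rw [norm_smul, Real.norm_of_nonneg (hk.nonneg hξ)]
    have h := mul_le_mul_of_nonneg_right (hk.upper ξ hξ) hn.le
    have e : ‖ξ‖ ^ (p - 2) * ‖ξ‖ = ‖ξ‖ ^ (p - 1) := by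
      nth_rewrite 2 [← Real.rpow_one ‖ξ‖]
      rw [← Real.rpow_add hn]
      congr 1
      ring
    rw [mul_assoc, e] at h
    calc _ ≤ c * ‖ξ‖ ^ (p - 1) * ‖η‖ := mul_le_mul_of_nonneg_right h (norm_nonneg _)
      _ = c * (‖ξ‖ ^ (p - 1) * ‖η‖) := mul_assoc _ _ _
      _ ≤ _ := by
        gcongr
        exact rpow_sub_one_mul_le hk.one_lt hn (norm_nonneg _)

end IsDiffusion

namespace Triangulation

variable {d : ℕ} [NeZero d] {Ω : Set (Pt d)} {𝒯 : Triangulation d Ω}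

/-- The discrete duality: the divergence is the adjoint of the gradient. -/
theorem divForm_eq (hd : d = 2 ∨ d = 3) (h𝒯 : 𝒯.IsDDFV) (F : 𝒯.Interface → Pt d) (φ : 𝒯.DFun) :
    divForm F φ = ∑ D, 𝒯.mDiamond D * inner ℝ (F D) (grad φ D) := by
  have hd1 := one_le_sub_one hd
  have hd0 : (d : ℝ) ≠ 0 := by linarith
  rw [divForm, Finset.mul_sum, Finset.mul_sum, ← Finset.sum_add_distrib]
  refine Finset.sum_congr rfl fun D _ => ?_
  have hk := dKL_pos h𝒯 D
  have hm := mDiamond_pos hd h𝒯 D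
  rw [grad, inner_add_right, inner_smul_right, inner_smul_right, inner_sum, mul_add]
  congr 1
  · rw [mDiamond_eq]
    field_simp
  · rw [← mul_assoc, mul_div_cancel₀ _ hm.ne', Finset.mul_sum, Finset.mul_sum]
    refine Finset.sum_congr rfl fun e he => ?_
    have hp := dualDist_pos D he
    have h1 : 𝒯.mSigmaStar D e * 𝒯.dualDist (𝒯.vtx D.K e.1) (𝒯.vtx D.K e.2) =
      𝒯.mSigma D.K D.i e * 𝒯.dKL D := mSigmaStar_mul hd h𝒯 D he
    rw [← eq_div_iff hp.ne'] at h1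
    rw [inner_smul_right, mSub, h1]
    field_simp

/-- The flux `k(∇A(u)) ∇A(u)` is a nonnegative multiple of `∇A(u)`, so each normal component of
the flux has the sign of the corresponding difference of `A(u)`, hence of `θ(u)`. -/
theorem divForm_comp_nonneg (hd : d = 2 ∨ d = 3) (h𝒯 : 𝒯.IsDDFV) {p c : ℝ} {k : Pt d → ℝ}
    (hk : IsDiffusion p c k) {A θ : ℝ → ℝ} (hA : Monotone A) (hθ : Monotone θ) (u : 𝒯.DFun) :
    0 ≤ divForm (fun D => k (grad (u.comp A) D) • grad (u.comp A) D) (u.comp θ) := by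
  have hd1 := one_le_sub_one hd
  rw [divForm]
  refine add_nonneg (mul_nonneg (by positivity) (Finset.sum_nonneg fun D _ => ?_)) (mul_nonneg
    (div_nonneg (by linarith) (by linarith)) (Finset.sum_nonneg fun D _ =>
      Finset.sum_nonneg fun e he => ?_))
  · refine mul_nonneg (𝒯.mFace_nonneg _ _) ?_
    rcases eq_or_ne (grad (u.comp A) D) 0 with h0 | h0
    · rw [h0, smul_zero, inner_zero_left, zero_mul]
    · rw [inner_smul_left, inner_grad_normal hd h𝒯, conj_trivial, mul_assoc, div_mul_eq_mul_div]
      exact mul_nonneg (hk.nonneg h0) (div_nonneg (Monotone.sub_mul_sub_nonneg hA hθ _ _)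
        (dKL_pos h𝒯 D).le)
  · refine mul_nonneg (mSigmaStar_nonneg _ _) ?_
    rcases eq_or_ne (grad (u.comp A) D) 0 with h0 | h0
    · rw [h0, smul_zero, inner_zero_left, zero_mul]
    · rw [inner_smul_left, inner_grad_dualNormal hd h𝒯 _ D he, conj_trivial, mul_assoc,
        div_mul_eq_mul_div]
      exact mul_nonneg (hk.nonneg h0) (div_nonneg (Monotone.sub_mul_sub_nonneg hA hθ _ _)
        (dualDist_pos D he).le)

theorem le_divForm_self (hd : d = 2 ∨ d = 3) (h𝒯 : 𝒯.IsDDFV) {p c : ℝ} {k : Pt d → ℝ}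
    (hk : IsDiffusion p c k) (w : 𝒯.DFun) :
    1 / c * ∑ D, 𝒯.mDiamond D * ‖grad w D‖ ^ p ≤
      divForm (fun D => k (grad w D) • grad w D) w := by
  rw [divForm_eq hd h𝒯, Finset.mul_sum]
  refine Finset.sum_le_sum fun D _ => ?_
  rw [mul_left_comm]
  exact mul_le_mul_of_nonneg_left (hk.inner_self_ge _) (mDiamond_pos hd h𝒯 D).le

theorem abs_divForm_le (hd : d = 2 ∨ d = 3) (h𝒯 : 𝒯.IsDDFV) {p c : ℝ} {k : Pt d → ℝ}
    (hk : IsDiffusion p c k) (w φ : 𝒯.DFun) :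
    |divForm (fun D => k (grad w D) • grad w D) φ| ≤
      c * (∑ D, 𝒯.mDiamond D * ‖grad w D‖ ^ p + ∑ D, 𝒯.mDiamond D * ‖grad φ D‖ ^ p) := by
  rw [divForm_eq hd h𝒯, ← Finset.sum_add_distrib, Finset.mul_sum]
  refine (Finset.abs_sum_le_sum_abs _ _).trans (Finset.sum_le_sum fun D _ => ?_)
  have hm := (mDiamond_pos hd h𝒯 D).le
  rw [abs_mul, abs_of_nonneg hm, ← mul_add, mul_left_comm]
  exact mul_le_mul_of_nonneg_left (hk.abs_inner_le _ _) hm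

theorem sum_mDiamond_norm_grad_le (hΩ : IsOpen Ω) (hΩb : Bornology.IsBounded Ω)
    (hd : d = 2 ∨ d = 3) (h𝒯 : 𝒯.IsDDFV) {p : ℝ} (hp : 1 < p) (φ : 𝒯.DFun) :
    ∑ D, 𝒯.mDiamond D * ‖grad φ D‖ ≤
      volume.real Ω / volume.real (stdCorner d) + ∑ D, 𝒯.mDiamond D * ‖grad φ D‖ ^ p := by
  refine le_trans ?_ (add_le_add_left (𝒯.sum_mDiamond_le hΩ hΩb hd h𝒯) _)
  rw [← Finset.sum_add_distrib]
  refine Finset.sum_le_sum fun D _ => ?_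
  have := mul_le_mul_of_nonneg_left (le_one_add_rpow hp (norm_nonneg (grad φ D)))
    (mDiamond_pos hd h𝒯 D).le
  linarith

variable (𝒯) in
theorem size_nonneg : 0 ≤ 𝒯.size :=
  le_max_of_le_left (Real.iSup_nonneg fun _ => Metric.diam_nonneg)

theorem penForm_comp_nonneg (hd : d = 2 ∨ d = 3) {A θ : ℝ → ℝ} (hA : Monotone A)
    (hθ : Monotone θ) (u : 𝒯.DFun) : 0 ≤ penForm (u.comp A) (u.comp θ) := by
  have hd1 := one_le_sub_one hd
  have h1 : 0 ≤ ((d : ℝ) - 1) / d := div_nonneg (by linarith) (by linarith)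
  have h2 := inv_nonneg.2 𝒯.size_nonneg
  refine mul_nonneg (mul_nonneg h1 h2) (Finset.sum_nonneg fun K _ => Finset.sum_nonneg fun v _ =>
    mul_nonneg measureReal_nonneg (Monotone.sub_mul_sub_nonneg hA hθ _ _))

theorem penForm_self_nonneg (hd : d = 2 ∨ d = 3) (w : 𝒯.DFun) : 0 ≤ penForm w w :=
  penForm_comp_nonneg hd monotone_id monotone_id w

theorem abs_penForm_le (hd : d = 2 ∨ d = 3) (w φ : 𝒯.DFun) :
    |penForm w φ| ≤ penForm w w + penForm φ φ := by
  have hd1 := one_le_sub_one hd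
  have h1 : 0 ≤ ((d : ℝ) - 1) / d := div_nonneg (by linarith) (by linarith)
  have h2 := inv_nonneg.2 𝒯.size_nonneg
  rw [penForm, penForm, penForm, abs_mul, abs_of_nonneg (mul_nonneg h1 h2), ← mul_add,
    ← Finset.sum_add_distrib]
  refine mul_le_mul_of_nonneg_left ?_ (mul_nonneg h1 h2)
  refine (Finset.abs_sum_le_sum_abs _ _).trans (Finset.sum_le_sum fun K _ => ?_)
  rw [← Finset.sum_add_distrib]
  refine (Finset.abs_sum_le_sum_abs _ _).trans (Finset.sum_le_sum fun v _ => ?_)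
  have hm : 0 ≤ 𝒯.mInter K v := measureReal_nonneg
  rw [abs_mul, abs_of_nonneg hm, ← mul_add]
  refine mul_le_mul_of_nonneg_left ?_ hm
  rw [abs_le]
  constructor <;> nlinarith [sq_nonneg (w.primal (Sum.inl K) - w.dual v +
    (φ.primal (Sum.inl K) - φ.dual v)), sq_nonneg (w.primal (Sum.inl K) - w.dual v -
    (φ.primal (Sum.inl K) - φ.dual v)), sq_nonneg (w.primal (Sum.inl K) - w.dual v),
    sq_nonneg (φ.primal (Sum.inl K) - φ.dual v)]

theorem penEnergy_eq (hΩ : IsOpen Ω) (hΩb : Bornology.IsBounded Ω) {w : 𝒯.DFun}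
    (hw : VanishesOnBdry w) : penEnergy 𝒯 w = penForm w w :=
  pairWith_pen hΩ hΩb w hw

end Triangulation

/-! ### Bounds on the data -/

/-- `∫ ‖S(t,·)‖_∞ dt` over the `n`-th time interval. -/
def sourceBound {d : ℕ} (Ω : Set (Pt d)) (S : ℝ → Pt d → ℝ) (Δt : ℝ) (n : ℕ) : ℝ :=
  (∫⁻ t in Ioo (((n : ℝ) - 1) * Δt) ((n : ℝ) * Δt), eLpNorm (S t) ∞ (volume.restrict Ω)).toReal

section

variable {d : ℕ} {Ω : Set (Pt d)}

theorem mul_le_of_le_numSteps {T Δt : ℝ} (hT : 0 < T) (hΔ : 0 < Δt) {n : ℕ}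
    (hn : n ≤ numSteps T Δt) : (n : ℝ) * Δt ≤ T := by
  have h := (Nat.le_floor_iff (div_pos hT hΔ).le).1 hn
  rwa [le_div_iff₀ hΔ] at h

theorem Ioo_timeStep_subset {T Δt : ℝ} (hT : 0 < T) (hΔ : 0 < Δt) {n : ℕ}
    (hn : n ∈ Finset.Icc 1 (numSteps T Δt)) :
    Ioo (((n : ℝ) - 1) * Δt) ((n : ℝ) * Δt) ⊆ Ioo 0 T := by
  rw [Finset.mem_Icc] at hn
  have h1 : (1 : ℝ) ≤ n := by exact_mod_cast hn.1
  exact Ioo_subset_Ioo (mul_nonneg (by linarith) hΔ.le) (mul_le_of_le_numSteps hT hΔ hn.2)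

theorem sourceBound_nonneg (S : ℝ → Pt d → ℝ) (Δt : ℝ) (n : ℕ) : 0 ≤ sourceBound Ω S Δt n :=
  ENNReal.toReal_nonneg

theorem sum_sourceBound_le {T Δt : ℝ} (hT : 0 < T) (hΔ : 0 < Δt) {S : ℝ → Pt d → ℝ}
    (hS' : ∫⁻ t in Ioo 0 T, eLpNorm (S t) ∞ (volume.restrict Ω) ≠ ∞) {m : ℕ}
    (hm : m ≤ numSteps T Δt) :
    ∑ n ∈ Finset.Icc 1 m, sourceBound Ω S Δt n ≤
      (∫⁻ t in Ioo 0 T, eLpNorm (S t) ∞ (volume.restrict Ω)).toReal := by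
  have hsub : ∀ n ∈ Finset.Icc 1 m,
      Ioo (((n : ℝ) - 1) * Δt) ((n : ℝ) * Δt) ⊆ Ioo 0 T := fun n hn => by
    rw [Finset.mem_Icc] at hn
    exact Ioo_timeStep_subset hT hΔ (Finset.mem_Icc.2 ⟨hn.1, hn.2.trans hm⟩)
  unfold sourceBound
  rw [← ENNReal.toReal_sum fun n hn => ne_top_of_le_ne_top hS' (lintegral_mono_set (hsub n hn))]
  refine ENNReal.toReal_mono hS' ?_
  rw [← lintegral_biUnion_finset]
  · exact lintegral_mono_set (iUnion₂_subset hsub)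
  · have key : ∀ i j : ℕ, i < j → ∀ t, t < (i : ℝ) * Δt → ¬ ((j : ℝ) - 1) * Δt < t := by
      intro i j h t hi hj
      have h1 : (i : ℝ) + 1 ≤ j := by exact_mod_cast h
      have h2 := mul_le_mul_of_nonneg_right h1 hΔ.le
      nlinarith
    intro i _ j _ hij
    refine Set.disjoint_left.2 fun t hi hj => ?_
    rcases lt_or_gt_of_ne hij with h | h
    · exact key i j h t hi.2 hj.1
    · exact key j i h t hj.2 hi.1
  · exact fun _ _ => measurableSet_Ioo

theorem lintegral_enorm_le {B : Set (Pt d)} (hB : B ⊆ Ω) (φ : Pt d → ℝ) :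
    ∫⁻ x in B, ‖φ x‖ₑ ≤ eLpNorm φ ∞ (volume.restrict Ω) * volume B := by
  rw [eLpNorm_exponent_top, ← setLIntegral_const]
  exact lintegral_mono_ae (ae_mono (Measure.restrict_mono hB le_rfl) ae_le_eLpNormEssSup)

theorem abs_mean_le_of_lintegral_le {B : Set (Pt d)} (hB : volume B ≠ ∞) {φ : Pt d → ℝ} {N : ℝ≥0∞}
    (hN : N ≠ ∞) (h : ∫⁻ x in B, ‖φ x‖ₑ ≤ N * volume B) : |mean B φ| ≤ N.toReal := by
  rw [mean, abs_mul, abs_inv, abs_of_nonneg measureReal_nonneg]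
  have h1 : |∫ x in B, φ x| ≤ N.toReal * volume.real B := by
    rw [measureReal_def, ← ENNReal.toReal_mul, ← Real.norm_eq_abs, ← toReal_enorm]
    exact ENNReal.toReal_mono (ENNReal.mul_ne_top hN hB)
      ((enorm_integral_le_lintegral_enorm _).trans h)
  rcases eq_or_lt_of_le (measureReal_nonneg (μ := volume) (s := B)) with h0 | h0
  · rw [← h0, inv_zero, zero_mul]
    exact ENNReal.toReal_nonneg
  · rw [inv_mul_le_iff₀ h0]
    linarith

theorem abs_mean_le (hΩb : Bornology.IsBounded Ω) {u₀ : Pt d → ℝ}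
    (hu₀ : MemLp u₀ ∞ (volume.restrict Ω)) {B : Set (Pt d)} (hB : B ⊆ Ω) :
    |mean B u₀| ≤ (eLpNorm u₀ ∞ (volume.restrict Ω)).toReal :=
  abs_mean_le_of_lintegral_le
    ((measure_mono hB).trans_lt hΩb.measure_lt_top).ne hu₀.eLpNorm_ne_top (lintegral_enorm_le hB u₀)

/-- The function `t ↦ ‖S(t,·)‖_∞` need not be measurable; only the monotonicity of the lower
integral is used for it, and Tonelli's theorem is applied to `S`, which is measurable on `Q`. -/
theorem abs_mean_timeMean_le (hΩb : Bornology.IsBounded Ω) {T Δt : ℝ} (hT : 0 < T) (hΔ : 0 < Δt)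
    {S : ℝ → Pt d → ℝ}
    (hS : AEStronglyMeasurable (Function.uncurry S)
      ((volume.restrict (Ioo 0 T)).prod (volume.restrict Ω)))
    (hS' : ∫⁻ t in Ioo 0 T, eLpNorm (S t) ∞ (volume.restrict Ω) ≠ ∞)
    {n : ℕ} (hn : n ∈ Finset.Icc 1 (numSteps T Δt)) {B : Set (Pt d)} (hB : B ⊆ Ω) :
    Δt * |mean B (timeMean S Δt n)| ≤ sourceBound Ω S Δt n := by
  have hI := Ioo_timeStep_subset hT hΔ hn
  set I := Ioo (((n : ℝ) - 1) * Δt) ((n : ℝ) * Δt) with hIdef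
  have hBfin : volume B ≠ ∞ := ((measure_mono hB).trans_lt hΩb.measure_lt_top).ne
  have hfin : ∫⁻ t in I, eLpNorm (S t) ∞ (volume.restrict Ω) ≠ ∞ :=
    ne_top_of_le_ne_top hS' (lintegral_mono_set hI)
  have h1 : ∀ x, ‖timeMean S Δt n x‖ₑ ≤ ENNReal.ofReal Δt⁻¹ * ∫⁻ t in I, ‖S t x‖ₑ := by
    intro x
    rw [timeMean, enorm_mul, Real.enorm_of_nonneg (inv_pos.2 hΔ).le,
      intervalIntegral.integral_of_le (by nlinarith), integral_Ioc_eq_integral_Ioo]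
    gcongr
    exact enorm_integral_le_lintegral_enorm _
  have h2 : ∫⁻ x in B, ∫⁻ t in I, ‖S t x‖ₑ ≤
      (∫⁻ t in I, eLpNorm (S t) ∞ (volume.restrict Ω)) * volume B := by
    rw [lintegral_lintegral_swap]
    · rw [← lintegral_mul_const' _ _ hBfin]
      exact lintegral_mono fun t => lintegral_enorm_le hB (S t)
    · have h3 : AEMeasurable (fun q : ℝ × Pt d => ‖S q.1 q.2‖ₑ)
          ((volume.restrict I).prod (volume.restrict B)) :=
        (hS.mono_measure (Measure.prod_mono (Measure.restrict_mono hI le_rfl)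
          (Measure.restrict_mono hB le_rfl))).enorm
      exact h3.prod_swap
  have h4 : ∫⁻ x in B, ‖timeMean S Δt n x‖ₑ ≤
      (ENNReal.ofReal Δt⁻¹ * ∫⁻ t in I, eLpNorm (S t) ∞ (volume.restrict Ω)) * volume B := by
    refine (lintegral_mono h1).trans ?_
    rw [lintegral_const_mul' _ _ ENNReal.ofReal_ne_top, mul_assoc]
    gcongr
  have h5 := abs_mean_le_of_lintegral_le hBfin (ENNReal.mul_ne_top ENNReal.ofReal_ne_top hfin) h4
  rw [ENNReal.toReal_mul, ENNReal.toReal_ofReal (inv_pos.2 hΔ).le, inv_mul_eq_div,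
    le_div_iff₀ hΔ] at h5
  rw [sourceBound, mul_comm]
  exact h5

end

/-! ### The pairing of discrete functions -/

namespace Triangulation

variable {d : ℕ} [NeZero d] {Ω : Set (Pt d)} {𝒯 : Triangulation d Ω}

open Classical in
theorem pairing_le_pairing (hd : d = 2 ∨ d = 3) {a b a' b' : Fin 𝒯.n → ℝ}
    {as bs as' bs' : 𝒯.Vertex → ℝ} (h : ∀ K, a K * b K ≤ a' K * b' K)
    (hs : ∀ v : 𝒯.Vertex, v.1 ∈ Ω → as v * bs v ≤ as' v * bs' v) :
    pairing a as b bs ≤ pairing a' as' b' bs' := by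
  have hd1 := one_le_sub_one hd
  rw [pairing, pairing]
  refine add_le_add (mul_le_mul_of_nonneg_left (Finset.sum_le_sum fun K _ => ?_) (by positivity))
    (mul_le_mul_of_nonneg_left (Finset.sum_le_sum fun v hv => ?_)
      (div_nonneg (by linarith) (by linarith)))
  · rw [mul_assoc, mul_assoc]
    exact mul_le_mul_of_nonneg_left (h K) (𝒯.mCell_pos K).le
  · rw [mul_assoc, mul_assoc]
    exact mul_le_mul_of_nonneg_left (hs v (Finset.mem_filter.1 hv).2) measureReal_nonneg

theorem pairing_congr {a b a' b' : Fin 𝒯.n → ℝ}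
    {as bs as' bs' : 𝒯.Vertex → ℝ} (h : ∀ K, a K * b K = a' K * b' K)
    (hs : ∀ v : 𝒯.Vertex, v.1 ∈ Ω → as v * bs v = as' v * bs' v) :
    pairing a as b bs = pairing a' as' b' bs' := by
  classical
  rw [pairing, pairing]
  congr 2
  · exact Finset.sum_congr rfl fun K _ => by rw [mul_assoc, mul_assoc, h K]
  · exact Finset.sum_congr rfl fun v hv => by
      rw [mul_assoc, mul_assoc, hs v (Finset.mem_filter.1 hv).2]

theorem pairing_add (a b a' : Fin 𝒯.n → ℝ) (as bs as' : 𝒯.Vertex → ℝ) :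
    pairing (fun K => a K + a' K) (fun v => as v + as' v) b bs =
      pairing a as b bs + pairing a' as' b bs := by
  simp only [pairing, mul_add, add_mul, Finset.sum_add_distrib]
  ring

theorem pairing_const_mul (c : ℝ) (a b : Fin 𝒯.n → ℝ) (as bs : 𝒯.Vertex → ℝ) :
    pairing (fun K => c * a K) (fun v => c * as v) b bs = c * pairing a as b bs := by
  simp only [pairing, mul_add, Finset.mul_sum]
  congr 1 <;> exact Finset.sum_congr rfl fun _ _ => by ring

theorem pairing_sub (a b a' : Fin 𝒯.n → ℝ) (as bs as' : 𝒯.Vertex → ℝ) :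
    pairing (fun K => a K - a' K) (fun v => as v - as' v) b bs =
      pairing a as b bs - pairing a' as' b bs := by
  simp only [pairing, mul_sub, sub_mul, Finset.sum_sub_distrib]
  ring

theorem pairing_sub_right (a b b' : Fin 𝒯.n → ℝ) (as bs bs' : 𝒯.Vertex → ℝ) :
    pairing a as (fun K => b K - b' K) (fun v => bs v - bs' v) =
      pairing a as b bs - pairing a as b' bs' := by
  simp only [pairing, mul_sub, Finset.sum_sub_distrib]
  ring

variable (𝒯) in
/-- The integral of a discrete function against the measure `[[·,1]]`. -/
def total (a : Fin 𝒯.n → ℝ) (as : 𝒯.Vertex → ℝ) : ℝ := pairing a as (fun _ => 1) fun _ => 1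

theorem total_const_le (hΩ : IsOpen Ω) (hΩb : Bornology.IsBounded Ω) (hd : d = 2 ∨ d = 3) {c : ℝ}
    (hc : 0 ≤ c) : 𝒯.total (fun _ => c) (fun _ => c) ≤ volume.real Ω * c := by
  classical
  have hd1 := one_le_sub_one hd
  have hd0 : (d : ℝ) ≠ 0 := by linarith
  rw [total, pairing]
  simp only [mul_one, ← Finset.sum_mul]
  have h1 := mul_le_mul_of_nonneg_right (𝒯.sum_mCell_le hΩb) hc
  have h2 := mul_le_mul_of_nonneg_right (𝒯.sum_mDual_le hΩ hΩb
    (Finset.univ.filter fun v : 𝒯.Vertex => v.1 ∈ Ω)) hc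
  calc _ ≤ 1 / (d : ℝ) * (volume.real Ω * c) + ((d : ℝ) - 1) / d * (volume.real Ω * c) := by
        refine add_le_add (mul_le_mul_of_nonneg_left h1 (by positivity))
          (mul_le_mul_of_nonneg_left h2 (div_nonneg (by linarith) (by linarith)))
    _ = _ := by field_simp; ring

open Classical in
theorem eq_zero_of_pairing_nonpos (hΩ : IsOpen Ω) (hΩb : Bornology.IsBounded Ω)
    (hd : d = 2 ∨ d = 3) {a b : Fin 𝒯.n → ℝ} {as bs : 𝒯.Vertex → ℝ} (h : ∀ K, 0 ≤ a K * b K)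
    (hs : ∀ v : 𝒯.Vertex, v.1 ∈ Ω → 0 ≤ as v * bs v) (hle : pairing a as b bs ≤ 0) :
    (∀ K, a K * b K = 0) ∧ ∀ v : 𝒯.Vertex, v.1 ∈ Ω → as v * bs v = 0 := by
  have hd1 := one_le_sub_one hd
  have hc1 : 0 < 1 / (d : ℝ) := div_pos one_pos (by linarith)
  have hc2 : 0 < ((d : ℝ) - 1) / d := div_pos (by linarith) (by linarith)
  rw [pairing] at hle
  have h1 : ∀ K ∈ Finset.univ, 0 ≤ 𝒯.mCell K * a K * b K := fun K _ => by
    rw [mul_assoc]; exact mul_nonneg (𝒯.mCell_pos K).le (h K)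
  have h2 : ∀ v ∈ Finset.univ.filter (fun v : 𝒯.Vertex => v.1 ∈ Ω),
      0 ≤ 𝒯.mDual v * as v * bs v := fun v hv => by
    rw [mul_assoc]; exact mul_nonneg measureReal_nonneg (hs v (Finset.mem_filter.1 hv).2)
  have h3 := mul_nonneg hc1.le (Finset.sum_nonneg h1)
  have h4 := mul_nonneg hc2.le (Finset.sum_nonneg h2)
  have h5 := (mul_eq_zero.1 (le_antisymm (by linarith) h3)).resolve_left hc1.ne'
  have h6 := (mul_eq_zero.1 (le_antisymm (by linarith) h4)).resolve_left hc2.ne'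
  refine ⟨fun K => ?_, fun v hv => ?_⟩
  · have := (Finset.sum_eq_zero_iff_of_nonneg h1).1 h5 K (Finset.mem_univ _)
    rw [mul_assoc] at this
    exact (mul_eq_zero.1 this).resolve_left (𝒯.mCell_pos K).ne'
  · have := (Finset.sum_eq_zero_iff_of_nonneg h2).1 h6 v (by simp [hv])
    rw [mul_assoc] at this
    exact (mul_eq_zero.1 this).resolve_left (𝒯.mDual_pos hΩ hΩb hv).ne'

end Triangulation

/-! ### The scheme in weak form and the maximum principle -/

/-- The hypotheses on the data of the continuous problem. -/
structure IsProblem {d : ℕ} (Ω : Set (Pt d)) (T : ℝ) (u₀ : Pt d → ℝ) (S : ℝ → Pt d → ℝ)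
    (p c : ℝ) (k : Pt d → ℝ) (A : ℝ → ℝ) (f : ℝ → Pt d) (ω : ℝ → ℝ) : Prop where
  dim : d = 2 ∨ d = 3
  isOpen : IsOpen Ω
  bounded : Bornology.IsBounded Ω
  time_pos : 0 < T
  init : MemLp u₀ ∞ (volume.restrict Ω)
  source : AEStronglyMeasurable (Function.uncurry S)
    ((volume.restrict (Ioo 0 T)).prod (volume.restrict Ω))
  source_fin : ∫⁻ t in Ioo 0 T, eLpNorm (S t) ∞ (volume.restrict Ω) ≠ ∞
  diffusion : IsDiffusion p c k
  cont_A : Continuous A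
  mono_A : Monotone A
  zero_A : A 0 = 0
  cont_f : Continuous f
  zero_f : f 0 = 0
  modulus : IsModulusOn f (dataBound Ω T u₀ S) ω

/-- The hypotheses on the mesh, the numerical fluxes and the discrete solution. -/
structure IsScheme {d : ℕ} [NeZero d] {Ω : Set (Pt d)} (𝒯 : Triangulation d Ω) (T Δt : ℝ)
    (u₀ : Pt d → ℝ) (S : ℝ → Pt d → ℝ) (k : Pt d → ℝ) (A : ℝ → ℝ) (f : ℝ → Pt d) (ω : ℝ → ℝ)
    (c' : ℝ) (g : 𝒯.PFlux) (gs : 𝒯.DFlux) (u : ℕ → 𝒯.DFun) : Prop where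
  mesh : 𝒯.IsDDFV
  step_pos : 0 < Δt
  flux : ∀ D : 𝒯.Interface, IsNumFlux f (dataBound Ω T u₀ S) ω c' (𝒯.normal D)
    (g (Sum.inl D.K) D.L) (g D.L (Sum.inl D.K))
  dual_flux : ∀ v w, 𝒯.DualNbr v w → IsNumFlux f (dataBound Ω T u₀ S) ω c'
    (𝒯.dualNormal v w) (gs v w) (gs w v)
  solution : IsDiscreteSolution 𝒯 T Δt u₀ S k A g gs u

open Triangulation

section

variable {d : ℕ} [NeZero d] {Ω : Set (Pt d)} {𝒯 : Triangulation d Ω} {T Δt : ℝ}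
  {u₀ : Pt d → ℝ} {S : ℝ → Pt d → ℝ} {p c : ℝ} {k : Pt d → ℝ} {A : ℝ → ℝ} {f : ℝ → Pt d}
  {ω : ℝ → ℝ} {c' : ℝ} {g : 𝒯.PFlux} {gs : 𝒯.DFlux} {u : ℕ → 𝒯.DFun}

/-- The increment of the solution during the `n`-th time step, tested with `φ`. -/
def incrPair (u : ℕ → 𝒯.DFun) (n : ℕ) (φ : 𝒯.DFun) : ℝ :=
  𝒯.pairWith (fun K => (u n).primal (Sum.inl K) - (u (n - 1)).primal (Sum.inl K))
    (fun v => (u n).dual v - (u (n - 1)).dual v) φ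

/-- The source during the `n`-th time step, tested with `φ`. -/
def sourcePair (S : ℝ → Pt d → ℝ) (Δt : ℝ) (n : ℕ) (φ : 𝒯.DFun) : ℝ :=
  𝒯.pairWith (fun K => Δt * mean (𝒯.simplex K).interior (timeMean S Δt n))
    (fun v => Δt * mean (𝒯.dualCell v) (timeMean S Δt n)) φ

/-- The diffusion form `[[-div 𝔞(∇w), φ]]`. -/
def diffForm (k : Pt d → ℝ) (w φ : 𝒯.DFun) : ℝ :=
  divForm (fun D => k (grad w D) • grad w D) φ

theorem IsScheme.vanishes (hP : IsProblem Ω T u₀ S p c k A f ω)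
    (h : IsScheme 𝒯 T Δt u₀ S k A f ω c' g gs u) {n : ℕ} (hn : n ∈ Finset.Icc 1 (numSteps T Δt)) :
    VanishesOnBdry (u n) :=
  ⟨h.solution.bdry_primal n hn,
    fun v hv => h.solution.bdry_dual n hn v (𝒯.vertex_mem_frontier hP.isOpen hv)⟩

/-- The scheme in weak form. -/
theorem IsScheme.weak (hP : IsProblem Ω T u₀ S p c k A f ω)
    (h : IsScheme 𝒯 T Δt u₀ S k A f ω c' g gs u) {n : ℕ} (hn : n ∈ Finset.Icc 1 (numSteps T Δt))
    {φ : 𝒯.DFun} (hφ : VanishesOnBdry φ) :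
    incrPair u n φ + Δt * (convForm g gs (u n) φ + diffForm k ((u n).comp A) φ +
      penForm ((u n).comp A) φ) = sourcePair S Δt n φ := by
  have hΔ := h.step_pos
  have h1 := pairWith_conv hP.isOpen hP.bounded (fun D => (h.flux D).conservative)
    (fun v w hvw => (h.dual_flux v w hvw).conservative) (u n) hφ
  have h2 := pairWith_div hP.isOpen hP.bounded
    (fun D => k (grad ((u n).comp A) D) • grad ((u n).comp A) D) hφ
  have h3 := pairWith_pen hP.isOpen hP.bounded ((u n).comp A) hφ
  have h4 : diffForm k ((u n).comp A) φ = - 𝒯.pairWith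
      (divPrimal fun D => k (grad ((u n).comp A) D) • grad ((u n).comp A) D)
      (divDual fun D => k (grad ((u n).comp A) D) • grad ((u n).comp A) D) φ := by
    rw [h2, neg_neg, diffForm]
  rw [← h1, ← h3, h4, ← sub_eq_add_neg, incrPair, sourcePair]
  unfold pairWith
  rw [← pairing_sub, ← pairing_add, ← pairing_const_mul, ← pairing_add]
  refine pairing_congr (fun K => ?_) fun v hv => ?_
  · rw [← h.solution.eq_primal n hn K]
    field_simp
    ring
  · rw [← h.solution.eq_dual n hn v hv]
    field_simp
    ring

/-- A bound for the values of the solution at the `n`-th time step. -/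
def stepBound (Ω : Set (Pt d)) (u₀ : Pt d → ℝ) (S : ℝ → Pt d → ℝ) (Δt : ℝ) (n : ℕ) : ℝ :=
  (eLpNorm u₀ ∞ (volume.restrict Ω)).toReal + ∑ i ∈ Finset.Icc 1 n, sourceBound Ω S Δt i

theorem stepBound_nonneg (n : ℕ) : 0 ≤ stepBound Ω u₀ S Δt n :=
  add_nonneg ENNReal.toReal_nonneg (Finset.sum_nonneg fun _ _ => sourceBound_nonneg _ _ _)

theorem stepBound_le (hP : IsProblem Ω T u₀ S p c k A f ω) (hΔ : 0 < Δt) {n : ℕ}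
    (hn : n ≤ numSteps T Δt) : stepBound Ω u₀ S Δt n ≤ dataBound Ω T u₀ S :=
  add_le_add le_rfl (sum_sourceBound_le hP.time_pos hΔ hP.source_fin hn)

theorem dataBound_nonneg : 0 ≤ dataBound Ω T u₀ S :=
  add_nonneg ENNReal.toReal_nonneg ENNReal.toReal_nonneg

/-- The monotone test function `sign(z)` on `|z| > κ`, zero elsewhere. -/
def truncSign (κ : ℝ) (z : ℝ) : ℝ := (if κ < z then 1 else 0) + if z < -κ then -1 else 0

theorem monotone_truncSign (κ : ℝ) : Monotone (truncSign κ) := by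
  intro a b hab
  unfold truncSign
  split_ifs <;> linarith

theorem truncSign_zero {κ : ℝ} (hκ : 0 ≤ κ) : truncSign κ 0 = 0 := by
  rw [truncSign, if_neg hκ.not_gt, if_neg (by linarith), add_zero]

/-- If `y` and `s` are the old value and the source, of total size at most `κ`, then `x - y - s`
has the sign of `x` as soon as `|x| > κ`. -/
theorem sub_mul_truncSign_nonneg {κ x y s : ℝ} (hκ : 0 ≤ κ) (hxy : |y| + |s| ≤ κ) :
    0 ≤ (x - y - s) * truncSign κ x := by
  have hy := abs_le.1 (le_refl |y|)
  have hs := abs_le.1 (le_refl |s|)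
  unfold truncSign
  split_ifs
  · linarith
  · nlinarith
  · nlinarith
  · simp

theorem abs_le_of_sub_mul_truncSign_eq_zero {κ x y s : ℝ} (hκ : 0 ≤ κ) (hxy : |y| + |s| ≤ κ)
    (h : (x - y - s) * truncSign κ x = 0) : |x| ≤ κ := by
  have hy := abs_le.1 (le_refl |y|)
  have hs := abs_le.1 (le_refl |s|)
  by_contra hx
  rw [not_le, lt_abs] at hx
  unfold truncSign at h
  rcases hx with hx | hx
  · rw [if_pos hx, if_neg (by linarith)] at h
    linarith
  · rw [if_neg (by linarith), if_pos (by linarith)] at h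
    linarith

theorem IsScheme.abs_source_le (hP : IsProblem Ω T u₀ S p c k A f ω)
    (h : IsScheme 𝒯 T Δt u₀ S k A f ω c' g gs u) {n : ℕ} (hn : n ∈ Finset.Icc 1 (numSteps T Δt))
    {B : Set (Pt d)} (hB : B ⊆ Ω) :
    |Δt * mean B (timeMean S Δt n)| ≤ sourceBound Ω S Δt n := by
  rw [abs_mul, abs_of_pos h.step_pos]
  exact abs_mean_timeMean_le hP.bounded hP.time_pos h.step_pos hP.source hP.source_fin hn hB

/-- The maximum principle, by induction on the time step. -/
theorem IsScheme.abs_le_stepBound (hP : IsProblem Ω T u₀ S p c k A f ω)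
    (h : IsScheme 𝒯 T Δt u₀ S k A f ω c' g gs u) (n : ℕ) (hn : n ≤ numSteps T Δt) :
    (∀ K, |(u n).primal (Sum.inl K)| ≤ stepBound Ω u₀ S Δt n) ∧
      ∀ v : 𝒯.Vertex, v.1 ∈ Ω → |(u n).dual v| ≤ stepBound Ω u₀ S Δt n := by
  induction n with
  | zero =>
    simp only [stepBound, Finset.Icc_eq_empty_of_lt zero_lt_one, Finset.sum_empty, add_zero]
    refine ⟨fun K => ?_, fun v hv => ?_⟩
    · rw [h.solution.init_primal K]
      exact abs_mean_le hP.bounded hP.init (𝒯.interior_subset K)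
    · rw [h.solution.init_dual v hv]
      exact abs_mean_le hP.bounded hP.init (𝒯.dualCell_subset v)
  | succ n ih =>
    obtain ⟨ih1, ih2⟩ := ih (Nat.le_of_succ_le hn)
    have hn' : n + 1 ∈ Finset.Icc 1 (numSteps T Δt) := Finset.mem_Icc.2 ⟨by omega, hn⟩
    set κ := stepBound Ω u₀ S Δt (n + 1) with hκdef
    have hκ : 0 ≤ κ := stepBound_nonneg _
    have hκ' : κ = stepBound Ω u₀ S Δt n + sourceBound Ω S Δt (n + 1) := by
      rw [hκdef, stepBound, stepBound, Finset.sum_Icc_succ_top (by omega), add_assoc]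
    have hu := h.vanishes hP hn'
    set φ := (u (n + 1)).comp (truncSign κ) with hφdef
    have hφ : VanishesOnBdry φ := hu.comp (truncSign_zero hκ)
    have hw := h.weak hP hn' hφ
    -- all the terms other than the increment and the source are nonnegative
    have h1 : 0 ≤ convForm g gs (u (n + 1)) φ :=
      convForm_comp_nonneg hP.isOpen hP.dim h.mesh h.flux h.dual_flux
        ((IsEntropyFlux.step_pos hκ).add (IsEntropyFlux.step_neg hκ)) hu
    have h2 : 0 ≤ diffForm k ((u (n + 1)).comp A) φ :=
      divForm_comp_nonneg hP.dim h.mesh hP.diffusion hP.mono_A (monotone_truncSign κ) _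
    have h3 : 0 ≤ penForm ((u (n + 1)).comp A) φ :=
      penForm_comp_nonneg hP.dim hP.mono_A (monotone_truncSign κ) _
    have h4 : incrPair u (n + 1) φ - sourcePair S Δt (n + 1) φ ≤ 0 := by
      have := mul_nonneg h.step_pos.le (add_nonneg (add_nonneg h1 h2) h3)
      linarith
    rw [incrPair, sourcePair, pairWith, pairWith, ← pairing_sub] at h4
    have hs1 : ∀ K, |(u n).primal (Sum.inl K)| +
        |Δt * mean (𝒯.simplex K).interior (timeMean S Δt (n + 1))| ≤ κ := fun K => by
      rw [hκ']
      exact add_le_add (ih1 K) (h.abs_source_le hP hn' (𝒯.interior_subset K))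
    have hs2 : ∀ v : 𝒯.Vertex, v.1 ∈ Ω → |(u n).dual v| +
        |Δt * mean (𝒯.dualCell v) (timeMean S Δt (n + 1))| ≤ κ := fun v hv => by
      rw [hκ']
      exact add_le_add (ih2 v hv) (h.abs_source_le hP hn' (𝒯.dualCell_subset v))
    obtain ⟨h5, h6⟩ := eq_zero_of_pairing_nonpos hP.isOpen hP.bounded hP.dim
      (fun K => sub_mul_truncSign_nonneg hκ (hs1 K))
      (fun v hv => sub_mul_truncSign_nonneg hκ (hs2 v hv)) h4
    exact ⟨fun K => abs_le_of_sub_mul_truncSign_eq_zero hκ (hs1 K) (h5 K),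
      fun v hv => abs_le_of_sub_mul_truncSign_eq_zero hκ (hs2 v hv) (h6 v hv)⟩

theorem IsScheme.abs_primal_le (hP : IsProblem Ω T u₀ S p c k A f ω)
    (h : IsScheme 𝒯 T Δt u₀ S k A f ω c' g gs u) {n : ℕ} (hn : n ≤ numSteps T Δt) (K : Fin 𝒯.n) :
    |(u n).primal (Sum.inl K)| ≤ dataBound Ω T u₀ S :=
  ((h.abs_le_stepBound hP n hn).1 K).trans (stepBound_le hP h.step_pos hn)

theorem IsScheme.abs_dual_le (hP : IsProblem Ω T u₀ S p c k A f ω)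
    (h : IsScheme 𝒯 T Δt u₀ S k A f ω c' g gs u) {n : ℕ} (hn : n ≤ numSteps T Δt)
    {v : 𝒯.Vertex} (hv : v.1 ∈ Ω) : |(u n).dual v| ≤ dataBound Ω T u₀ S :=
  ((h.abs_le_stepBound hP n hn).2 v hv).trans (stepBound_le hP h.step_pos hn)

end

/-! ### Energy estimates -/

open Triangulation

theorem sum_Icc_sub_pred (b : ℕ → ℝ) (m : ℕ) :
    ∑ n ∈ Finset.Icc 1 m, (b n - b (n - 1)) = b m - b 0 := by
  induction m with
  | zero => simp
  | succ m ih =>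
    rw [Finset.sum_Icc_succ_top (by omega), ih, Nat.add_sub_cancel]
    ring

section

variable {θ : ℝ → ℝ}

theorem abs_le_of_monotone (hθ' : Monotone θ) (hθ0 : θ 0 = 0) {M z : ℝ} (hz : |z| ≤ M) :
    |θ z| ≤ θ M - θ (-M) := by
  have hM := (abs_nonneg z).trans hz
  obtain ⟨h1, h2⟩ := abs_le.1 hz
  have h3 := hθ' h1
  have h4 := hθ' h2
  have h5 := hθ' hM
  have h6 := hθ' (neg_nonpos.2 hM)
  rw [abs_le]
  constructor <;> linarith

/-- The primitive of `θ` that vanishes at `0`. -/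
def primitive (θ : ℝ → ℝ) (z : ℝ) : ℝ := ∫ s in (0 : ℝ)..z, θ s

theorem primitive_sub_le (hθ : Continuous θ) (hθ' : Monotone θ) (x y : ℝ) :
    primitive θ x - primitive θ y ≤ (x - y) * θ x := by
  rw [primitive, primitive, intervalIntegral.integral_interval_sub_left
    (hθ.intervalIntegrable _ _) (hθ.intervalIntegrable _ _)]
  rcases le_total y x with h | h
  · have := intervalIntegral.integral_mono_on (μ := volume) h (hθ.intervalIntegrable y x)
      (_root_.intervalIntegrable_const (c := θ x)) fun s hs => hθ' hs.2
    rwa [intervalIntegral.integral_const, smul_eq_mul] at this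
  · have := intervalIntegral.integral_mono_on (μ := volume) h (_root_.intervalIntegrable_const (c := θ x))
      (hθ.intervalIntegrable x y) fun s hs => hθ' hs.1
    rw [intervalIntegral.integral_const, smul_eq_mul] at this
    rw [intervalIntegral.integral_symm]
    linarith

theorem primitive_nonneg (hθ : Continuous θ) (hθ' : Monotone θ) (hθ0 : θ 0 = 0) (z : ℝ) :
    0 ≤ primitive θ z := by
  have := primitive_sub_le hθ hθ' 0 z
  rw [hθ0, mul_zero, primitive, intervalIntegral.integral_same] at this
  linarith

theorem primitive_le (hθ : Continuous θ) (hθ' : Monotone θ) (hθ0 : θ 0 = 0) {M z : ℝ}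
    (hz : |z| ≤ M) : primitive θ z ≤ M * (θ M - θ (-M)) := by
  have h := primitive_sub_le hθ hθ' z 0
  rw [primitive, primitive, intervalIntegral.integral_same, sub_zero, sub_zero] at h
  calc primitive θ z ≤ |z * θ z| := h.trans (le_abs_self _)
    _ = |z| * |θ z| := abs_mul _ _
    _ ≤ M * (θ M - θ (-M)) := mul_le_mul hz (abs_le_of_monotone hθ' hθ0 hz) (abs_nonneg _)
      ((abs_nonneg z).trans hz)

end

section

variable {d : ℕ} [NeZero d] {Ω : Set (Pt d)} {𝒯 : Triangulation d Ω} {T Δt : ℝ}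
  {u₀ : Pt d → ℝ} {S : ℝ → Pt d → ℝ} {p c : ℝ} {k : Pt d → ℝ} {A : ℝ → ℝ} {f : ℝ → Pt d}
  {ω : ℝ → ℝ} {c' : ℝ} {g : 𝒯.PFlux} {gs : 𝒯.DFlux} {u : ℕ → 𝒯.DFun}

theorem IsScheme.abs_sourcePair_le (hP : IsProblem Ω T u₀ S p c k A f ω)
    (h : IsScheme 𝒯 T Δt u₀ S k A f ω c' g gs u) {n : ℕ} (hn : n ∈ Finset.Icc 1 (numSteps T Δt))
    {φ : 𝒯.DFun} {m : ℝ} (hm : 0 ≤ m) (hφ : ∀ K, |φ.primal (Sum.inl K)| ≤ m)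
    (hφ' : ∀ v : 𝒯.Vertex, v.1 ∈ Ω → |φ.dual v| ≤ m) :
    |sourcePair S Δt n φ| ≤ volume.real Ω * (sourceBound Ω S Δt n * m) := by
  have hs := sourceBound_nonneg (Ω := Ω) S Δt n
  have h1 : ∀ K, |Δt * mean (𝒯.simplex K).interior (timeMean S Δt n) * φ.primal (Sum.inl K)| ≤
      sourceBound Ω S Δt n * m := fun K => by
    rw [abs_mul]
    exact mul_le_mul (h.abs_source_le hP hn (𝒯.interior_subset K)) (hφ K) (abs_nonneg _) hs
  have h2 : ∀ v : 𝒯.Vertex, v.1 ∈ Ω →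
      |Δt * mean (𝒯.dualCell v) (timeMean S Δt n) * φ.dual v| ≤
      sourceBound Ω S Δt n * m := fun v hv => by
    rw [abs_mul]
    exact mul_le_mul (h.abs_source_le hP hn (𝒯.dualCell_subset v)) (hφ' v hv) (abs_nonneg _) hs
  have h3 := total_const_le (𝒯 := 𝒯) hP.isOpen hP.bounded hP.dim (mul_nonneg hs hm)
  rw [abs_le]
  constructor
  · refine le_trans (neg_le_neg h3) ?_
    have e : -𝒯.total (fun _ => sourceBound Ω S Δt n * m) (fun _ => sourceBound Ω S Δt n * m) =
        pairing (𝒯 := 𝒯) (fun _ => -1 * (sourceBound Ω S Δt n * m))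
          (fun _ => -1 * (sourceBound Ω S Δt n * m)) (fun _ => 1) fun _ => 1 := by
      rw [pairing_const_mul, total]; ring
    rw [e]
    refine pairing_le_pairing hP.dim (fun K => ?_) fun v hv => ?_
    · have := (abs_le.1 (h1 K)).1
      linarith
    · have := (abs_le.1 (h2 v hv)).1
      linarith
  · refine le_trans ?_ h3
    refine pairing_le_pairing hP.dim (fun K => ?_) fun v hv => ?_
    · have := (abs_le.1 (h1 K)).2
      linarith
    · have := (abs_le.1 (h2 v hv)).2
      linarith

/-- The energy estimate obtained by testing the scheme with a monotone function of the solution. -/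
theorem IsScheme.energy (hP : IsProblem Ω T u₀ S p c k A f ω)
    (h : IsScheme 𝒯 T Δt u₀ S k A f ω c' g gs u) {θ : ℝ → ℝ} (hθ : Continuous θ)
    (hθ' : Monotone θ) (hθ0 : θ 0 = 0) :
    ∑ n ∈ Finset.Icc 1 (numSteps T Δt), Δt * (convForm g gs (u n) ((u n).comp θ) +
      diffForm k ((u n).comp A) ((u n).comp θ) + penForm ((u n).comp A) ((u n).comp θ)) ≤
      volume.real Ω * (2 * dataBound Ω T u₀ S *
        (θ (dataBound Ω T u₀ S) - θ (-dataBound Ω T u₀ S))) := by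
  set M := dataBound Ω T u₀ S with hM
  have hM0 : 0 ≤ M := dataBound_nonneg
  set m := θ M - θ (-M) with hm
  have hm0 : 0 ≤ m := sub_nonneg.2 (hθ' (by linarith))
  set b : ℕ → ℝ := fun n => 𝒯.total (fun K => primitive θ ((u n).primal (Sum.inl K)))
    (fun v => primitive θ ((u n).dual v)) with hb
  have h1 : ∀ n ∈ Finset.Icc 1 (numSteps T Δt),
      Δt * (convForm g gs (u n) ((u n).comp θ) +
        diffForm k ((u n).comp A) ((u n).comp θ) + penForm ((u n).comp A) ((u n).comp θ)) ≤
      volume.real Ω * m * sourceBound Ω S Δt n - (b n - b (n - 1)) := by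
    intro n hn
    have hn2 := (Finset.mem_Icc.1 hn).2
    have hw := h.weak hP hn ((h.vanishes hP hn).comp hθ0)
    have hs := (le_abs_self _).trans (h.abs_sourcePair_le hP hn (φ := (u n).comp θ) hm0
      (fun K => abs_le_of_monotone hθ' hθ0 (h.abs_primal_le hP hn2 K))
      (fun v hv => abs_le_of_monotone hθ' hθ0 (h.abs_dual_le hP hn2 hv)))
    have hi : b n - b (n - 1) ≤ incrPair u n ((u n).comp θ) := by
      rw [hb]
      simp only [total]
      rw [← pairing_sub]
      refine pairing_le_pairing hP.dim (fun K => ?_) fun v hv => ?_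
      · rw [mul_one]
        exact primitive_sub_le hθ hθ' _ _
      · rw [mul_one]
        exact primitive_sub_le hθ hθ' _ _
    linarith
  have h2 : b 0 ≤ volume.real Ω * (M * m) := by
    refine le_trans ?_ (total_const_le (𝒯 := 𝒯) hP.isOpen hP.bounded hP.dim (mul_nonneg hM0 hm0))
    refine pairing_le_pairing hP.dim (fun K => ?_) fun v hv => ?_
    · rw [mul_one, mul_one]
      exact primitive_le hθ hθ' hθ0 (h.abs_primal_le hP (Nat.zero_le _) K)
    · rw [mul_one, mul_one]
      exact primitive_le hθ hθ' hθ0 (h.abs_dual_le hP (Nat.zero_le _) hv)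
  have h3 : 0 ≤ b (numSteps T Δt) := by
    have e : (0 : ℝ) = pairing (𝒯 := 𝒯) (fun _ => 0) (fun _ => 0) (fun _ => 1) fun _ => 1 := by
      simp [pairing]
    rw [e]
    refine pairing_le_pairing hP.dim (fun K => ?_) fun v hv => ?_
    · rw [mul_one, mul_one]
      exact primitive_nonneg hθ hθ' hθ0 _
    · rw [mul_one, mul_one]
      exact primitive_nonneg hθ hθ' hθ0 _
  have h4 : ∑ n ∈ Finset.Icc 1 (numSteps T Δt), sourceBound Ω S Δt n ≤ M :=
    (le_add_of_nonneg_left ENNReal.toReal_nonneg).trans (stepBound_le hP h.step_pos le_rfl)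
  refine (Finset.sum_le_sum h1).trans ?_
  rw [Finset.sum_sub_distrib, sum_Icc_sub_pred, ← Finset.mul_sum]
  have h5 := mul_le_mul_of_nonneg_left h4 (mul_nonneg (measureReal_nonneg (μ := volume) (s := Ω))
    hm0)
  linarith

/-- The `p`-energy of the discrete gradient. -/
def gradEnergy (p : ℝ) (w : 𝒯.DFun) : ℝ := ∑ D, 𝒯.mDiamond D * ‖grad w D‖ ^ p

theorem IsScheme.gradEnergy_nonneg (hP : IsProblem Ω T u₀ S p c k A f ω)
    (h : IsScheme 𝒯 T Δt u₀ S k A f ω c' g gs u) (w : 𝒯.DFun) : 0 ≤ gradEnergy p w :=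
  Finset.sum_nonneg fun D _ => mul_nonneg (mDiamond_pos hP.dim h.mesh D).le
    (Real.rpow_nonneg (norm_nonneg _) _)

/-- The bound of the energy estimate for `θ = A`. -/
def energyBound (Ω : Set (Pt d)) (A : ℝ → ℝ) (M : ℝ) : ℝ := volume.real Ω * (2 * M * (A M - A (-M)))

theorem IsScheme.diffusion_bounds (hP : IsProblem Ω T u₀ S p c k A f ω)
    (h : IsScheme 𝒯 T Δt u₀ S k A f ω c' g gs u) :
    ∑ n ∈ Finset.Icc 1 (numSteps T Δt), Δt * gradEnergy p ((u n).comp A) ≤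
        c * energyBound Ω A (dataBound Ω T u₀ S) ∧
      ∑ n ∈ Finset.Icc 1 (numSteps T Δt), Δt * penForm ((u n).comp A) ((u n).comp A) ≤
        energyBound Ω A (dataBound Ω T u₀ S) := by
  have hE := h.energy hP hP.cont_A hP.mono_A hP.zero_A
  have hc := hP.diffusion.pos
  have hΔ := h.step_pos
  obtain ⟨F, hF⟩ := IsEntropyFlux.exists_of_monotone hP.cont_f hP.cont_A hP.mono_A
  have h1 : ∀ n ∈ Finset.Icc 1 (numSteps T Δt),
      0 ≤ convForm g gs (u n) ((u n).comp A) := fun n hn =>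
    convForm_comp_nonneg hP.isOpen hP.dim h.mesh h.flux h.dual_flux hF (h.vanishes hP hn)
  have h2 : ∀ n, 1 / c * gradEnergy p ((u n).comp A) ≤
      diffForm k ((u n).comp A) ((u n).comp A) := fun n =>
    le_divForm_self hP.dim h.mesh hP.diffusion _
  have h3 : ∀ n, 0 ≤ penForm ((u n).comp A) ((u n).comp A) := fun n =>
    penForm_self_nonneg hP.dim _
  have h4 : ∀ n, 0 ≤ gradEnergy p ((u n).comp A) := fun n => h.gradEnergy_nonneg hP _
  constructor
  · rw [← div_le_iff₀' hc, div_eq_inv_mul, ← one_div, Finset.mul_sum]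
    refine (Finset.sum_le_sum fun n hn => ?_).trans hE
    rw [mul_left_comm]
    refine mul_le_mul_of_nonneg_left ?_ hΔ.le
    linarith [h1 n hn, h2 n, h3 n]
  · refine (Finset.sum_le_sum fun n hn => ?_).trans hE
    refine mul_le_mul_of_nonneg_left ?_ hΔ.le
    have := mul_nonneg (one_div_nonneg.2 hc.le) (h4 n)
    linarith [h1 n hn, h2 n, h3 n]

theorem IsScheme.convection_bound (hP : IsProblem Ω T u₀ S p c k A f ω)
    (h : IsScheme 𝒯 T Δt u₀ S k A f ω c' g gs u) :
    ∑ n ∈ Finset.Icc 1 (numSteps T Δt), Δt * (dissPrimal g (u n) + dissDual gs (u n)) ≤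
      energyBound Ω id (dataBound Ω T u₀ S) := by
  refine (Finset.sum_le_sum fun n hn => ?_).trans (h.energy hP continuous_id monotone_id rfl)
  rw [convForm_self hP.isOpen hP.dim h.mesh hP.cont_f h.flux h.dual_flux (h.vanishes hP hn)]
  refine mul_le_mul_of_nonneg_left ?_ h.step_pos.le
  have h1 : 0 ≤ diffForm k ((u n).comp A) ((u n).comp id) :=
    divForm_comp_nonneg hP.dim h.mesh hP.diffusion hP.mono_A monotone_id _
  have h2 : 0 ≤ penForm ((u n).comp A) ((u n).comp id) :=
    penForm_comp_nonneg hP.dim hP.mono_A monotone_id _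
  change _ ≤ convForm g gs (u n) (u n) + _ + _
  linarith

/-! ### Time translates -/

variable (Δt) in
/-- The part of the bound of `[[u^j - u^{j-1}, w^m]]` that depends on the time step `j`; `B` bounds
the values of `w`. -/
def incrBound (Ω : Set (Pt d)) (S : ℝ → Pt d → ℝ) (p c B : ℝ) (w : ℕ → 𝒯.DFun) (j : ℕ) : ℝ :=
  Δt * (c * gradEnergy p (w j) + penForm (w j) (w j)) + volume.real Ω * (sourceBound Ω S Δt j * B)

variable (Δt) in
/-- The part of the bound of `[[u^j - u^{j-1}, w^m]]` that depends on the test function `w^m`; `W`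
bounds the numerical fluxes and `V` the total volume of the diamonds. -/
def testBound (p c W V : ℝ) (w : ℕ → 𝒯.DFun) (m : ℕ) : ℝ :=
  Δt * (W * d * (V + gradEnergy p (w m)) + c * gradEnergy p (w m) + penForm (w m) (w m))

/-- A discrete form of the bound of `∂ₜu` in the dual of the energy space. -/
theorem IsScheme.abs_incrPair_le (hP : IsProblem Ω T u₀ S p c k A f ω)
    (h : IsScheme 𝒯 T Δt u₀ S k A f ω c' g gs u) {W : ℝ} (hW0 : 0 ≤ W)
    (hW : ∀ z ∈ Icc 0 (2 * dataBound Ω T u₀ S), |ω z| ≤ W) {j m : ℕ}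
    (hj : j ∈ Finset.Icc 1 (numSteps T Δt)) (hm : m ∈ Finset.Icc 1 (numSteps T Δt)) :
    |incrPair u j ((u m).comp A)| ≤
      incrBound Δt Ω S p c (A (dataBound Ω T u₀ S) - A (-dataBound Ω T u₀ S))
        (fun n => (u n).comp A) j +
      testBound Δt p c (|c'| * (2 * W)) (volume.real Ω / volume.real (stdCorner d))
        (fun n => (u n).comp A) m := by
  have hj2 := (Finset.mem_Icc.1 hj).2
  have hm2 := (Finset.mem_Icc.1 hm).2
  have hv := h.vanishes hP hj
  have hM : 0 ≤ dataBound Ω T u₀ S := dataBound_nonneg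
  have hΔ := h.step_pos
  have hw := h.weak hP hj ((h.vanishes hP hm).comp hP.zero_A)
  have hB : 0 ≤ A (dataBound Ω T u₀ S) - A (-dataBound Ω T u₀ S) :=
    sub_nonneg.2 (hP.mono_A (by linarith))
  have hs := h.abs_sourcePair_le hP hj (φ := (u m).comp A) hB
      (fun K => abs_le_of_monotone hP.mono_A hP.zero_A (h.abs_primal_le hP hm2 K))
      (fun v hv => abs_le_of_monotone hP.mono_A hP.zero_A (h.abs_dual_le hP hm2 hv))
  have hpr : ∀ K, |(u j).primal K| ≤ dataBound Ω T u₀ S := by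
    rintro (K | e)
    · exact h.abs_primal_le hP hj2 K
    · rw [hv.primal, abs_zero]; exact hM
  have hdu : ∀ v, |(u j).dual v| ≤ dataBound Ω T u₀ S := by
    intro v
    by_cases hvΩ : v.1 ∈ Ω
    · exact h.abs_dual_le hP hj2 hvΩ
    · rw [hv.dual v hvΩ, abs_zero]; exact hM
  have h1 := abs_convForm_le hP.dim h.mesh (u := u j) (W := |c'| * (2 * W))
    (fun D => (h.flux D).abs_apply_le hP.zero_f hW (hpr _) (hpr _))
    (fun v w hvw => (h.dual_flux v w hvw).abs_apply_le hP.zero_f hW (hdu _) (hdu _))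
    ((u m).comp A)
  have h2 := sum_mDiamond_norm_grad_le hP.isOpen hP.bounded hP.dim h.mesh hP.diffusion.one_lt
    ((u m).comp A)
  have h3 := mul_le_mul_of_nonneg_left h2 (by positivity : 0 ≤ |c'| * (2 * W) * d)
  have h4 := abs_divForm_le hP.dim h.mesh hP.diffusion ((u j).comp A) ((u m).comp A)
  have h5 := abs_penForm_le hP.dim ((u j).comp A) ((u m).comp A)
  have h6 : |convForm g gs (u j) ((u m).comp A) + diffForm k ((u j).comp A) ((u m).comp A) +
      penForm ((u j).comp A) ((u m).comp A)| ≤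
      |c'| * (2 * W) * d * (volume.real Ω / volume.real (stdCorner d) +
        gradEnergy p ((u m).comp A)) +
      c * (gradEnergy p ((u j).comp A) + gradEnergy p ((u m).comp A)) +
      (penForm ((u j).comp A) ((u j).comp A) + penForm ((u m).comp A) ((u m).comp A)) :=
    (abs_add_three _ _ _).trans (add_le_add_three (h1.trans h3) h4 h5)
  have h7 := mul_le_mul_of_nonneg_left h6 hΔ.le
  rw [eq_sub_of_add_eq hw]
  refine (abs_sub _ _).trans ?_
  rw [abs_mul, abs_of_pos hΔ, incrBound, testBound]
  linarith

end

open Triangulation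

theorem sum_shift_le {a : ℕ → ℝ} (ha : ∀ n, 0 ≤ a n) {N q l : ℕ} (hl : l ≤ q) :
    ∑ i ∈ (Finset.Icc 1 N).filter (fun i => i + q ≤ N), a (i + l) ≤
      ∑ i ∈ Finset.Icc 1 N, a i := by
  rw [← Finset.sum_image (g := fun i => i + l) (f := a) (fun _ _ _ _ h => Nat.add_right_cancel h)]
  refine Finset.sum_le_sum_of_subset_of_nonneg ?_ fun n _ _ => ha n
  intro n hn
  simp only [Finset.mem_image, Finset.mem_filter, Finset.mem_Icc] at hn ⊢
  omega

/-- Summation of the telescoped increments over all translates by `q` steps: each of the `q`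
increments contributes the sum of the bounds once. -/
theorem sum_translates_le {a b : ℕ → ℝ} (ha : ∀ n, 0 ≤ a n) (hb : ∀ n, 0 ≤ b n) {N : ℕ}
    {I : ℕ → ℕ → ℝ} (hI : ∀ j ∈ Finset.Icc 1 N, ∀ m ∈ Finset.Icc 1 N, |I j m| ≤ a j + b m)
    {Ca Cb : ℝ} (hCa : ∑ n ∈ Finset.Icc 1 N, a n ≤ Ca) (hCb : ∑ n ∈ Finset.Icc 1 N, b n ≤ Cb)
    (q : ℕ) :
    ∑ i ∈ (Finset.Icc 1 N).filter (fun i => i + q ≤ N),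
      ∑ l ∈ Finset.Icc 1 q, (I (i + l) (i + q) - I (i + l) i) ≤ q * (2 * (Ca + Cb)) := by
  rw [Finset.sum_comm]
  have h1 : ∀ l ∈ Finset.Icc 1 q, ∑ i ∈ (Finset.Icc 1 N).filter (fun i => i + q ≤ N),
      (I (i + l) (i + q) - I (i + l) i) ≤ 2 * (Ca + Cb) := by
    intro l hl
    rw [Finset.mem_Icc] at hl
    have h2 : ∀ i ∈ (Finset.Icc 1 N).filter (fun i => i + q ≤ N),
        I (i + l) (i + q) - I (i + l) i ≤ 2 * a (i + l) + b (i + q) + b (i + 0) := by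
      intro i hi
      simp only [Finset.mem_filter, Finset.mem_Icc] at hi
      have m1 : i + l ∈ Finset.Icc 1 N := by rw [Finset.mem_Icc]; omega
      have m2 : i + q ∈ Finset.Icc 1 N := by rw [Finset.mem_Icc]; omega
      have m3 : i ∈ Finset.Icc 1 N := by rw [Finset.mem_Icc]; omega
      have h3 := (abs_le.1 (hI _ m1 _ m2)).2
      have h4 := (abs_le.1 (hI _ m1 _ m3)).1
      rw [add_zero]
      linarith
    refine (Finset.sum_le_sum h2).trans ?_
    rw [Finset.sum_add_distrib, Finset.sum_add_distrib, ← Finset.mul_sum]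
    have h5 := sum_shift_le ha (N := N) hl.2
    have h6 := sum_shift_le hb (N := N) (le_refl q)
    have h7 := sum_shift_le hb (N := N) (Nat.zero_le q)
    linarith
  refine (Finset.sum_le_sum h1).trans ?_
  rw [Finset.sum_const, Nat.card_Icc, nsmul_eq_mul, Nat.add_sub_cancel]

/-- Uniform continuity of a continuous nondecreasing function, in a form suited to the monotone
quantity `(x - y) (A x - A y)`. -/
theorem exists_modulus_monotone {A : ℝ → ℝ} (hA : Continuous A) (hA' : Monotone A) (M : ℝ)
    {ε : ℝ} (hε : 0 < ε) : ∃ b, 0 ≤ b ∧ ∀ x y, |x| ≤ M → |y| ≤ M →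
      |A x - A y| ≤ ε + b * ((x - y) * (A x - A y)) := by
  have hu := (isCompact_Icc (a := -M) (b := M)).uniformContinuousOn_of_continuous hA.continuousOn
  obtain ⟨η, hη, h⟩ := Metric.uniformContinuousOn_iff.1 hu ε hε
  refine ⟨η⁻¹, (inv_pos.2 hη).le, fun x y hx hy => ?_⟩
  have hp := Monotone.sub_mul_sub_nonneg monotone_id hA' x y
  simp only [id] at hp
  rcases lt_or_ge |x - y| η with hxy | hxy
  · have h1 := h x (abs_le.1 hx) y (abs_le.1 hy) (by rwa [Real.dist_eq])
    rw [Real.dist_eq] at h1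
    have := mul_nonneg (inv_pos.2 hη).le hp
    linarith
  -- for distant `x` and `y` the monotone quantity alone is sufficient
  · have h1 : |A x - A y| ≤ η⁻¹ * ((x - y) * (A x - A y)) := by
      rw [← div_eq_inv_mul, le_div_iff₀ hη, ← abs_of_nonneg hp, abs_mul, mul_comm]
      exact mul_le_mul_of_nonneg_right hxy (abs_nonneg _)
    linarith

section

variable {d : ℕ} [NeZero d] {Ω : Set (Pt d)} {𝒯 : Triangulation d Ω} {T Δt : ℝ}
  {u₀ : Pt d → ℝ} {S : ℝ → Pt d → ℝ} {p c : ℝ} {k : Pt d → ℝ} {A : ℝ → ℝ} {f : ℝ → Pt d}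
  {ω : ℝ → ℝ} {c' : ℝ} {g : 𝒯.PFlux} {gs : 𝒯.DFlux} {u : ℕ → 𝒯.DFun}

/-- The product `[[a - b, A(a) - A(b)]]`. -/
def monotonePair (A : ℝ → ℝ) (a b : 𝒯.DFun) : ℝ :=
  pairing (𝒯 := 𝒯) (fun K => a.primal (Sum.inl K) - b.primal (Sum.inl K))
    (fun v => a.dual v - b.dual v)
    (fun K => A (a.primal (Sum.inl K)) - A (b.primal (Sum.inl K)))
    (fun v => A (a.dual v) - A (b.dual v))

/-- The difference `u^{i+q} - u^i` is split into the increments of the `q` intermediate time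
steps. -/
theorem monotonePair_eq (A : ℝ → ℝ) (u : ℕ → 𝒯.DFun) (i q : ℕ) :
    monotonePair A (u (i + q)) (u i) = ∑ l ∈ Finset.Icc 1 q,
      (incrPair u (i + l) ((u (i + q)).comp A) - incrPair u (i + l) ((u i).comp A)) := by
  have key : ∀ φ : 𝒯.DFun, ∑ l ∈ Finset.Icc 1 q, incrPair u (i + l) φ =
      𝒯.pairWith (fun K => (u (i + q)).primal (Sum.inl K) - (u i).primal (Sum.inl K))
        (fun v => (u (i + q)).dual v - (u i).dual v) φ := by
    intro φ
    rw [pairWith, pairing_sub]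
    have := sum_Icc_sub_pred (fun n => pairing (𝒯 := 𝒯) (fun K => (u (i + n)).primal (Sum.inl K))
      (fun v => (u (i + n)).dual v) (fun K => φ.primal (Sum.inl K)) φ.dual) q
    rw [add_zero] at this
    rw [← this]
    refine Finset.sum_congr rfl fun l hl => ?_
    rw [incrPair, pairWith, pairing_sub, Nat.add_sub_assoc (Finset.mem_Icc.1 hl).1]
  rw [Finset.sum_sub_distrib, key, key, monotonePair, pairing_sub_right]
  rfl

open Classical in
/-- The sum of the `L^1(Ω)` distances of the primal and of the dual components. -/
def l1Dist (a b : 𝒯.DFun) : ℝ :=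
  ∑ K, 𝒯.mCell K * |a.primal (Sum.inl K) - b.primal (Sum.inl K)| +
    ∑ v ∈ Finset.univ.filter (fun v : 𝒯.Vertex => v.1 ∈ Ω), 𝒯.mDual v * |a.dual v - b.dual v|

theorem l1Dist_nonneg (a b : 𝒯.DFun) : 0 ≤ l1Dist a b :=
  add_nonneg (Finset.sum_nonneg fun _ _ => mul_nonneg measureReal_nonneg (abs_nonneg _))
    (Finset.sum_nonneg fun _ _ => mul_nonneg measureReal_nonneg (abs_nonneg _))

theorem l1Dist_le (hd : d = 2 ∨ d = 3) (a b : 𝒯.DFun) :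
    l1Dist a b ≤ d * 𝒯.total (fun K => |a.primal (Sum.inl K) - b.primal (Sum.inl K)|)
      (fun v => |a.dual v - b.dual v|) := by
  classical
  have hd1 := one_le_sub_one hd
  have hd0 : (d : ℝ) ≠ 0 := by linarith
  rw [l1Dist, total, pairing]
  simp only [mul_one]
  have h2 : 0 ≤ ∑ v ∈ Finset.univ.filter (fun v : 𝒯.Vertex => v.1 ∈ Ω),
      𝒯.mDual v * |a.dual v - b.dual v| :=
    Finset.sum_nonneg fun _ _ => mul_nonneg measureReal_nonneg (abs_nonneg _)
  have h3 := mul_le_mul_of_nonneg_right hd1 h2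
  rw [mul_add, ← mul_assoc, mul_one_div_cancel hd0, ← mul_assoc, mul_div_cancel₀ _ hd0]
  linarith

theorem l1Dist_comp_le (hP : IsProblem Ω T u₀ S p c k A f ω) {M ε b : ℝ} (hε : 0 ≤ ε)
    (hb : ∀ x y, |x| ≤ M → |y| ≤ M → |A x - A y| ≤ ε + b * ((x - y) * (A x - A y)))
    {v w : 𝒯.DFun} (hv : ∀ K, |v.primal (Sum.inl K)| ≤ M)
    (hv' : ∀ z : 𝒯.Vertex, z.1 ∈ Ω → |v.dual z| ≤ M) (hw : ∀ K, |w.primal (Sum.inl K)| ≤ M)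
    (hw' : ∀ z : 𝒯.Vertex, z.1 ∈ Ω → |w.dual z| ≤ M) :
    l1Dist (v.comp A) (w.comp A) ≤ d * (volume.real Ω * ε + b * monotonePair A v w) := by
  refine (l1Dist_le hP.dim _ _).trans (mul_le_mul_of_nonneg_left ?_ (Nat.cast_nonneg d))
  have h1 : 𝒯.total (fun _ => ε) (fun _ => ε) + b * monotonePair A v w =
      pairing (𝒯 := 𝒯) (fun K => ε + b * ((v.primal (Sum.inl K) - w.primal (Sum.inl K)) *
          (A (v.primal (Sum.inl K)) - A (w.primal (Sum.inl K)))))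
        (fun z => ε + b * ((v.dual z - w.dual z) * (A (v.dual z) - A (w.dual z))))
        (fun _ => 1) fun _ => 1 := by
    rw [pairing_add, pairing_const_mul, total]
    congr 2
    exact pairing_congr (fun K => (mul_one _).symm) fun v _ => (mul_one _).symm
  refine le_trans ?_ (add_le_add_left (total_const_le (𝒯 := 𝒯) hP.isOpen hP.bounded hP.dim hε) _)
  rw [h1]
  refine pairing_le_pairing hP.dim (fun K => ?_) fun z hz => ?_
  · rw [mul_one, mul_one]
    exact hb _ _ (hv K) (hw K)
  · rw [mul_one, mul_one]
    exact hb _ _ (hv' z hz) (hw' z hz)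

/-- Extension of a family of discrete functions by zero after `N` time steps. -/
def truncFam (N : ℕ) (w : ℕ → 𝒯.DFun) (j : ℕ) : 𝒯.DFun :=
  if j ≤ N then w j else ⟨fun _ => 0, fun _ => 0⟩

/-- The constant of the bound of `∑ [[u^{i+q} - u^i, w^{i+q} - w^i]] / q`: twice the sum over all
time steps of `incrBound` and `testBound`, estimated by the energy. -/
def translateBound (Ω : Set (Pt d)) (T c W M : ℝ) (A : ℝ → ℝ) : ℝ :=
  2 * ((c * (c * energyBound Ω A M) + energyBound Ω A M + volume.real Ω * (M * (A M - A (-M)))) +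
    (W * d * (T * (volume.real Ω / volume.real (stdCorner d)) + c * energyBound Ω A M) +
      c * (c * energyBound Ω A M) + energyBound Ω A M))

/-- Each increment `u^j - u^{j-1}` carries a factor `Δt` through the scheme, so that its bounds are
summable over the time steps; multiplied by `Δt`, the right-hand side is a constant times the length
`q Δt` of the translate. -/
theorem IsScheme.sum_monotonePair_le (hP : IsProblem Ω T u₀ S p c k A f ω)
    (h : IsScheme 𝒯 T Δt u₀ S k A f ω c' g gs u) {W : ℝ} (hW0 : 0 ≤ W)
    (hW : ∀ z ∈ Icc 0 (2 * dataBound Ω T u₀ S), |ω z| ≤ W) (q : ℕ) :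
    ∑ i ∈ (Finset.Icc 1 (numSteps T Δt)).filter (fun i => i + q ≤ numSteps T Δt),
      monotonePair A (u (i + q)) (u i) ≤
      q * translateBound Ω T c (|c'| * (2 * W)) (dataBound Ω T u₀ S) A := by
  have hc := hP.diffusion.pos
  have hΔ := h.step_pos
  have hM : 0 ≤ dataBound Ω T u₀ S := dataBound_nonneg
  have hB : 0 ≤ A (dataBound Ω T u₀ S) - A (-dataBound Ω T u₀ S) :=
    sub_nonneg.2 (hP.mono_A (by linarith))
  have hV : 0 ≤ volume.real Ω / volume.real (stdCorner d) :=
    div_nonneg measureReal_nonneg measureReal_nonneg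
  have hΩ0 : 0 ≤ volume.real Ω := measureReal_nonneg
  have hG : ∀ n, 0 ≤ gradEnergy p ((u n).comp A) := fun n => h.gradEnergy_nonneg hP _
  have hQ : ∀ n, 0 ≤ penForm ((u n).comp A) ((u n).comp A) := fun n =>
    penForm_self_nonneg hP.dim _
  obtain ⟨e1, e2⟩ := h.diffusion_bounds hP
  simp_rw [monotonePair_eq]
  have e3 : ∑ n ∈ Finset.Icc 1 (numSteps T Δt), sourceBound Ω S Δt n ≤ dataBound Ω T u₀ S :=
    (le_add_of_nonneg_left ENNReal.toReal_nonneg).trans (stepBound_le hP hΔ le_rfl)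
  have e4 : (numSteps T Δt : ℝ) * Δt ≤ T := mul_le_of_le_numSteps hP.time_pos hΔ le_rfl
  refine sum_translates_le (I := fun j m => incrPair u j ((u m).comp A)) ?_ ?_
    (fun j hj m hm => h.abs_incrPair_le hP hW0 hW hj hm) ?_ ?_ q
  · intro n
    have := hG n
    have := hQ n
    have := sourceBound_nonneg (Ω := Ω) S Δt n
    simp only [incrBound]
    positivity
  · intro n
    have := hG n
    have := hQ n
    simp only [testBound]
    positivity
  · have : ∀ n, incrBound Δt Ω S p c (A (dataBound Ω T u₀ S) - A (-dataBound Ω T u₀ S))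
        (fun n => (u n).comp A) n = c * (Δt * gradEnergy p ((u n).comp A)) +
        Δt * penForm ((u n).comp A) ((u n).comp A) + volume.real Ω *
        (A (dataBound Ω T u₀ S) - A (-dataBound Ω T u₀ S)) * sourceBound Ω S Δt n := fun n => by
      rw [incrBound]; ring
    simp_rw [this]
    rw [Finset.sum_add_distrib, Finset.sum_add_distrib]
    have h1 := mul_le_mul_of_nonneg_left e1 hc.le
    have h3 := mul_le_mul_of_nonneg_left e3 (mul_nonneg hΩ0 hB)
    simp only [← Finset.mul_sum] at h1 h3 e2 ⊢
    linarith
  · set V := volume.real Ω / volume.real (stdCorner d)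
    have : ∀ n, testBound Δt p c (|c'| * (2 * W)) V (fun n => (u n).comp A) n =
        |c'| * (2 * W) * d * V * Δt + |c'| * (2 * W) * d * (Δt * gradEnergy p ((u n).comp A)) +
        c * (Δt * gradEnergy p ((u n).comp A)) +
        Δt * penForm ((u n).comp A) ((u n).comp A) := fun n => by
      rw [testBound]; ring
    simp_rw [this]
    rw [Finset.sum_add_distrib, Finset.sum_add_distrib, Finset.sum_add_distrib,
      Finset.sum_const, Nat.card_Icc, Nat.add_sub_cancel, nsmul_eq_mul]
    have h1 := mul_le_mul_of_nonneg_left e1 hc.le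
    have h2 := mul_le_mul_of_nonneg_left e1 (by positivity : 0 ≤ |c'| * (2 * W) * d)
    have h3 := mul_le_mul_of_nonneg_left e4 (by positivity : 0 ≤ |c'| * (2 * W) * d * V)
    simp only [← Finset.mul_sum] at h1 h2 e2 ⊢
    linarith

/-- Translates by a whole number of time steps. The translates that end before the last time step
are controlled by `monotonePair`; there are at most `q` others, for which the solution is bounded
and its translate is zero. -/
theorem IsScheme.sum_l1Dist_le (hP : IsProblem Ω T u₀ S p c k A f ω)
    (h : IsScheme 𝒯 T Δt u₀ S k A f ω c' g gs u) {W : ℝ} (hW0 : 0 ≤ W)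
    (hW : ∀ z ∈ Icc 0 (2 * dataBound Ω T u₀ S), |ω z| ≤ W) {ε b : ℝ} (hε : 0 ≤ ε) (hb0 : 0 ≤ b)
    (hb : ∀ x y, |x| ≤ dataBound Ω T u₀ S → |y| ≤ dataBound Ω T u₀ S →
      |A x - A y| ≤ ε + b * ((x - y) * (A x - A y))) (q : ℕ) :
    ∑ i ∈ Finset.Icc 1 (numSteps T Δt), Δt * l1Dist
        (truncFam (numSteps T Δt) (fun n => (u n).comp A) (i + q))
        (truncFam (numSteps T Δt) (fun n => (u n).comp A) i) ≤
      ε * (d * volume.real Ω * T) + q * Δt *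
        (d * (b * translateBound Ω T c (|c'| * (2 * W)) (dataBound Ω T u₀ S) A +
          volume.real Ω * (A (dataBound Ω T u₀ S) - A (-dataBound Ω T u₀ S)))) := by
  set N := numSteps T Δt with hN
  have hM : 0 ≤ dataBound Ω T u₀ S := dataBound_nonneg
  have hΔ := h.step_pos
  have hB : 0 ≤ A (dataBound Ω T u₀ S) - A (-dataBound Ω T u₀ S) :=
    sub_nonneg.2 (hP.mono_A (by linarith))
  have hΩ0 : 0 ≤ volume.real Ω := measureReal_nonneg
  have e4 : (N : ℝ) * Δt ≤ T := mul_le_of_le_numSteps hP.time_pos hΔ le_rfl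
  rw [← Finset.sum_filter_add_sum_filter_not (Finset.Icc 1 N) (fun i => i + q ≤ N)]
  have h1 : ∑ i ∈ (Finset.Icc 1 N).filter (fun i => i + q ≤ N), Δt * l1Dist
        (truncFam N (fun n => (u n).comp A) (i + q)) (truncFam N (fun n => (u n).comp A) i) ≤
      ε * (d * volume.real Ω * T) + q * Δt *
        (d * (b * translateBound Ω T c (|c'| * (2 * W)) (dataBound Ω T u₀ S) A)) := by
    have h2 : ∀ i ∈ (Finset.Icc 1 N).filter (fun i => i + q ≤ N), Δt * l1Dist
        (truncFam N (fun n => (u n).comp A) (i + q)) (truncFam N (fun n => (u n).comp A) i) ≤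
        Δt * (d * (volume.real Ω * ε)) + Δt * d * b * monotonePair A (u (i + q)) (u i) := by
      intro i hi
      simp only [Finset.mem_filter, Finset.mem_Icc] at hi
      rw [truncFam, truncFam, if_pos hi.2, if_pos hi.1.2]
      have h3 := l1Dist_comp_le hP hε hb (v := u (i + q)) (w := u i)
        (fun K => h.abs_primal_le hP hi.2 K) (fun v hv => h.abs_dual_le hP hi.2 hv)
        (fun K => h.abs_primal_le hP hi.1.2 K) (fun v hv => h.abs_dual_le hP hi.1.2 hv)
      have h4 := mul_le_mul_of_nonneg_left h3 hΔ.le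
      linarith
    refine (Finset.sum_le_sum h2).trans ?_
    rw [Finset.sum_add_distrib, Finset.sum_const, nsmul_eq_mul]
    have h5 : (((Finset.Icc 1 N).filter fun i => i + q ≤ N).card : ℝ) ≤ N := by
      have := Finset.card_filter_le (Finset.Icc 1 N) fun i => i + q ≤ N
      rw [Nat.card_Icc, Nat.add_sub_cancel] at this
      exact_mod_cast this
    have h6 := mul_le_mul_of_nonneg_right h5 (by positivity : 0 ≤ Δt * (d * (volume.real Ω * ε)))
    have h7 := mul_le_mul_of_nonneg_right e4 (by positivity : 0 ≤ (d * (volume.real Ω * ε)))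
    have h8 := mul_le_mul_of_nonneg_left (h.sum_monotonePair_le hP hW0 hW q)
      (by positivity : 0 ≤ Δt * d * b)
    rw [← hN] at h8
    simp only [← Finset.mul_sum] at h8 ⊢
    linarith
  have h2 : ∑ i ∈ (Finset.Icc 1 N).filter (fun i => ¬ i + q ≤ N), Δt * l1Dist
        (truncFam N (fun n => (u n).comp A) (i + q)) (truncFam N (fun n => (u n).comp A) i) ≤
      q * Δt * (d * (volume.real Ω * (A (dataBound Ω T u₀ S) - A (-dataBound Ω T u₀ S)))) := by
    have h3 : ∀ i ∈ (Finset.Icc 1 N).filter (fun i => ¬ i + q ≤ N), Δt * l1Dist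
        (truncFam N (fun n => (u n).comp A) (i + q)) (truncFam N (fun n => (u n).comp A) i) ≤
        Δt * (d * (volume.real Ω * (A (dataBound Ω T u₀ S) - A (-dataBound Ω T u₀ S)))) := by
      intro i hi
      simp only [Finset.mem_filter, Finset.mem_Icc] at hi
      rw [truncFam, truncFam, if_neg hi.2, if_pos hi.1.2]
      refine mul_le_mul_of_nonneg_left ((l1Dist_le hP.dim _ _).trans
        (mul_le_mul_of_nonneg_left ?_ (Nat.cast_nonneg d))) hΔ.le
      refine le_trans ?_ (total_const_le (𝒯 := 𝒯) hP.isOpen hP.bounded hP.dim hB)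
      refine pairing_le_pairing hP.dim (fun K => ?_) fun z hz => ?_
      · rw [mul_one, mul_one, zero_sub, abs_neg]
        exact abs_le_of_monotone hP.mono_A hP.zero_A (h.abs_primal_le hP hi.1.2 K)
      · rw [mul_one, mul_one, zero_sub, abs_neg]
        exact abs_le_of_monotone hP.mono_A hP.zero_A (h.abs_dual_le hP hi.1.2 hz)
    refine (Finset.sum_le_sum h3).trans ?_
    rw [Finset.sum_const, nsmul_eq_mul, ← mul_assoc]
    have h5 : (((Finset.Icc 1 N).filter fun i => ¬ i + q ≤ N).card : ℝ) ≤ q := by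
      have h6 : ((Finset.Icc 1 N).filter fun i => ¬ i + q ≤ N) ⊆ Finset.Icc (N + 1 - q) N := by
        intro i hi
        simp only [Finset.mem_filter, Finset.mem_Icc] at hi ⊢
        omega
      have h7 := Finset.card_le_card h6
      rw [Nat.card_Icc] at h7
      exact_mod_cast h7.trans (by omega)
    have h8 := mul_le_mul_of_nonneg_right h5 hΔ.le
    exact mul_le_mul_of_nonneg_right h8 (by positivity)
  linarith

end

/-! ### From step functions to discrete functions -/

open Triangulation

/-- The infimum over `ε` of the bounds `ε a + δ b(ε)` is a modulus of continuity: it is concave in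
`δ`, hence continuous for `δ > 0`, and it tends to zero with `δ`. -/
theorem exists_modulus_of_forall_le {a : ℝ} (ha : 0 ≤ a) {b : ℝ → ℝ} (hb : ∀ ε, 0 < ε → 0 ≤ b ε) :
    ∃ ω : ℝ → ℝ, (ContinuousOn ω (Ici 0) ∧ MonotoneOn ω (Ici 0) ∧ ω 0 = 0) ∧
      ∀ x δ, 0 ≤ δ → (∀ ε, 0 < ε → x ≤ ε * a + δ * b ε) → x ≤ ω δ := by
  have : Nonempty {ε : ℝ // 0 < ε} := ⟨⟨1, one_pos⟩⟩
  set ω : ℝ → ℝ := fun δ => ⨅ ε : {ε : ℝ // 0 < ε}, (ε.1 * a + δ * b ε.1) with hω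
  have hbdd : ∀ δ, 0 ≤ δ →
      BddBelow (range fun ε : {ε : ℝ // 0 < ε} => ε.1 * a + δ * b ε.1) := by
    rintro δ hδ
    refine ⟨0, ?_⟩
    rintro _ ⟨ε, rfl⟩
    exact add_nonneg (mul_nonneg ε.2.le ha) (mul_nonneg hδ (hb _ ε.2))
  have hle : ∀ δ, 0 ≤ δ → ∀ ε, 0 < ε → ω δ ≤ ε * a + δ * b ε := fun δ hδ ε hε =>
    ciInf_le (hbdd δ hδ) ⟨ε, hε⟩
  have hnn : ∀ δ, 0 ≤ δ → 0 ≤ ω δ := fun δ hδ => le_ciInf fun ε =>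
    add_nonneg (mul_nonneg ε.2.le ha) (mul_nonneg hδ (hb _ ε.2))
  have hsmall : ∀ e, 0 < e → ∃ η > 0, ∀ δ, 0 ≤ δ → δ < η → ω δ < e := by
    intro e he
    have h1 : 0 < e / (2 * (a + 1)) := by positivity
    have h2 := hb _ h1
    -- half of `e` for each of the two terms of the bound
    refine ⟨e / (2 * (b (e / (2 * (a + 1))) + 1)), by positivity, fun δ hδ hδ' => ?_⟩
    have h3 := hle δ hδ _ h1
    have h4 : e / (2 * (a + 1)) * a ≤ e / 2 := by
      rw [div_mul_eq_mul_div, div_le_div_iff₀ (by positivity) (by positivity)]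
      nlinarith
    rw [lt_div_iff₀ (by positivity)] at hδ'
    nlinarith
  have h0 : ω 0 = 0 := by
    refine le_antisymm (le_of_forall_pos_le_add fun e he => ?_) (hnn 0 le_rfl)
    obtain ⟨η, hη, h⟩ := hsmall e he
    linarith [h 0 le_rfl hη]
  have hconc : ConcaveOn ℝ (Ici 0) ω := by
    refine ⟨convex_Ici 0, fun x hx y hy s t hs ht hst => le_ciInf fun ε => ?_⟩
    have h1 := mul_le_mul_of_nonneg_left (hle x hx ε.1 ε.2) hs
    have h2 := mul_le_mul_of_nonneg_left (hle y hy ε.1 ε.2) ht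
    have h3 : ε.1 * a = s * (ε.1 * a) + t * (ε.1 * a) := by rw [← add_mul, hst, one_mul]
    simp only [smul_eq_mul]
    linarith
  refine ⟨ω, ⟨fun δ hδ => ?_, fun x hx y hy hxy => ?_, h0⟩, fun x δ hδ h =>
    le_ciInf fun ε => h ε.1 ε.2⟩
  · rcases eq_or_lt_of_le (mem_Ici.1 hδ) with rfl | hpos
    · rw [Metric.continuousWithinAt_iff]
      intro e he
      obtain ⟨η, hη, h⟩ := hsmall e he
      refine ⟨η, hη, fun {x} hx hxη => ?_⟩
      rw [Real.dist_eq, sub_zero, abs_of_nonneg hx] at hxη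
      rw [h0, Real.dist_eq, sub_zero, abs_of_nonneg (hnn x hx)]
      exact h x hx hxη
    · have h1 : ContinuousOn ω (Ioi 0) :=
        (hconc.subset Ioi_subset_Ici_self (convex_Ioi 0)).continuousOn isOpen_Ioi
      exact (h1.continuousAt (Ioi_mem_nhds hpos)).continuousWithinAt
  · refine ciInf_mono (hbdd x hx) fun ε => ?_
    have := mul_le_mul_of_nonneg_right hxy (hb _ ε.2)
    linarith

section

variable {d : ℕ} {Ω : Set (Pt d)}

/-- On the `n`-th time interval, a piecewise constant function is given by its `n`-th value. -/
theorem sum_step_eq {ι : Type*} (s : Finset ι) (B : ι → Set (Pt d)) (a : ℕ → ι → ℝ) {Δt : ℝ}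
    (hΔ : 0 < Δt) (N : ℕ) {n : ℕ} (hn : 1 ≤ n) {t : ℝ}
    (ht : t ∈ Ico (((n : ℝ) - 1) * Δt) ((n : ℝ) * Δt)) (x : Pt d) :
    ∑ m ∈ Finset.Icc 1 N, ∑ i ∈ s,
      (Ico (((m : ℝ) - 1) * Δt) ((m : ℝ) * Δt) ×ˢ B i).indicator (fun _ => a m i) (t, x) =
    ∑ i ∈ s, (B i).indicator (fun _ => if n ≤ N then a n i else 0) x := by
  have h1 : ∀ m : ℕ, m ≠ n → t ∉ Ico (((m : ℝ) - 1) * Δt) ((m : ℝ) * Δt) := by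
    intro m hm hm'
    rcases lt_or_gt_of_ne hm with h | h
    · have h2 : (m : ℝ) + 1 ≤ n := by exact_mod_cast h
      have := mul_le_mul_of_nonneg_right h2 hΔ.le
      nlinarith [hm'.2, ht.1]
    · have h2 : (n : ℝ) + 1 ≤ m := by exact_mod_cast h
      have := mul_le_mul_of_nonneg_right h2 hΔ.le
      nlinarith [hm'.1, ht.2]
  have h2 : ∀ m : ℕ, m ≠ n → ∑ i ∈ s,
      (Ico (((m : ℝ) - 1) * Δt) ((m : ℝ) * Δt) ×ˢ B i).indicator (fun _ => a m i) (t, x) = 0 :=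
    fun m hm => Finset.sum_eq_zero fun i _ =>
      indicator_of_notMem (fun h => h1 m hm (mem_prod.1 h).1) _
  by_cases hN : n ≤ N
  · rw [Finset.sum_eq_single n (fun m _ hm => h2 m hm)
      (fun h => absurd (Finset.mem_Icc.2 ⟨hn, hN⟩) h)]
    refine Finset.sum_congr rfl fun i _ => ?_
    by_cases hx : x ∈ B i
    · rw [indicator_of_mem (mk_mem_prod ht hx), indicator_of_mem hx, if_pos hN]
    · rw [indicator_of_notMem (fun h => hx (mem_prod.1 h).2), indicator_of_notMem hx]
  · rw [Finset.sum_eq_zero fun m hm => h2 m fun h => hN (h ▸ (Finset.mem_Icc.1 hm).2)]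
    simp [hN]

theorem exists_step {Δt t : ℝ} (hΔ : 0 < Δt) (ht : 0 ≤ t) :
    ∃ n : ℕ, 1 ≤ n ∧ t ∈ Ico (((n : ℝ) - 1) * Δt) ((n : ℝ) * Δt) := by
  refine ⟨⌊t / Δt⌋₊ + 1, by omega, ?_, ?_⟩
  · rw [← le_div_iff₀ hΔ]
    push_cast
    rw [add_sub_cancel_right]
    exact Nat.floor_le (div_nonneg ht hΔ.le)
  · rw [← div_lt_iff₀ hΔ]
    push_cast
    exact Nat.lt_floor_add_one _

theorem abs_sum_indicator_le {ι : Type*} {s : Finset ι} {B : ι → Set (Pt d)}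
    (hB : ∀ i j, i ≠ j → Disjoint (B i) (B j)) {a : ι → ℝ} {M : ℝ} (hM : 0 ≤ M)
    (ha : ∀ i ∈ s, |a i| ≤ M) (x : Pt d) : |∑ i ∈ s, (B i).indicator (fun _ => a i) x| ≤ M := by
  by_cases h : ∃ i ∈ s, x ∈ B i
  · obtain ⟨i, hi, hx⟩ := h
    rw [Finset.sum_eq_single i (fun j _ hj => indicator_of_notMem
      (fun hx' => Set.disjoint_left.1 (hB j i hj) hx' hx) _) (fun h => absurd hi h),
      indicator_of_mem hx]
    exact ha i hi
  · push Not at h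
    rw [Finset.sum_eq_zero fun i hi => indicator_of_notMem (h i hi) _, abs_zero]
    exact hM

theorem lintegral_sum_indicator_le {ι : Type*} {s : Finset ι} {B : ι → Set (Pt d)}
    (hB : ∀ i ∈ s, MeasurableSet (B i)) (hB' : ∀ i ∈ s, volume (B i) ≠ ∞) (a : ι → ℝ) :
    ∫⁻ x in Ω, ∑ i ∈ s, (B i).indicator (fun _ => ENNReal.ofReal |a i|) x ≤
      ENNReal.ofReal (∑ i ∈ s, volume.real (B i) * |a i|) := by
  rw [lintegral_finsetSum _ fun i hi => measurable_const.indicator (hB i hi),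
    ENNReal.ofReal_sum_of_nonneg fun i _ => mul_nonneg measureReal_nonneg (abs_nonneg _)]
  refine Finset.sum_le_sum fun i hi => ?_
  rw [lintegral_indicator_const (hB i hi), mul_comm (volume.real (B i)),
    ENNReal.ofReal_mul (abs_nonneg _), ofReal_measureReal (hB' i hi)]
  gcongr
  exact Measure.restrict_le_self

theorem ofReal_abs_sum_indicator_le {ι : Type*} (s : Finset ι) (B : ι → Set (Pt d)) (a : ι → ℝ)
    (x : Pt d) : ENNReal.ofReal |∑ i ∈ s, (B i).indicator (fun _ => a i) x| ≤
      ∑ i ∈ s, (B i).indicator (fun _ => ENNReal.ofReal |a i|) x := by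
  rw [← Real.enorm_eq_ofReal_abs]
  refine (enorm_sum_le _ _).trans (Finset.sum_le_sum fun i _ => ?_)
  rw [enorm_indicator_eq_indicator_enorm]
  simp only [Real.enorm_eq_ofReal_abs, le_refl]

end

section

variable {d : ℕ} [NeZero d] {Ω : Set (Pt d)} {𝒯 : Triangulation d Ω} {T Δt : ℝ}

theorem primalFun_eq (hΔ : 0 < Δt) (w : ℕ → 𝒯.DFun) {n : ℕ} (hn : 1 ≤ n) {t : ℝ}
    (ht : t ∈ Ico (((n : ℝ) - 1) * Δt) ((n : ℝ) * Δt)) (x : Pt d) :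
    primalFun 𝒯 T Δt w t x = ∑ K, (𝒯.simplex K).interior.indicator
      (fun _ => (truncFam (numSteps T Δt) w n).primal (Sum.inl K)) x := by
  rw [primalFun, sum_step_eq _ _ (fun n K => (w n).primal (Sum.inl K)) hΔ _ hn ht]
  unfold truncFam
  split_ifs <;> rfl

open Classical in
theorem dualFun_eq (hΔ : 0 < Δt) (w : ℕ → 𝒯.DFun) {n : ℕ} (hn : 1 ≤ n) {t : ℝ}
    (ht : t ∈ Ico (((n : ℝ) - 1) * Δt) ((n : ℝ) * Δt)) (x : Pt d) :
    dualFun 𝒯 T Δt w t x = ∑ v ∈ Finset.univ.filter (fun v : 𝒯.Vertex => v.1 ∈ Ω),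
      (𝒯.dualCell v).indicator (fun _ => (truncFam (numSteps T Δt) w n).dual v) x := by
  rw [dualFun, sum_step_eq _ _ (fun n v => (w n).dual v) hΔ _ hn ht]
  unfold truncFam
  split_ifs <;> rfl

theorem lintegral_translate_le (hΩ : IsOpen Ω) (hΩb : Bornology.IsBounded Ω) (hΔ : 0 < Δt)
    (w : ℕ → 𝒯.DFun) {n m : ℕ} (hn : 1 ≤ n) (hm : 1 ≤ m) {t t' : ℝ}
    (ht : t ∈ Ico (((n : ℝ) - 1) * Δt) ((n : ℝ) * Δt))
    (ht' : t' ∈ Ico (((m : ℝ) - 1) * Δt) ((m : ℝ) * Δt)) :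
    ∫⁻ x in Ω, ENNReal.ofReal (|primalFun 𝒯 T Δt w t' x - primalFun 𝒯 T Δt w t x| +
        |dualFun 𝒯 T Δt w t' x - dualFun 𝒯 T Δt w t x|) ≤
      ENNReal.ofReal (l1Dist (truncFam (numSteps T Δt) w m) (truncFam (numSteps T Δt) w n)) := by
  classical
  set a := truncFam (numSteps T Δt) w m
  set b := truncFam (numSteps T Δt) w n
  set s := Finset.univ.filter (fun v : 𝒯.Vertex => v.1 ∈ Ω) with hs
  have h1 : ∀ x, ENNReal.ofReal (|primalFun 𝒯 T Δt w t' x - primalFun 𝒯 T Δt w t x| +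
        |dualFun 𝒯 T Δt w t' x - dualFun 𝒯 T Δt w t x|) ≤
      (∑ K, (𝒯.simplex K).interior.indicator
        (fun _ => ENNReal.ofReal |a.primal (Sum.inl K) - b.primal (Sum.inl K)|) x) +
      ∑ v ∈ s, (𝒯.dualCell v).indicator (fun _ => ENNReal.ofReal |a.dual v - b.dual v|) x := by
    intro x
    rw [primalFun_eq hΔ w hm ht', primalFun_eq hΔ w hn ht, dualFun_eq hΔ w hm ht',
      dualFun_eq hΔ w hn ht, ← Finset.sum_sub_distrib, ← Finset.sum_sub_distrib]
    simp only [← Pi.sub_apply, ← indicator_sub']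
    rw [ENNReal.ofReal_add (abs_nonneg _) (abs_nonneg _)]
    exact add_le_add (ofReal_abs_sum_indicator_le _ _ _ x) (ofReal_abs_sum_indicator_le _ _ _ x)
  refine (lintegral_mono h1).trans ?_
  rw [lintegral_add_left (Finset.measurable_fun_sum _ fun K _ =>
    measurable_const.indicator (measurableSet_interior _)), l1Dist]
  refine le_trans ?_ (ENNReal.ofReal_add
    (Finset.sum_nonneg fun _ _ => mul_nonneg measureReal_nonneg (abs_nonneg _))
    (Finset.sum_nonneg fun _ _ => mul_nonneg measureReal_nonneg (abs_nonneg _))).ge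
  exact add_le_add
    (lintegral_sum_indicator_le (fun K _ => measurableSet_interior _)
      (fun K _ => (volume_lt_top_of_subset hΩb (𝒯.interior_subset K)).ne) _)
    (lintegral_sum_indicator_le (fun v _ => 𝒯.measurableSet_dualCell hΩ v)
      (fun v _ => (volume_lt_top_of_subset hΩb (𝒯.dualCell_subset v)).ne) _)

/-- Translates by `δ = (q + τ) Δt`: on a fraction `1 - τ` of each time interval the translate is
by `q` steps, on the remaining fraction by `q + 1` steps. -/
theorem lintegral_lintegral_translate_le (hΩ : IsOpen Ω) (hΩb : Bornology.IsBounded Ω)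
    (hΔ : 0 < Δt) (w : ℕ → 𝒯.DFun) (q : ℕ) {τ : ℝ} (hτ0 : 0 ≤ τ) (hτ1 : τ < 1) :
    ∫⁻ t in Ioo 0 T, ∫⁻ x in Ω, ENNReal.ofReal
        (|primalFun 𝒯 T Δt w (t + (q + τ) * Δt) x - primalFun 𝒯 T Δt w t x| +
        |dualFun 𝒯 T Δt w (t + (q + τ) * Δt) x - dualFun 𝒯 T Δt w t x|) ≤
      ENNReal.ofReal ((1 - τ) * (∑ i ∈ Finset.Icc 1 (numSteps T Δt), Δt *
          l1Dist (truncFam (numSteps T Δt) w (i + q)) (truncFam (numSteps T Δt) w i)) +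
        τ * ∑ i ∈ Finset.Icc 1 (numSteps T Δt), Δt *
          l1Dist (truncFam (numSteps T Δt) w (i + (q + 1))) (truncFam (numSteps T Δt) w i)) := by
  set N := numSteps T Δt with hN
  set E : ℕ → ℕ → ℝ := fun m i => l1Dist (truncFam N w m) (truncFam N w i) with hE
  have hE0 : ∀ m i, 0 ≤ E m i := fun _ _ => l1Dist_nonneg _ _
  have h1 : ∀ t ∈ Ioo 0 T, ∫⁻ x in Ω, ENNReal.ofReal
        (|primalFun 𝒯 T Δt w (t + (q + τ) * Δt) x - primalFun 𝒯 T Δt w t x| +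
        |dualFun 𝒯 T Δt w (t + (q + τ) * Δt) x - dualFun 𝒯 T Δt w t x|) ≤
      ∑ i ∈ Finset.Icc 1 N, ((Ico (((i : ℝ) - 1) * Δt) (((i : ℝ) - τ) * Δt)).indicator
          (fun _ => ENNReal.ofReal (E (i + q) i)) t +
        (Ico (((i : ℝ) - τ) * Δt) ((i : ℝ) * Δt)).indicator
          (fun _ => ENNReal.ofReal (E (i + (q + 1)) i)) t) := by
    intro t ht
    obtain ⟨i, hi, hti⟩ := exists_step hΔ ht.1.le
    rcases lt_or_ge t (((i : ℝ) - τ) * Δt) with hlt | hge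
    · have ht' : t + (q + τ) * Δt ∈ Ico ((((i + q : ℕ) : ℝ) - 1) * Δt) (((i + q : ℕ) : ℝ) * Δt) := by
        push_cast
        constructor
        · nlinarith [hti.1, mul_nonneg hτ0 hΔ.le]
        · nlinarith
      refine (lintegral_translate_le hΩ hΩb hΔ w hi (by omega) hti ht').trans ?_
      by_cases hiN : i ≤ N
      · refine le_trans ?_ (Finset.single_le_sum (f := fun i : ℕ =>
          (Ico (((i : ℝ) - 1) * Δt) (((i : ℝ) - τ) * Δt)).indicator
            (fun _ => ENNReal.ofReal (E (i + q) i)) t +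
          (Ico (((i : ℝ) - τ) * Δt) ((i : ℝ) * Δt)).indicator
            (fun _ => ENNReal.ofReal (E (i + (q + 1)) i)) t) (fun _ _ => zero_le)
          (Finset.mem_Icc.2 ⟨hi, hiN⟩))
        rw [indicator_of_mem (s := Ico (((i : ℝ) - 1) * Δt) (((i : ℝ) - τ) * Δt)) ⟨hti.1, hlt⟩]
        exact le_self_add
      · rw [← hN, truncFam, truncFam, if_neg (by omega), if_neg hiN]
        simp [l1Dist]
    · have ht' : t + (q + τ) * Δt ∈
          Ico ((((i + (q + 1) : ℕ) : ℝ) - 1) * Δt) (((i + (q + 1) : ℕ) : ℝ) * Δt) := by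
        push_cast
        constructor
        · nlinarith
        · nlinarith [hti.2, mul_lt_mul_of_pos_right hτ1 hΔ]
      refine (lintegral_translate_le hΩ hΩb hΔ w hi (by omega) hti ht').trans ?_
      by_cases hiN : i ≤ N
      · refine le_trans ?_ (Finset.single_le_sum (f := fun i : ℕ =>
          (Ico (((i : ℝ) - 1) * Δt) (((i : ℝ) - τ) * Δt)).indicator
            (fun _ => ENNReal.ofReal (E (i + q) i)) t +
          (Ico (((i : ℝ) - τ) * Δt) ((i : ℝ) * Δt)).indicator
            (fun _ => ENNReal.ofReal (E (i + (q + 1)) i)) t) (fun _ _ => zero_le)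
          (Finset.mem_Icc.2 ⟨hi, hiN⟩))
        rw [indicator_of_mem (s := Ico (((i : ℝ) - τ) * Δt) ((i : ℝ) * Δt)) ⟨hge, hti.2⟩]
        exact le_add_self
      · rw [← hN, truncFam, truncFam, if_neg (by omega), if_neg hiN]
        simp [l1Dist]
  refine (setLIntegral_mono' measurableSet_Ioo h1).trans ((setLIntegral_le_lintegral _ _).trans ?_)
  have hm : ∀ (a b e : ℝ), Measurable fun t => (Ico a b).indicator
      (fun _ => ENNReal.ofReal e) t := fun a b e => measurable_const.indicator measurableSet_Ico
  have hm2 : ∀ i : ℕ, Measurable fun t =>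
      (Ico (((i : ℝ) - 1) * Δt) (((i : ℝ) - τ) * Δt)).indicator
        (fun _ => ENNReal.ofReal (E (i + q) i)) t +
      (Ico (((i : ℝ) - τ) * Δt) ((i : ℝ) * Δt)).indicator
        (fun _ => ENNReal.ofReal (E (i + (q + 1)) i)) t := fun i => (hm _ _ _).add (hm _ _ _)
  rw [lintegral_finsetSum _ fun i _ => hm2 i, Finset.mul_sum, Finset.mul_sum,
    ← Finset.sum_add_distrib, ENNReal.ofReal_sum_of_nonneg]
  · refine Finset.sum_le_sum fun i _ => ?_
    rw [lintegral_add_left (hm _ _ _), lintegral_indicator_const measurableSet_Ico,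
      lintegral_indicator_const measurableSet_Ico, Real.volume_Ico, Real.volume_Ico,
      ← ENNReal.ofReal_mul (hE0 _ _), ← ENNReal.ofReal_mul (hE0 _ _), ← ENNReal.ofReal_add]
    · exact ENNReal.ofReal_le_ofReal (le_of_eq (by ring))
    · exact mul_nonneg (hE0 _ _) (by nlinarith)
    · exact mul_nonneg (hE0 _ _) (by nlinarith)
  · intro i _
    have := hE0 (i + q) i
    have := hE0 (i + (q + 1)) i
    have : 0 ≤ 1 - τ := by linarith
    positivity

theorem eLpNorm_primalFun_le (hΩ : IsOpen Ω) (hΔ : 0 < Δt) {u : ℕ → 𝒯.DFun} {M : ℝ} (hM : 0 ≤ M)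
    (hu : ∀ n ≤ numSteps T Δt, ∀ K, |(u n).primal (Sum.inl K)| ≤ M) :
    eLpNorm (Function.uncurry (primalFun 𝒯 T Δt u)) ∞
      ((volume.restrict (Ioo 0 T)).prod (volume.restrict Ω)) ≤ ENNReal.ofReal M := by
  rw [eLpNorm_exponent_top, Measure.prod_restrict]
  refine eLpNormEssSup_le_of_ae_bound
    (ae_restrict_of_forall_mem (measurableSet_Ioo.prod hΩ.measurableSet) ?_)
  rintro ⟨t, x⟩ ht
  obtain ⟨n, hn, htn⟩ := exists_step hΔ ht.1.1.le
  rw [Function.uncurry_apply_pair, primalFun_eq hΔ u hn htn, Real.norm_eq_abs]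
  refine abs_sum_indicator_le 𝒯.disjoint hM (fun K _ => ?_) x
  rw [truncFam]
  split_ifs with h
  · exact hu n h K
  · simpa using hM

theorem eLpNorm_dualFun_le (hΩ : IsOpen Ω) (hΔ : 0 < Δt) {u : ℕ → 𝒯.DFun} {M : ℝ} (hM : 0 ≤ M)
    (hu : ∀ n ≤ numSteps T Δt, ∀ v : 𝒯.Vertex, v.1 ∈ Ω → |(u n).dual v| ≤ M) :
    eLpNorm (Function.uncurry (dualFun 𝒯 T Δt u)) ∞
      ((volume.restrict (Ioo 0 T)).prod (volume.restrict Ω)) ≤ ENNReal.ofReal M := by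
  classical
  rw [eLpNorm_exponent_top, Measure.prod_restrict]
  refine eLpNormEssSup_le_of_ae_bound
    (ae_restrict_of_forall_mem (measurableSet_Ioo.prod hΩ.measurableSet) ?_)
  rintro ⟨t, x⟩ ht
  obtain ⟨n, hn, htn⟩ := exists_step hΔ ht.1.1.le
  rw [Function.uncurry_apply_pair, dualFun_eq hΔ u hn htn, Real.norm_eq_abs]
  refine abs_sum_indicator_le (fun _ _ h => 𝒯.disjoint_dualCell h) hM (fun v hv => ?_) x
  rw [truncFam]
  split_ifs with h
  · exact hu n h v (Finset.mem_filter.1 hv).2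
  · simpa using hM

end

end DDFV

end

theorem proposition6p1 (d : ℕ) [NeZero d] (hd : d = 2 ∨ d = 3)
    (Ω : Set (DDFV.Pt d)) (hΩ : IsOpen Ω) (hΩb : Bornology.IsBounded Ω)
    (T : ℝ) (hT : 0 < T)
    (u₀ : DDFV.Pt d → ℝ) (hu₀ : MemLp u₀ ∞ (volume.restrict Ω))
    (S : ℝ → DDFV.Pt d → ℝ)
    (hS : AEStronglyMeasurable (Function.uncurry S)
      ((volume.restrict (Ioo 0 T)).prod (volume.restrict Ω)))
    (hS' : ∫⁻ t in Ioo 0 T, eLpNorm (S t) ∞ (volume.restrict Ω) ≠ ∞)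
    (p c : ℝ) (k : DDFV.Pt d → ℝ) (hk : DDFV.IsDiffusion p c k)
    (A : ℝ → ℝ) (hA : Continuous A) (hA' : Monotone A) (hA0 : A 0 = 0)
    (f : ℝ → DDFV.Pt d) (hf : Continuous f) (hf0 : f 0 = 0)
    (ω : ℝ → ℝ) (hω : DDFV.IsModulusOn f (DDFV.dataBound Ω T u₀ S) ω)
    (c' R : ℝ) :
    ∃ C : ℝ, 0 < C ∧ ∃ ωA : ℝ → ℝ,
      (ContinuousOn ωA (Ici 0) ∧ MonotoneOn ωA (Ici 0) ∧ ωA 0 = 0) ∧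
      ∀ (𝒯 : DDFV.Triangulation d Ω), 𝒯.IsDDFV → 𝒯.reg ≤ R →
      ∀ (Δt : ℝ), 0 < Δt →
      ∀ (g : 𝒯.PFlux) (gs : 𝒯.DFlux),
        (∀ D : 𝒯.Interface, DDFV.IsNumFlux f (DDFV.dataBound Ω T u₀ S) ω c' (𝒯.normal D)
          (g (Sum.inl D.K) D.L) (g D.L (Sum.inl D.K))) →
        (∀ v w, 𝒯.DualNbr v w → DDFV.IsNumFlux f (DDFV.dataBound Ω T u₀ S) ω c'
          (𝒯.dualNormal v w) (gs v w) (gs w v)) →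
      ∀ (u : ℕ → 𝒯.DFun), DDFV.IsDiscreteSolution 𝒯 T Δt u₀ S k A g gs u →
        -- (i) the `L^∞` bound
        (max
            (eLpNorm (Function.uncurry (DDFV.primalFun 𝒯 T Δt u)) ∞
              ((volume.restrict (Ioo 0 T)).prod (volume.restrict Ω)))
            (eLpNorm (Function.uncurry (DDFV.dualFun 𝒯 T Δt u)) ∞
              ((volume.restrict (Ioo 0 T)).prod (volume.restrict Ω)))
          ≤ ENNReal.ofReal (DDFV.dataBound Ω T u₀ S)) ∧
        -- (ii) the bounds on the discrete gradient and on the penalization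
        DDFV.gradNorm 𝒯 p T Δt (fun n => (u n).comp A) ≤ C ∧
        (∑ n ∈ Finset.Icc 1 (DDFV.numSteps T Δt),
          Δt * DDFV.penEnergy 𝒯 ((u n).comp A)) ≤ C ∧
        -- (iii) the weak BV bound
        (∑ n ∈ Finset.Icc 1 (DDFV.numSteps T Δt),
          Δt * (DDFV.Triangulation.dissPrimal g (u n) +
            DDFV.Triangulation.dissDual gs (u n))) ≤ C ∧
        -- (iv) the `L^1` time translates
        (∀ δ : ℝ, 0 < δ →
          ∫⁻ t in Ioo 0 T, ∫⁻ x in Ω, ENNReal.ofReal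
            (|DDFV.primalFun 𝒯 T Δt (fun n => (u n).comp A) (t + δ) x
                - DDFV.primalFun 𝒯 T Δt (fun n => (u n).comp A) t x| +
              |DDFV.dualFun 𝒯 T Δt (fun n => (u n).comp A) (t + δ) x
                - DDFV.dualFun 𝒯 T Δt (fun n => (u n).comp A) t x|)
            ≤ ENNReal.ofReal (ωA δ)) := by
  have hP : DDFV.IsProblem Ω T u₀ S p c k A f ω :=
    ⟨hd, hΩ, hΩb, hT, hu₀, hS, hS', hk, hA, hA', hA0, hf, hf0, hω⟩
  set M := DDFV.dataBound Ω T u₀ S with hMdef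
  have hM : 0 ≤ M := DDFV.dataBound_nonneg
  have hc := hk.pos
  have hp : 0 < p := one_pos.trans hk.one_lt
  have hB : 0 ≤ A M - A (-M) := sub_nonneg.2 (hA' (by linarith))
  have hΩ0 : 0 ≤ volume.real Ω := measureReal_nonneg
  have hE : 0 ≤ DDFV.energyBound Ω A M :=
    mul_nonneg hΩ0 (mul_nonneg (mul_nonneg zero_le_two hM) hB)
  have hE' : 0 ≤ DDFV.energyBound Ω id M := by
    refine mul_nonneg hΩ0 (mul_nonneg (mul_nonneg zero_le_two hM) ?_)
    simp only [id]
    linarith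
  obtain ⟨W, hW0, hW⟩ := hω.exists_bound
  choose! b hb0 hb using fun ε (hε : 0 < ε) => DDFV.exists_modulus_monotone hA hA' M hε
  have hV : 0 ≤ volume.real Ω / volume.real (DDFV.stdCorner d) :=
    div_nonneg measureReal_nonneg measureReal_nonneg
  have hH : 0 ≤ DDFV.translateBound Ω T c (|c'| * (2 * W)) M A := by
    unfold DDFV.translateBound
    positivity
  obtain ⟨ωA, hωA, hωA'⟩ := DDFV.exists_modulus_of_forall_le
    (a := d * volume.real Ω * T) (by positivity)
    (b := fun ε => d * (b ε * DDFV.translateBound Ω T c (|c'| * (2 * W)) M A +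
      volume.real Ω * (A M - A (-M))))
    (fun ε hε => by
      have := hb0 ε hε
      positivity)
  set C₁ := (c * DDFV.energyBound Ω A M) ^ (1 / p) with hC₁
  have hC₁0 : 0 ≤ C₁ := Real.rpow_nonneg (mul_nonneg hc.le hE) _
  refine ⟨C₁ + DDFV.energyBound Ω A M + DDFV.energyBound Ω id M + 1, by linarith, ωA, hωA, ?_⟩
  intro 𝒯 h𝒯 _ Δt hΔ g gs hg hgs u hu
  have h : DDFV.IsScheme 𝒯 T Δt u₀ S k A f ω c' g gs u := ⟨h𝒯, hΔ, hg, hgs, hu⟩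
  obtain ⟨hG, hpen⟩ := h.diffusion_bounds hP
  refine ⟨max_le ?_ ?_, ?_, ?_, ?_, ?_⟩
  · exact DDFV.eLpNorm_primalFun_le hΩ hΔ hM fun n hn K => h.abs_primal_le hP hn K
  · exact DDFV.eLpNorm_dualFun_le hΩ hΔ hM fun n hn v hv => h.abs_dual_le hP hn hv
  · have h1 : DDFV.gradNorm 𝒯 p T Δt (fun n => (u n).comp A) ≤ C₁ :=
      Real.rpow_le_rpow (Finset.sum_nonneg fun n _ => mul_nonneg hΔ.le
        (h.gradEnergy_nonneg hP ((u n).comp A))) hG (by positivity)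
    linarith
  · have h1 : ∑ n ∈ Finset.Icc 1 (DDFV.numSteps T Δt), Δt * DDFV.penEnergy 𝒯 ((u n).comp A) ≤
        DDFV.energyBound Ω A M := by
      refine le_trans (le_of_eq (Finset.sum_congr rfl fun n hn => ?_)) hpen
      rw [DDFV.Triangulation.penEnergy_eq hΩ hΩb ((h.vanishes hP hn).comp hA0)]
    linarith
  · have h1 := h.convection_bound hP
    linarith
  · intro δ hδ
    -- `δ = (q + τ) Δt` with `q` a natural number and `0 ≤ τ < 1`
    set q := ⌊δ / Δt⌋₊
    set τ := δ / Δt - q with hτ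
    have hτ0 : 0 ≤ τ := sub_nonneg.2 (Nat.floor_le (div_pos hδ hΔ).le)
    have hτ1 : τ < 1 := by
      have := Nat.lt_floor_add_one (δ / Δt)
      rw [hτ]
      linarith
    have hδ' : δ = (q + τ) * Δt := by
      rw [hτ]
      field_simp
      ring
    have h1 := DDFV.lintegral_lintegral_translate_le (T := T) hΩ hΩb hΔ
      (fun n => (u n).comp A) q hτ0 hτ1
    rw [← hδ'] at h1
    refine h1.trans (ENNReal.ofReal_le_ofReal (hωA' _ δ hδ.le fun ε hε => ?_))
    have h2 := mul_le_mul_of_nonneg_left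
      (h.sum_l1Dist_le hP hW0 hW hε.le (hb0 ε hε) (hb ε hε) q) (sub_nonneg.2 hτ1.le)
    have h3 := mul_le_mul_of_nonneg_left
      (h.sum_l1Dist_le hP hW0 hW hε.le (hb0 ε hε) (hb ε hε) (q + 1)) hτ0
    refine (add_le_add h2 h3).trans (le_of_eq ?_)
    rw [hδ']
    push_cast
    ring
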